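/- **Setting.** Let $\Omega=(-1,1)$, $s\in(0,1)$ and $r(x)=\operatorname{dist}(x,\partial\Omega)$. Put $$|v|_{H^s(\Omega)}^2=\int_\Omega\int_\Omega\frac{|v(x)-v(y)|^2}{|x-y|^{1+2s}}\,dy\,dx,\qquad \|v\|_{\widetilde H^s(\Omega)}^2=\|v\|_{L^2(\Omega)}^2+|v|_{H^s(\Omega)}^2+\|v/r^s\|_{L^2(\Omega)}^2,$$ $$a(u,v)=\frac{C(s)}2\int_{\mathbb R}\int_{\mathbb R}\frac{(u(x)-u(y))(v(x)-v(y))}{|x-y|^{1+2s}}\,dy\,dx,\qquad C(s)=-2^{2s}\frac{\Gamma(s+1/2)}{\pi^{1/2}\,\Gamma(-s)} .$$ A mesh $\mathcal T=\{T_i=(x_{i-1},x_i): i=1,\dots,M\}$ on $\Omega$ is given by nodes $-1=x_0<x_1<\dots<x_M=1$; write $h_T$ for the length of $T$ and $\#\mathcal T=M$. For $\gamma>0$ the mesh is $\gamma$-shape regular if $\gamma\,h_T\le h_{T'}$ for all $T,T'\in\mathcal T$ with $\overline T\cap\overline{T'}\ne\emptyset$. For an integer $p\ge 0$, $S_0^{p,1}(\mathcal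 T)$ is the space of $u\in H^1_0(\Omega)$, extended by zero to $\mathbb R$, such that $u|_T$ is a polynomial of degree at most $p$ for every $T\in\mathcal T$. For $T=(x_\ell,x_r)\in\mathcal T$ let $\hat v_T(x)=v(x_\ell+x\,h_T)$, $x\in(0,1)$. For $\alpha,\beta>-1$, $GJ_n^{\alpha,\beta}$ is the $n$-point Gaussian quadrature rule on $(0,1)$ for the weight $(1-x)^\alpha x^\beta$ (its nodes are the zeros of the $n$-th orthogonal polynomial, its weights the weighted integrals of the Lagrange polynomials of the nodes), and $GL_n=GJ_n^{0,0}$; for $n=0$ these rules are zero. A subscript $x$ or $y$ names the variable that the rule acts on. **The approximate form.** Define $\widetilde a_n(u,v)=\frac{C(s)}2\Big(\sum_{T,T'\in\mathcal T}Q^n_{T,T'}(u,v)+2\sum_{T\in\mathcal T}Q^n_{T,\Omega^c}(u,v)\Big)$ as follows. * Identical elements: $$Q^n_{T,T}(u,v)=2h_T^{1-2s}\,GJ_{n,x}^{0,2-2s}\circ GJ_{n,y}^{1-2s,0}\Big(\tfrac{(\hat u_T(x)-\hat u_T(xy))(\hat v_T(x)-\hat v_T(xy))}{|x-xy|^2}\Big).$$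 * $T\neq T'$, $\overline T\cap\overline{T'}\ne\emptyset$, $T$ to the left of $T'$: $$Q^n_{T,T'}(u,v)=h_Th_{T'}\Big(GJ_{n,x}^{0,2-2s}\circ GL_{n,y}\Big(\tfrac{(\hat u_T(1-x)-\hat u_{T'}(xy))(\hat v_T(1-x)-\hat v_{T'}(xy))}{|h_T+yh_{T'}|^{1+2s}x^2}\Big)+GL_{n,x}\circ GJ_{n,y}^{0,2-2s}\Big(\tfrac{(\hat u_T(1-xy)-\hat u_{T'}(y))(\hat v_T(1-xy)-\hat v_{T'}(y))}{|xh_T+h_{T'}|^{1+2s}y^2}\Big)\Big).$$ * $\overline T\cap\overline{T'}=\emptyset$, $T$ to the left of $T'$: $$Q^n_{T,T'}(u,v)=h_Th_{T'}\,GL_{n,x}\circ GL_{n,y}\Big(\tfrac{(\hat u_T(x)-\hat u_{T'}(y))(\hat v_T(x)-\hat v_{T'}(y))}{|(1-x)h_T+\operatorname{dist}(T,T')+yh_{T'}|^{1+2s}}\Big).$$ * If $T$ lies to the right of $T'$, then $Q^n_{T,T'}(u,v)=Q^n_{T',T}(u,v)$. * Complement: $Q^n_{T,\Omega^c}(u,v)=\frac{h_T}{2s}(L_T+R_T)$,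 where $$L_T=\begin{cases}GJ_n^{0,2-2s}\Big(\tfrac{\hat u_T(x)\hat v_T(x)}{x^2h_T^{2s}}\Big),&-1\in\overline T,\\ GL_n\Big(\tfrac{\hat u_T(x)\hat v_T(x)}{|\operatorname{dist}(T,\{-1\})+xh_T|^{2s}}\Big),&-1\notin\overline T,\end{cases}\qquad R_T=\begin{cases}GJ_n^{2-2s,0}\Big(\tfrac{\hat u_T(x)\hat v_T(x)}{(1-x)^2h_T^{2s}}\Big),&1\in\overline T,\\ GL_n\Big(\tfrac{\hat u_T(x)\hat v_T(x)}{|\operatorname{dist}(T,\{1\})+(1-x)h_T|^{2s}}\Big),&1\notin\overline T.\end{cases}$$ **Lemma (consistency error for $a$).** For every $\gamma>0$ there is a constant $\rho>1$ depending only on $\gamma$, and for every $s\in(0,1)$ there is a constant $C_{s,\gamma}>0$ depending only on $s$ and $\gamma$, such that for every $\gamma$-shape regular mesh $\mathcal T$ on $\Omega$, all integers $r,p,n\ge 0$, all $u\in S_0^{r,1}(\mathcal T)$ and all $v\in S_0^{p,1}(\mathcal T)$, $$|a(u,v)-\widetilde a_n(u,v)|\le C_{s,\gamma}\,(\#\mathcal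 T)^2\,\rho^{\,r+p-2n+1}\,r^3p^3\,\|u\|_{\widetilde H^s(\Omega)}\,\|v\|_{\widetilde H^s(\Omega)} .$$ -/

import Mathlib

open MeasureTheory Set

open scoped ContDiff ENNReal

noncomputable section

namespace FracLap

/-! ### Sobolev spaces on the interval `(-1, 1)` -/

/-- The domain `Ω = (-1, 1)`. -/
def Om : Set ℝ := Ioo (-1) 1

/-- Test functions: smooth functions with compact support contained in `Ω`. -/
def IsTest (φ : ℝ → ℝ) : Prop :=
  ContDiff ℝ ∞ φ ∧ HasCompactSupport φ ∧ tsupport φ ⊆ Om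

/-- `g` is the weak derivative of `u` on `Ω`, with `u` and `g` both in `L²(Ω)`. -/
def HasWeakDerivL2 (u g : ℝ → ℝ) : Prop :=
  MemLp u 2 (volume.restrict Om) ∧ MemLp g 2 (volume.restrict Om) ∧
    ∀ φ : ℝ → ℝ, IsTest φ → ∫ x in Om, u x * deriv φ x = -∫ x in Om, g x * φ x

/-- `u ∈ H¹(Ω)`. -/
def MemH1 (u : ℝ → ℝ) : Prop := ∃ g : ℝ → ℝ, HasWeakDerivL2 u g

/-- `u ∈ H¹₀(Ω)`: `u` lies in the closure of the test functions with respect to the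
`H¹(Ω)`-norm. -/
def MemH10 (u : ℝ → ℝ) : Prop :=
  ∃ g : ℝ → ℝ, HasWeakDerivL2 u g ∧ ∀ ε : ℝ≥0∞, 0 < ε → ∃ φ : ℝ → ℝ, IsTest φ ∧
    eLpNorm (fun x => u x - φ x) 2 (volume.restrict Om) < ε ∧
    eLpNorm (fun x => g x - deriv φ x) 2 (volume.restrict Om) < ε

/-- The square of the Aronszajn-Slobodeckij seminorm `|v|_{H^t(Ω)}`. -/
def slobSq (t : ℝ) (v : ℝ → ℝ) : ℝ :=
  ∫ x in Om, ∫ y in Om, |v x - v y| ^ 2 / |x - y| ^ (1 + 2 * t)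

/-- The distance `r(x)` of `x` to `∂Ω`. -/
def bdryDist (x : ℝ) : ℝ := Metric.infDist x (frontier Om)

/-- The norm of `H̃^t(Ω)`:
`‖v‖² = ‖v‖²_{L²(Ω)} + |v|²_{H^t(Ω)} + ‖v / r^t‖²_{L²(Ω)}`. -/
def tildeNorm (t : ℝ) (v : ℝ → ℝ) : ℝ :=
  Real.sqrt ((∫ x in Om, |v x| ^ 2) + slobSq t v + ∫ x in Om, |v x / bdryDist x ^ t| ^ 2)

/-! ### The bilinear form -/

/-- The normalisation constant of the integral fractional Laplacian. -/
def Cs (s : ℝ) : ℝ :=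
  -((2 : ℝ) ^ (2 * s) * Real.Gamma (s + 1 / 2) / (Real.pi ^ (1 / 2 : ℝ) * Real.Gamma (-s)))

/-- The bilinear form `a(u, v)`; functions on `Ω` are extended by zero to `ℝ`. -/
def formA (s : ℝ) (u v : ℝ → ℝ) : ℝ :=
  Cs s / 2 * ∫ x : ℝ, ∫ y : ℝ, (u x - u y) * (v x - v y) / |x - y| ^ (1 + 2 * s)

/-! ### Meshes and spline spaces -/

/-- A mesh on `Ω = (-1, 1)`: nodes `-1 = x₀ < x₁ < ⋯ < x_M = 1`. -/
structure Mesh where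
  M : ℕ
  node : Fin (M + 1) → ℝ
  strictMono : StrictMono node
  node_zero : node 0 = -1
  node_last : node (Fin.last M) = 1

namespace Mesh

variable (𝒯 : Mesh)

/-- Left endpoint of an element. -/
def lo (i : Fin 𝒯.M) : ℝ := 𝒯.node i.castSucc

/-- Right endpoint of an element. -/
def hi (i : Fin 𝒯.M) : ℝ := 𝒯.node i.succ

/-- The (open) elements of the mesh, numbered from left to right. -/
def elt (i : Fin 𝒯.M) : Set ℝ := Ioo (𝒯.lo i) (𝒯.hi i)

/-- The length of an element. -/
def h (i : Fin 𝒯.M) : ℝ := 𝒯.hi i - 𝒯.lo i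

/-- The closures of two elements meet. -/
def Touch (i j : Fin 𝒯.M) : Prop := (closure (𝒯.elt i) ∩ closure (𝒯.elt j)).Nonempty

/-- `γ`-shape regularity. -/
def ShapeRegular (γ : ℝ) : Prop := ∀ i j : Fin 𝒯.M, 𝒯.Touch i j → γ * 𝒯.h i ≤ 𝒯.h j

/-- The spline space `S^{p,1}(𝒯)`. -/
def spline (p : ℕ) : Set (ℝ → ℝ) :=
  {u | MemH1 u ∧ ∀ i : Fin 𝒯.M, ∃ q : Polynomial ℝ, q.natDegree ≤ p ∧
    ∀ x ∈ 𝒯.elt i, u x = q.eval x}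

/-- The spline space `S₀^{p,1}(𝒯) = S^{p,1}(𝒯) ∩ H¹₀(Ω)`, its elements being extended by
zero outside `Ω`. -/
def spline0 (p : ℕ) : Set (ℝ → ℝ) :=
  {u | u ∈ 𝒯.spline p ∧ MemH10 u ∧ ∀ x, x ∉ Om → u x = 0}

/-- The pullback of `v` to the reference element `(0, 1)`. -/
def pull (i : Fin 𝒯.M) (v : ℝ → ℝ) : ℝ → ℝ := fun x => v (𝒯.lo i + x * 𝒯.h i)

end Mesh

/-! ### Gaussian quadrature on `(0, 1)` -/

/-- The `w`-weighted `L²(0,1)` inner product of polynomials. -/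
def wInner (w : ℝ → ℝ) (f g : Polynomial ℝ) : ℝ :=
  ∫ x in (0 : ℝ)..1, w x * (f.eval x * g.eval x)

/-- The monic orthogonal polynomial of degree `n` for the weight `w` on `(0,1)`, obtained by
applying the Gram-Schmidt process to `1, X, X², …`. -/
def orthoPoly (w : ℝ → ℝ) (n : ℕ) : Polynomial ℝ :=
  Polynomial.X ^ n - ∑ k : Fin n,
    Polynomial.C (wInner w (Polynomial.X ^ n) (orthoPoly w k) /
      wInner w (orthoPoly w k) (orthoPoly w k)) * orthoPoly w k
termination_by n
decreasing_by all_goals exact k.2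

/-- The `n` Gaussian quadrature nodes for the weight `w`: the zeros of the orthogonal
polynomial of degree `n`. -/
def gaussNodes (w : ℝ → ℝ) (n : ℕ) : Finset ℝ := (orthoPoly w n).roots.toFinset

/-- The Gaussian quadrature weight belonging to the node `ξ`: the weighted integral of the
Lagrange interpolation polynomial of `ξ`. -/
def gaussWeight (w : ℝ → ℝ) (n : ℕ) (ξ : ℝ) : ℝ :=
  ∫ x in (0 : ℝ)..1, w x * (Lagrange.basis (gaussNodes w n) id ξ).eval x

/-- The `n`-point Gaussian quadrature rule for the weight `w`. -/
def gauss (w : ℝ → ℝ) (n : ℕ) (Φ : ℝ → ℝ) : ℝ :=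
  ∑ ξ ∈ gaussNodes w n, gaussWeight w n ξ * Φ ξ

/-- Gauss-Legendre quadrature (weight `1`). -/
def gaussLeg (n : ℕ) (Φ : ℝ → ℝ) : ℝ := gauss (fun _ => 1) n Φ

/-- Gauss-Jacobi quadrature (weight `(1 - x)^α x^β`). -/
def gaussJac (α β : ℝ) (n : ℕ) (Φ : ℝ → ℝ) : ℝ := gauss (fun x => (1 - x) ^ α * x ^ β) n Φ

/-! ### The approximate bilinear form -/

namespace Mesh

variable (𝒯 : Mesh) (s : ℝ) (n : ℕ) (u v : ℝ → ℝ)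

/-- Quadrature for a pair of identical elements. -/
def QId (i : Fin 𝒯.M) : ℝ :=
  2 * 𝒯.h i ^ (1 - 2 * s) *
    gaussJac 0 (2 - 2 * s) n fun x => gaussJac (1 - 2 * s) 0 n fun y =>
      (𝒯.pull i u x - 𝒯.pull i u (x * y)) * (𝒯.pull i v x - 𝒯.pull i v (x * y)) /
        |x - x * y| ^ 2

/-- Quadrature for adjacent elements, the element `i` being the left neighbour of `j`. -/
def QAdj (i j : Fin 𝒯.M) : ℝ :=
  𝒯.h i * 𝒯.h j *
    ((gaussJac 0 (2 - 2 * s) n fun x => gaussLeg n fun y =>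
        (𝒯.pull i u (1 - x) - 𝒯.pull j u (x * y)) *
          (𝒯.pull i v (1 - x) - 𝒯.pull j v (x * y)) /
          (|𝒯.h i + y * 𝒯.h j| ^ (1 + 2 * s) * x ^ 2)) +
      (gaussLeg n fun x => gaussJac 0 (2 - 2 * s) n fun y =>
        (𝒯.pull i u (1 - x * y) - 𝒯.pull j u y) *
          (𝒯.pull i v (1 - x * y) - 𝒯.pull j v y) /
          (|x * 𝒯.h i + 𝒯.h j| ^ (1 + 2 * s) * y ^ 2)))

/-- Quadrature for separated elements, the element `i` lying to the left of `j`; the distance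
of the two elements is `lo j - hi i`. -/
def QSep (i j : Fin 𝒯.M) : ℝ :=
  𝒯.h i * 𝒯.h j * gaussLeg n fun x => gaussLeg n fun y =>
    (𝒯.pull i u x - 𝒯.pull j u y) * (𝒯.pull i v x - 𝒯.pull j v y) /
      |(1 - x) * 𝒯.h i + (𝒯.lo j - 𝒯.hi i) + y * 𝒯.h j| ^ (1 + 2 * s)

open Classical in
/-- The approximation of the double integral over the product of two elements. If the first
element lies to the right of the second one, the two elements change their roles. -/
def Q (i j : Fin 𝒯.M) : ℝ :=
  if i = j then 𝒯.QId s n u v i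
  else if 𝒯.Touch i j then
    if i < j then 𝒯.QAdj s n u v i j else 𝒯.QAdj s n u v j i
  else
    if i < j then 𝒯.QSep s n u v i j else 𝒯.QSep s n u v j i

open Classical in
/-- The approximation of the integral over the product of an element with the complement of
`Ω`. The first summand belongs to `(-∞, -1]`, the second one to `[1, ∞)`; the distances of the
element to `-1` and `1` are `lo i + 1` and `1 - hi i`. -/
def QComp (i : Fin 𝒯.M) : ℝ :=
  𝒯.h i / (2 * s) *
    ((if (-1 : ℝ) ∈ closure (𝒯.elt i) then
        gaussJac 0 (2 - 2 * s) n fun x =>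
          𝒯.pull i u x * 𝒯.pull i v x / (x ^ 2 * 𝒯.h i ^ (2 * s))
      else
        gaussLeg n fun x =>
          𝒯.pull i u x * 𝒯.pull i v x / |(𝒯.lo i + 1) + x * 𝒯.h i| ^ (2 * s)) +
     (if (1 : ℝ) ∈ closure (𝒯.elt i) then
        gaussJac (2 - 2 * s) 0 n fun x =>
          𝒯.pull i u x * 𝒯.pull i v x / ((1 - x) ^ 2 * 𝒯.h i ^ (2 * s))
      else
        gaussLeg n fun x =>
          𝒯.pull i u x * 𝒯.pull i v x / |(1 - 𝒯.hi i) + (1 - x) * 𝒯.h i| ^ (2 * s)))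

/-- The approximate bilinear form `ã_n(u, v)`. -/
def approxForm : ℝ :=
  Cs s / 2 * ((∑ i : Fin 𝒯.M, ∑ j : Fin 𝒯.M, 𝒯.Q s n u v i j) +
    2 * ∑ i : Fin 𝒯.M, 𝒯.QComp s n u v i)

end Mesh

end FracLap

end

/-! The form and its approximation split in the same way into pairs of elements and, for the
complement, into boundary contributions of single elements; it suffices to bound each local
quadrature error, and summing over the pairs costs $(\#\mathcal T)^2$.

Every local integral becomes a weighted integral over the unit square (or interval) of $f\,g\,k$.
The factors $f,g$ are polynomials of degree at most $r$ and $p$ in each variable, coming from $u$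
and $v$, and $k$ is a smooth kernel. On identical or adjacent elements the Duffy transformation
produces this form: differences of $u$ and $v$ are divisible by the singular variable
(`exists_biPoly_slope`, `exists_biPoly_adjacent`), and the remaining singular powers are exactly the
Jacobi weights of the rules. At the endpoints of $\Omega$ the zero boundary values play the same
role.

An $n$-point Gauss rule is exact up to degree $2n-1$ (`IsWeight.gauss_eval`) and has nonnegative
weights (`IsWeight.gaussWeight_nonneg`). So its error on $fgk$ is at most twice the mass of the
weights times $\sup|fg|$ times the best approximation error of $k$ by polynomials of degree
$2n-1-(r+p)$ (`abs_dInt_sub_dGauss_le`). The kernels are negative powers of affine functions. Shape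
regularity bounds their relative variation around the centre by $1/(1+\gamma)$, so the truncated
binomial series converges geometrically at the rate `rate γ`, which does not involve $s$
(`exists_kernelApprox_affine`). This gives $\rho$ as the inverse of `rate γ`; $s$ enters only
through constants.

To bound $\sup|fg|$ by the norms, Markov's inequality (a factor $n^2$) and the inverse estimate from
$L^2$ to $L^\infty$ (a factor $n$) bound derivatives of polynomials on $(0,1)$; this explains $r^3$
and $p^3$. The $L^2$ quantities on the reference element are controlled by the Slobodeckij seminorm,
after replacing $|x-y|$ by its maximum over the pair, or by the weighted term $\|v/r^s\|$ near the
complement. The powers of the element lengths cancel in `error_of_weighted_bounds`.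

An element of the spline space is a function fixed only up to null sets. It is replaced by its
continuous representative in the integrals, while the rules sample interior points of elements only,
where both functions agree. Degree zero forces $u=0$, so one may work with degree $\max(r,1)$. -/

namespace FracLap

open Polynomial

/-! ### Gaussian quadrature -/

/-- Admissible weights on `(0, 1)`: measurable, positive and integrable. -/
structure IsWeight (w : ℝ → ℝ) : Prop where
  meas : Measurable w
  pos : ∀ x ∈ Ioo (0 : ℝ) 1, 0 < w x
  int : IntegrableOn w (Ioo (0 : ℝ) 1)

/-- The measure on `(0, 1)` with density `w`. -/
noncomputable def wMeas (w : ℝ → ℝ) : Measure ℝ :=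
  (volume.restrict (Ioo (0 : ℝ) 1)).withDensity fun x => ENNReal.ofReal (w x)

lemma wMeas_ae_mem (w : ℝ → ℝ) : ∀ᵐ x ∂(wMeas w), x ∈ Ioo (0 : ℝ) 1 :=
  (withDensity_absolutelyContinuous _ _).ae_le (ae_restrict_mem measurableSet_Ioo)

namespace IsWeight

variable {w : ℝ → ℝ} (hw : IsWeight w)
include hw

lemma isFiniteMeasure : IsFiniteMeasure (wMeas w) := isFiniteMeasure_withDensity_ofReal hw.int.2

lemma integral_wMeas (f : ℝ → ℝ) :
    ∫ x, f x ∂(wMeas w) = ∫ x in Ioo (0 : ℝ) 1, w x * f x := by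
  rw [wMeas, integral_withDensity_eq_integral_toReal_smul hw.meas.ennreal_ofReal (by simp)]
  refine setIntegral_congr_fun measurableSet_Ioo fun x hx => ?_
  simp [ENNReal.toReal_ofReal (hw.pos x hx).le]

lemma integral_wMeas_interval (f : ℝ → ℝ) :
    ∫ x in (0 : ℝ)..1, w x * f x = ∫ x, f x ∂(wMeas w) := by
  rw [hw.integral_wMeas, intervalIntegral.integral_of_le zero_le_one, integral_Ioc_eq_integral_Ioo]

lemma integrable_eval (f : ℝ[X]) : Integrable (fun x => f.eval x) (wMeas w) := by
  have := hw.isFiniteMeasure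
  obtain ⟨C, hC⟩ := isCompact_Icc.exists_bound_of_continuousOn
    (f := fun x => f.eval x) (s := Icc (0 : ℝ) 1) f.continuous.continuousOn
  refine Integrable.of_bound f.continuous.aestronglyMeasurable C ?_
  filter_upwards [wMeas_ae_mem w] with x hx using hC x (Ioo_subset_Icc_self hx)

lemma wInner_eq (f g : ℝ[X]) : wInner w f g = ∫ x, (f * g).eval x ∂(wMeas w) := by
  simp only [wInner, eval_mul]
  exact hw.integral_wMeas_interval _

/-- A nonzero polynomial has finitely many roots. If its support were a null set for the weighted
measure, $(0,1)$ would be covered by a Lebesgue null set and these roots. -/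
lemma integral_eval_pos {f : ℝ[X]} (hf : f ≠ 0) (h0 : ∀ x ∈ Ioo (0 : ℝ) 1, 0 ≤ f.eval x) :
    0 < ∫ x, f.eval x ∂(wMeas w) := by
  have hnn : 0 ≤ᵐ[wMeas w] fun x => f.eval x := by
    filter_upwards [wMeas_ae_mem w] with x hx using h0 x hx
  rw [integral_pos_iff_support_of_nonneg_ae hnn (hw.integrable_eval f)]
  by_contra hcon
  have hz : wMeas w (Function.support fun x => f.eval x) = 0 := by simpa using hcon
  rw [wMeas, withDensity_apply_eq_zero hw.meas.ennreal_ofReal,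
    Measure.restrict_apply' measurableSet_Ioo] at hz
  have hfin : volume ((f.roots.toFinset : Set ℝ)) = 0 := (Finset.finite_toSet _).measure_zero _
  have : volume (Ioo (0 : ℝ) 1) = 0 := by
    refine measure_mono_null ?_ (measure_union_null hz hfin)
    intro x hx
    by_cases hr : f.eval x = 0
    · right; simp [hf, hr]
    · left
      refine ⟨⟨?_, hr⟩, hx⟩
      simpa using hw.pos x hx
  simp at this

lemma wInner_self_pos {f : ℝ[X]} (hf : f ≠ 0) : 0 < wInner w f f := by
  rw [hw.wInner_eq]
  refine hw.integral_eval_pos (mul_ne_zero hf hf) fun x _ => ?_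
  rw [eval_mul]; exact mul_self_nonneg _

lemma wInner_add (f g k : ℝ[X]) : wInner w f (g + k) = wInner w f g + wInner w f k := by
  simp only [hw.wInner_eq, mul_add, eval_add]
  rw [integral_add (hw.integrable_eval _) (hw.integrable_eval _)]

lemma wInner_C_mul (f g : ℝ[X]) (c : ℝ) : wInner w f (C c * g) = c * wInner w f g := by
  simp only [hw.wInner_eq, eval_mul, eval_C]
  rw [← integral_const_mul]
  congr 1; ext x; ring

lemma wInner_comm (f g : ℝ[X]) : wInner w f g = wInner w g f := by
  simp only [hw.wInner_eq, mul_comm]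

lemma wInner_sum {ι : Type*} (s : Finset ι) (f : ℝ[X]) (g : ι → ℝ[X]) :
    wInner w f (∑ i ∈ s, g i) = ∑ i ∈ s, wInner w f (g i) := by
  classical
  induction s using Finset.induction_on with
  | empty => simp [hw.wInner_eq]
  | insert a s ha ih => rw [Finset.sum_insert ha, hw.wInner_add, ih, Finset.sum_insert ha]

end IsWeight

/-! ### Orthogonal polynomials -/

lemma degree_C_mul_le_degree (c : ℝ) (f : ℝ[X]) : (C c * f).degree ≤ f.degree := by
  rw [← smul_eq_C_mul]; exact degree_smul_le c f

lemma orthoPoly_degree_sum (w : ℝ → ℝ) (n : ℕ) (h : ∀ k < n, (orthoPoly w k).degree = k) :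
    (∑ k : Fin n, C (wInner w (X ^ n) (orthoPoly w k) /
      wInner w (orthoPoly w k) (orthoPoly w k)) * orthoPoly w k).degree < (n : ℕ) := by
  refine (degree_sum_le _ _).trans_lt ?_
  rw [Finset.sup_lt_iff (by exact WithBot.bot_lt_coe n)]
  intro k _
  refine (degree_C_mul_le_degree _ _).trans_lt ?_
  rw [h k k.2]
  exact_mod_cast k.2

lemma orthoPoly_monic_degree (w : ℝ → ℝ) (n : ℕ) :
    (orthoPoly w n).Monic ∧ (orthoPoly w n).degree = n := by
  induction n using Nat.strong_induction_on with
  | _ n ih =>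
    have hd := orthoPoly_degree_sum w n fun k hk => (ih k hk).2
    rw [orthoPoly]
    constructor
    · exact monic_X_pow_sub (by simpa using hd)
    · rw [degree_sub_eq_left_of_degree_lt, degree_X_pow]
      rwa [degree_X_pow]

lemma orthoPoly_monic (w : ℝ → ℝ) (n : ℕ) : (orthoPoly w n).Monic := (orthoPoly_monic_degree w n).1

lemma orthoPoly_natDegree (w : ℝ → ℝ) (n : ℕ) : (orthoPoly w n).natDegree = n :=
  natDegree_eq_of_degree_eq_some (orthoPoly_monic_degree w n).2

namespace IsWeight

variable {w : ℝ → ℝ} (hw : IsWeight w)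
include hw

/-- In the Gram-Schmidt sum only the $k$-th projection survives pairing with the $k$-th polynomial,
and it cancels the contribution of $X^n$. The other terms vanish by the induction hypothesis, used
at the larger of the two indices. -/
lemma orthoPoly_orthogonal (n : ℕ) : ∀ k < n, wInner w (orthoPoly w k) (orthoPoly w n) = 0 := by
  induction n using Nat.strong_induction_on with
  | _ n ih =>
    intro k hk
    have hneg : ∀ f : ℝ[X], ∀ g : ℝ[X], f - g = f + C (-1) * g := by intro f g; simp [sub_eq_add_neg]
    rw [orthoPoly.eq_1 w n, hneg, hw.wInner_add, hw.wInner_C_mul, hw.wInner_sum,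
      Finset.sum_eq_single (⟨k, hk⟩ : Fin n)]
    · rw [hw.wInner_C_mul, div_mul_cancel₀ _ (hw.wInner_self_pos (orthoPoly_monic w k).ne_zero).ne',
        hw.wInner_comm (X ^ n)]
      ring
    · intro j _ hj
      rw [hw.wInner_C_mul]
      have hjk : (j : ℕ) ≠ k := fun h => hj (Fin.ext h)
      rcases lt_or_gt_of_ne hjk with h | h
      · rw [hw.wInner_comm (orthoPoly w k), ih k hk j h, mul_zero]
      · rw [ih j j.2 k h, mul_zero]
    · simp

/-- Since the orthogonal polynomials are monic with one in each degree, subtracting the leading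
coefficient times the polynomial of degree $m$ lowers the degree bound by one without changing the
inner product. -/
lemma orthoPoly_wInner_eq_zero (n : ℕ) (f : ℝ[X]) (hf : f.degree < n) :
    wInner w (orthoPoly w n) f = 0 := by
  have key : ∀ m ≤ n, ∀ f : ℝ[X], f.degree < m → wInner w (orthoPoly w n) f = 0 := by
    intro m
    induction m with
    | zero =>
      intro _ f hf
      have : f = 0 := by
        rw [← degree_eq_bot]
        simpa [Nat.WithBot.lt_zero_iff] using hf
      simp [this, hw.wInner_eq]
    | succ m ih =>
      intro hm f hf
      have hdec : f = (f - C (f.coeff m) * orthoPoly w m) + C (f.coeff m) * orthoPoly w m := by ring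
      rw [hdec, hw.wInner_add, hw.wInner_C_mul, hw.wInner_comm _ (orthoPoly w m),
        hw.orthoPoly_orthogonal n m hm, mul_zero, add_zero]
      refine ih (by omega) _ ?_
      rw [degree_lt_iff_coeff_zero] at hf ⊢
      intro j hj
      rcases hj.eq_or_lt with rfl | hj
      · have := (orthoPoly_monic w m).coeff_natDegree
        rw [orthoPoly_natDegree] at this
        simp [this]
      · rw [coeff_sub, coeff_C_mul, hf j hj, coeff_eq_zero_of_natDegree_lt (p := orthoPoly w m)
          (by rw [orthoPoly_natDegree]; exact hj)]
        simp
  exact key n le_rfl f hf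

end IsWeight

/-! ### Location of the Gauss nodes -/

lemma exists_sign_of_no_root {f : ℝ[X]} (h : ∀ x ∈ Ioo (0 : ℝ) 1, f.eval x ≠ 0) :
    ∃ ε : ℝ, ε ≠ 0 ∧ ∀ x ∈ Ioo (0 : ℝ) 1, 0 ≤ ε * f.eval x := by
  by_cases hpos : ∀ x ∈ Ioo (0 : ℝ) 1, 0 ≤ f.eval x
  · exact ⟨1, one_ne_zero, by simpa using hpos⟩
  push Not at hpos
  obtain ⟨a, ha, hfa⟩ := hpos
  refine ⟨-1, by norm_num, fun x hx => ?_⟩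
  by_contra hcon
  have hfx : 0 < f.eval x := by linarith
  obtain ⟨c, hc, hc0⟩ := isPreconnected_Ioo.intermediate_value ha hx
    (f.continuous.continuousOn (s := Ioo (0 : ℝ) 1)) ⟨hfa.le, hfx.le⟩
  exact h c hc hc0

/-- `S` collects the points of $(0,1)$ where $f$ changes sign, that is, the roots of odd
multiplicity. Multiplying by the corresponding linear factors makes all multiplicities even. Linear
factors are split off one at a time, each toggling the membership of its root in `S`. -/
lemma exists_nodal_sign (f : ℝ[X]) (hf : f ≠ 0) :
    ∃ S : Finset ℝ, (∀ ξ ∈ S, ξ ∈ Ioo (0 : ℝ) 1 ∧ f.eval ξ = 0) ∧ ∃ ε : ℝ, ε ≠ 0 ∧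
      ∀ x ∈ Ioo (0 : ℝ) 1, 0 ≤ ε * (f.eval x * ∏ ξ ∈ S, (x - ξ)) := by
  classical
  induction hn : f.natDegree using Nat.strong_induction_on generalizing f with
  | _ n ih =>
    by_cases hroot : ∃ ξ ∈ Ioo (0 : ℝ) 1, f.eval ξ = 0
    · obtain ⟨ξ, hξ, h0⟩ := hroot
      obtain ⟨g, rfl⟩ := dvd_iff_isRoot.2 h0
      have hg : g ≠ 0 := right_ne_zero_of_mul hf
      have hdeg : g.natDegree < n := by
        rw [← hn, natDegree_mul (X_sub_C_ne_zero ξ) hg, natDegree_X_sub_C]; omega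
      obtain ⟨S, hS, ε, hε, hsign⟩ := ih _ hdeg g hg rfl
      -- A root already in `S` acquires even multiplicity and leaves the set; the leftover square
      -- $(x-\xi)^2$ comes from `f` itself. Otherwise the root enters the set.
      by_cases hmem : ξ ∈ S
      · refine ⟨S.erase ξ, fun η hη => ?_, ε, hε, fun x hx => ?_⟩
        · have := hS η (Finset.mem_of_mem_erase hη)
          exact ⟨this.1, by simp [this.2]⟩
        · have := hsign x hx
          rw [← Finset.mul_prod_erase S _ hmem] at this
          simp only [eval_mul, eval_sub, eval_X, eval_C]
          calc (0 : ℝ) ≤ _ := this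
            _ = _ := by ring
      · refine ⟨insert ξ S, fun η hη => ?_, ε, hε, fun x hx => ?_⟩
        · rcases Finset.mem_insert.1 hη with rfl | h
          · exact ⟨hξ, h0⟩
          · exact ⟨(hS η h).1, by simp [(hS η h).2]⟩
        · rw [Finset.prod_insert hmem]
          simp only [eval_mul, eval_sub, eval_X, eval_C]
          have := mul_nonneg (mul_self_nonneg (x - ξ)) (hsign x hx)
          calc (0 : ℝ) ≤ _ := this
            _ = _ := by ring
    · push Not at hroot
      obtain ⟨ε, hε, h⟩ := exists_sign_of_no_root hroot
      exact ⟨∅, by simp, ε, hε, by simpa using h⟩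

namespace IsWeight

variable {w : ℝ → ℝ} (hw : IsWeight w)
include hw

/-- With fewer than $n$ sign changes in $(0,1)$, the nodal polynomial of these points would have
degree below $n$, hence be orthogonal to the orthogonal polynomial. Up to a constant factor their
product has one sign and is nonzero, so its weighted integral cannot vanish. Thus there are $n$ sign
changes, and they exhaust the roots. -/
lemma card_and_mem_gaussNodes (n : ℕ) :
    (gaussNodes w n).card = n ∧ ∀ ξ ∈ gaussNodes w n, ξ ∈ Ioo (0 : ℝ) 1 := by
  classical
  have hP0 := (orthoPoly_monic w n).ne_zero
  obtain ⟨S, hS, ε, hε, hsign⟩ := exists_nodal_sign (orthoPoly w n) hP0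
  have hsub : S ⊆ gaussNodes w n := fun ξ hξ => by
    simp only [gaussNodes, Multiset.mem_toFinset, mem_roots hP0]; exact (hS ξ hξ).2
  have hle : (gaussNodes w n).card ≤ n := by
    refine (Multiset.toFinset_card_le _).trans ((card_roots' _).trans ?_)
    rw [orthoPoly_natDegree]
  have hge : n ≤ S.card := by
    by_contra hlt
    push Not at hlt
    set π : ℝ[X] := C ε * Lagrange.nodal S id with hπ
    have hπ0 : π ≠ 0 := mul_ne_zero (by simpa using hε) Lagrange.nodal_ne_zero
    have hdeg : π.degree < n := by
      refine (degree_C_mul_le_degree _ _).trans_lt ?_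
      rw [Lagrange.degree_nodal]; exact_mod_cast hlt
    have h0 := hw.orthoPoly_wInner_eq_zero n π hdeg
    have hpos := hw.integral_eval_pos (mul_ne_zero hP0 hπ0) fun x hx => by
      have := hsign x hx
      simp only [hπ, eval_mul, eval_C, Lagrange.eval_nodal, id]
      convert this using 1; ring
    rw [← hw.wInner_eq, h0] at hpos
    exact lt_irrefl _ hpos
  have hSeq : S = gaussNodes w n := Finset.eq_of_subset_of_card_le hsub (hle.trans hge)
  refine ⟨le_antisymm hle (hge.trans (Finset.card_le_card hsub)), fun ξ hξ => (hS ξ ?_).1⟩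
  rwa [hSeq]

/-! ### Exactness and positivity of the Gauss rules -/

lemma gaussWeight_eq (n : ℕ) (ξ : ℝ) : gaussWeight w n ξ =
    ∫ x, (Lagrange.basis (gaussNodes w n) id ξ).eval x ∂(wMeas w) :=
  hw.integral_wMeas_interval _

lemma gauss_eval_of_degree_lt (n : ℕ) (f : ℝ[X]) (hf : f.degree < n) :
    gauss w n (fun x => f.eval x) = ∫ x, f.eval x ∂(wMeas w) := by
  classical
  have hinj : Set.InjOn id (gaussNodes w n : Set ℝ) := Function.injective_id.injOn
  have hint := Lagrange.eq_interpolate (s := gaussNodes w n) (v := id) hinj (f := f)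
    (by rw [(hw.card_and_mem_gaussNodes n).1]; exact hf)
  conv_rhs => rw [hint]
  simp only [Lagrange.interpolate_apply, eval_finsetSum, eval_mul, eval_C, id]
  rw [integral_finsetSum]
  · simp only [gauss, integral_const_mul, hw.gaussWeight_eq, mul_comm]
  · intro i _
    exact (hw.integrable_eval _).const_mul _

/-- Divide $f$ by the orthogonal polynomial $P$. The term with the factor $P$ vanishes at the nodes,
and its integral vanishes because the quotient has degree below $n$; on the remainder the rule is
interpolatory. -/
lemma gauss_eval (n : ℕ) (f : ℝ[X]) (hf : f.natDegree < 2 * n) :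
    gauss w n (fun x => f.eval x) = ∫ x, f.eval x ∂(wMeas w) := by
  have hmon := orthoPoly_monic w n
  set P := orthoPoly w n with hP
  have hdiv : f %ₘ P + P * (f /ₘ P) = f := modByMonic_add_div f P
  have hmod : (f %ₘ P).degree < n := by
    have := degree_modByMonic_lt f hmon
    rwa [(orthoPoly_monic_degree w n).2] at this
  have hquot : (f /ₘ P).degree < n := by
    have hn : 0 < n := by omega
    by_cases h : f /ₘ P = 0
    · rw [h, degree_zero]; exact WithBot.bot_lt_coe n
    rw [← natDegree_lt_iff_degree_lt h, natDegree_divByMonic f hmon, orthoPoly_natDegree]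
    omega
  have h1 : gauss w n (fun x => f.eval x) = gauss w n (fun x => (f %ₘ P).eval x) := by
    refine Finset.sum_congr rfl fun ξ hξ => ?_
    have : P.eval ξ = 0 := by
      exact (mem_roots hmon.ne_zero).1 (Multiset.mem_toFinset.1 hξ)
    conv_lhs => rw [← hdiv]
    simp [this]
  rw [h1, hw.gauss_eval_of_degree_lt n _ hmod]
  conv_rhs => rw [← hdiv]
  simp only [eval_add]
  rw [integral_add (hw.integrable_eval _) (hw.integrable_eval _), ← hw.wInner_eq P,
    hw.orthoPoly_wInner_eq_zero n _ hquot, add_zero]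

/-- The squared Lagrange polynomial has degree $2n-2$, so it is integrated exactly; the rule applied
to it returns just the weight of its node. -/
lemma gaussWeight_nonneg (n : ℕ) {ξ : ℝ} (hξ : ξ ∈ gaussNodes w n) : 0 ≤ gaussWeight w n ξ := by
  classical
  have hinj : Set.InjOn id (gaussNodes w n : Set ℝ) := Function.injective_id.injOn
  have hcard := (hw.card_and_mem_gaussNodes n).1
  have hn : 0 < n := by rw [← hcard]; exact Finset.card_pos.2 ⟨ξ, hξ⟩
  set L := Lagrange.basis (gaussNodes w n) id ξ
  have hdeg : (L * L).natDegree < 2 * n := by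
    refine natDegree_mul_le.trans_lt ?_
    rw [Lagrange.natDegree_basis hinj hξ, hcard]; omega
  have hex := hw.gauss_eval n (L * L) hdeg
  have hsum : gauss w n (fun x => (L * L).eval x) = gaussWeight w n ξ := by
    rw [gauss, Finset.sum_eq_single ξ]
    · have := Lagrange.eval_basis_self hinj hξ
      simp only [id] at this
      simp [L, this]
    · intro η hη hne
      have := Lagrange.eval_basis_of_ne (v := id) hne.symm hη
      simp only [id] at this
      simp [L, this]
    · exact fun h => absurd hξ h
  rw [← hsum, hex]
  refine integral_nonneg fun x => ?_
  simp only [Pi.zero_apply, eval_mul]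
  exact mul_self_nonneg _

/-- Exactness for the constant $1$. Only an inequality is claimed because the rule with $n=0$ is
zero. -/
lemma sum_gaussWeight_le (n : ℕ) : ∑ ξ ∈ gaussNodes w n, gaussWeight w n ξ ≤ (wMeas w).real univ := by
  rcases Nat.eq_zero_or_pos n with rfl | hn
  · rw [Finset.card_eq_zero.1 (hw.card_and_mem_gaussNodes 0).1]
    simp
  · have := hw.gauss_eval n 1 (by simpa using hn)
    simp only [gauss, eval_one, mul_one, integral_const, smul_eq_mul] at this
    exact this.le

lemma gauss_congr (n : ℕ) {f g : ℝ → ℝ} (h : ∀ x ∈ Ioo (0 : ℝ) 1, f x = g x) :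
    gauss w n f = gauss w n g :=
  Finset.sum_congr rfl fun ξ hξ => by rw [h ξ ((hw.card_and_mem_gaussNodes n).2 ξ hξ)]

lemma abs_gauss_le (n : ℕ) {f : ℝ → ℝ} {A : ℝ} (hA : 0 ≤ A)
    (h : ∀ x ∈ Ioo (0 : ℝ) 1, |f x| ≤ A) : |gauss w n f| ≤ (wMeas w).real univ * A := by
  calc |gauss w n f| ≤ ∑ ξ ∈ gaussNodes w n, |gaussWeight w n ξ * f ξ| :=
        Finset.abs_sum_le_sum_abs _ _
    _ ≤ ∑ ξ ∈ gaussNodes w n, gaussWeight w n ξ * A := by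
        refine Finset.sum_le_sum fun ξ hξ => ?_
        rw [abs_mul, abs_of_nonneg (hw.gaussWeight_nonneg n hξ)]
        exact mul_le_mul_of_nonneg_left (h ξ ((hw.card_and_mem_gaussNodes n).2 ξ hξ))
          (hw.gaussWeight_nonneg n hξ)
    _ ≤ _ := by
        rw [← Finset.sum_mul]
        exact mul_le_mul_of_nonneg_right (hw.sum_gaussWeight_le n) hA

end IsWeight

lemma gauss_add (w : ℝ → ℝ) (n : ℕ) (f g : ℝ → ℝ) :
    gauss w n (fun x => f x + g x) = gauss w n f + gauss w n g := by
  simp only [gauss, mul_add, Finset.sum_add_distrib]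

lemma gauss_const_mul (w : ℝ → ℝ) (n : ℕ) (c : ℝ) (f : ℝ → ℝ) :
    gauss w n (fun x => c * f x) = c * gauss w n f := by
  simp only [gauss, Finset.mul_sum]
  exact Finset.sum_congr rfl fun ξ _ => by ring

lemma isWeight_one : IsWeight fun _ => 1 :=
  ⟨measurable_const, fun _ _ => one_pos, by simp⟩

lemma isWeight_jacobi_right {β : ℝ} (hβ : -1 < β) :
    IsWeight fun x => (1 - x) ^ (0 : ℝ) * x ^ β := by
  refine ⟨by fun_prop, fun x hx => ?_, ?_⟩
  · simpa using Real.rpow_pos_of_pos hx.1 β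
  · simp only [Real.rpow_zero, one_mul]
    exact (intervalIntegrable_iff_integrableOn_Ioo_of_le zero_le_one).1
      (intervalIntegral.intervalIntegrable_rpow' hβ)

lemma isWeight_jacobi_left {α : ℝ} (hα : -1 < α) :
    IsWeight fun x => (1 - x) ^ α * x ^ (0 : ℝ) := by
  refine ⟨by fun_prop, fun x hx => ?_, ?_⟩
  · simpa using Real.rpow_pos_of_pos (sub_pos.2 hx.2) α
  · simp only [Real.rpow_zero, mul_one]
    rw [← intervalIntegrable_iff_integrableOn_Ioo_of_le zero_le_one]
    have := (intervalIntegral.intervalIntegrable_rpow' (a := 0) (b := 1) hα).comp_sub_left 1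
    simpa using this.symm

/-! ### Tensor product quadrature -/

/-- Polynomial functions of two variables, of degree at most `d` in each variable. -/
def biPoly (d : ℕ) : Submodule ℝ (ℝ → ℝ → ℝ) :=
  Submodule.span ℝ {f | ∃ i j : ℕ, i ≤ d ∧ j ≤ d ∧ f = fun x y => x ^ i * y ^ j}

lemma biPoly_monomial {d i j : ℕ} (hi : i ≤ d) (hj : j ≤ d) :
    (fun x y : ℝ => x ^ i * y ^ j) ∈ biPoly d :=
  Submodule.subset_span ⟨i, j, hi, hj, rfl⟩

lemma biPoly_mono {d e : ℕ} (h : d ≤ e) : biPoly d ≤ biPoly e :=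
  Submodule.span_mono fun _ ⟨i, j, hi, hj, hf⟩ => ⟨i, j, hi.trans h, hj.trans h, hf⟩

lemma biPoly_mul {d e : ℕ} {f g : ℝ → ℝ → ℝ} (hf : f ∈ biPoly d) (hg : g ∈ biPoly e) :
    f * g ∈ biPoly (d + e) := by
  have h := Submodule.mul_mem_mul hf hg
  rw [biPoly, biPoly, Submodule.span_mul_span] at h
  refine Submodule.span_mono ?_ h
  rintro _ ⟨_, ⟨i, j, hi, hj, rfl⟩, _, ⟨k, l, hk, hl, rfl⟩, rfl⟩
  refine ⟨i + k, j + l, by omega, by omega, ?_⟩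
  ext x y
  simp only [Pi.mul_apply]
  ring

lemma biPoly_const (c : ℝ) (d : ℕ) : (fun _ _ : ℝ => c) ∈ biPoly d := by
  have := (biPoly d).smul_mem c (biPoly_monomial (Nat.zero_le d) (Nat.zero_le d))
  convert this using 1
  ext x y; simp

lemma biPoly_pow {L : ℝ → ℝ → ℝ} (hL : L ∈ biPoly 1) (k : ℕ) : L ^ k ∈ biPoly k := by
  induction k with
  | zero => rw [pow_zero]; exact biPoly_const 1 0
  | succ k ih => rw [pow_succ]; exact biPoly_mul ih hL

lemma biPoly_eval {L : ℝ → ℝ → ℝ} (hL : L ∈ biPoly 1) {P : ℝ[X]} {d : ℕ} (hP : P.natDegree ≤ d) :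
    (fun x y => P.eval (L x y)) ∈ biPoly d := by
  have : (fun x y => P.eval (L x y)) = ∑ k ∈ Finset.range (d + 1), P.coeff k • L ^ k := by
    ext x y
    rw [eval_eq_sum_range' (Nat.lt_succ_of_le hP)]
    simp [Finset.sum_apply]
  rw [this]
  refine Submodule.sum_mem _ fun k hk => Submodule.smul_mem _ _ ?_
  exact biPoly_mono (by simpa [Nat.lt_succ_iff] using hk) (biPoly_pow hL k)

lemma biPoly_fst : (fun x _ : ℝ => x) ∈ biPoly 1 := by
  simpa using biPoly_monomial (d := 1) (i := 1) (j := 0) le_rfl zero_le_one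

lemma biPoly_snd : (fun _ y : ℝ => y) ∈ biPoly 1 := by
  simpa using biPoly_monomial (d := 1) (i := 0) (j := 1) zero_le_one le_rfl

lemma biPoly_prod : (fun x y : ℝ => x * y) ∈ biPoly 1 := by
  simpa using biPoly_monomial (d := 1) (i := 1) (j := 1) le_rfl le_rfl

lemma biPoly_affine (A a b : ℝ) : (fun x y : ℝ => A + a * x + b * y) ∈ biPoly 1 :=
  (biPoly 1).add_mem ((biPoly 1).add_mem (biPoly_const A 1) ((biPoly 1).smul_mem a biPoly_fst))
    ((biPoly 1).smul_mem b biPoly_snd)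

lemma continuous_of_mem_biPoly {d : ℕ} {f : ℝ → ℝ → ℝ} (hf : f ∈ biPoly d) :
    Continuous fun z : ℝ × ℝ => f z.1 z.2 := by
  induction hf using Submodule.span_induction with
  | mem f hf => obtain ⟨i, j, -, -, rfl⟩ := hf; fun_prop
  | zero => exact continuous_const
  | add f g _ _ hf hg => exact hf.add hg
  | smul c f _ hf => exact hf.const_smul c

/-- The weighted double integral over the unit square. -/
noncomputable def dInt (w₁ w₂ : ℝ → ℝ) (G : ℝ → ℝ → ℝ) : ℝ :=
  ∫ z, G z.1 z.2 ∂((wMeas w₁).prod (wMeas w₂))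

/-- The tensor product Gaussian rule on the unit square. -/
noncomputable def dGauss (w₁ w₂ : ℝ → ℝ) (n : ℕ) (G : ℝ → ℝ → ℝ) : ℝ :=
  gauss w₁ n fun x => gauss w₂ n fun y => G x y

section

variable {w₁ w₂ : ℝ → ℝ} (h₁ : IsWeight w₁) (h₂ : IsWeight w₂)
include h₁ h₂

lemma prod_ae_mem : ∀ᵐ z ∂((wMeas w₁).prod (wMeas w₂)),
    z.1 ∈ Ioo (0 : ℝ) 1 ∧ z.2 ∈ Ioo (0 : ℝ) 1 := by
  have := h₁.isFiniteMeasure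
  have := h₂.isFiniteMeasure
  filter_upwards [Measure.quasiMeasurePreserving_fst.ae (wMeas_ae_mem w₁),
    Measure.quasiMeasurePreserving_snd.ae (wMeas_ae_mem w₂)] with z h h' using ⟨h, h'⟩

lemma integrable_prod_of_bound {G : ℝ → ℝ → ℝ} (hm : Measurable fun z : ℝ × ℝ => G z.1 z.2) {A : ℝ}
    (hA : ∀ x ∈ Ioo (0 : ℝ) 1, ∀ y ∈ Ioo (0 : ℝ) 1, |G x y| ≤ A) :
    Integrable (fun z : ℝ × ℝ => G z.1 z.2) ((wMeas w₁).prod (wMeas w₂)) := by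
  have := h₁.isFiniteMeasure
  have := h₂.isFiniteMeasure
  refine Integrable.of_bound hm.aestronglyMeasurable A ?_
  filter_upwards [prod_ae_mem h₁ h₂] with z hz using hA _ hz.1 _ hz.2

lemma integrable_biPoly {d : ℕ} {f : ℝ → ℝ → ℝ} (hf : f ∈ biPoly d) :
    Integrable (fun z : ℝ × ℝ => f z.1 z.2) ((wMeas w₁).prod (wMeas w₂)) := by
  have hc := continuous_of_mem_biPoly hf
  obtain ⟨C, hC⟩ := (isCompact_Icc.prod isCompact_Icc).exists_bound_of_continuousOn
    (s := Icc (0 : ℝ) 1 ×ˢ Icc (0 : ℝ) 1) hc.continuousOn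
  exact integrable_prod_of_bound h₁ h₂ hc.measurable fun x hx y hy =>
    hC (x, y) ⟨Ioo_subset_Icc_self hx, Ioo_subset_Icc_self hy⟩

/-- By linearity it suffices to test monomials, for which the rule and the integral both factor into
one-dimensional ones. -/
lemma dGauss_biPoly {d n : ℕ} (hd : d < 2 * n) {f : ℝ → ℝ → ℝ} (hf : f ∈ biPoly d) :
    dGauss w₁ w₂ n f = dInt w₁ w₂ f := by
  have := h₁.isFiniteMeasure
  have := h₂.isFiniteMeasure
  induction hf using Submodule.span_induction with
  | mem f hf =>
    obtain ⟨i, j, hi, hj, rfl⟩ := hf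
    have e₁ := h₁.gauss_eval n (X ^ i) (by rw [natDegree_X_pow]; omega)
    have e₂ := h₂.gauss_eval n (X ^ j) (by rw [natDegree_X_pow]; omega)
    simp only [eval_pow, eval_X] at e₁ e₂
    simp only [dGauss, dInt, gauss_const_mul]
    rw [integral_prod_mul (fun x : ℝ => x ^ i) (fun y : ℝ => y ^ j), ← e₁, ← e₂, mul_comm,
      ← gauss_const_mul]
    congr 1; ext x; ring
  | zero => simp [dGauss, dInt, gauss]
  | add f g hf' hg' hf hg =>
    have i₁ := integrable_biPoly h₁ h₂ (d := d) hf'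
    have i₂ := integrable_biPoly h₁ h₂ (d := d) hg'
    simp only [dGauss, dInt, Pi.add_apply, gauss_add] at hf hg ⊢
    rw [hf, hg, integral_add i₁ i₂]
  | smul c f _ hf =>
    simp only [dGauss, dInt, Pi.smul_apply, smul_eq_mul, gauss_const_mul] at hf ⊢
    rw [hf, integral_const_mul]

lemma abs_dInt_le {G : ℝ → ℝ → ℝ} {A : ℝ}
    (hA : ∀ x ∈ Ioo (0 : ℝ) 1, ∀ y ∈ Ioo (0 : ℝ) 1, |G x y| ≤ A) :
    |dInt w₁ w₂ G| ≤ (wMeas w₁).real univ * (wMeas w₂).real univ * A := by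
  have := h₁.isFiniteMeasure
  have := h₂.isFiniteMeasure
  have := norm_integral_le_of_norm_le_const (μ := (wMeas w₁).prod (wMeas w₂)) (C := A)
    (f := fun z : ℝ × ℝ => G z.1 z.2) (by
      filter_upwards [prod_ae_mem h₁ h₂] with z hz using hA _ hz.1 _ hz.2)
  rw [← univ_prod_univ, measureReal_prod_prod] at this
  rw [mul_comm]
  exact this

lemma abs_dGauss_le (n : ℕ) {G : ℝ → ℝ → ℝ} {A : ℝ} (h0 : 0 ≤ A)
    (hA : ∀ x ∈ Ioo (0 : ℝ) 1, ∀ y ∈ Ioo (0 : ℝ) 1, |G x y| ≤ A) :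
    |dGauss w₁ w₂ n G| ≤ (wMeas w₁).real univ * (wMeas w₂).real univ * A := by
  rw [mul_assoc]
  exact h₁.abs_gauss_le n (by positivity) fun x hx => h₂.abs_gauss_le n h0 fun y hy => hA x hx y hy

lemma dGauss_congr (n : ℕ) {G H : ℝ → ℝ → ℝ}
    (h : ∀ x ∈ Ioo (0 : ℝ) 1, ∀ y ∈ Ioo (0 : ℝ) 1, G x y = H x y) :
    dGauss w₁ w₂ n G = dGauss w₁ w₂ n H :=
  h₁.gauss_congr n fun x hx => h₂.gauss_congr n fun y hy => h x hx y hy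

lemma dInt_congr {G H : ℝ → ℝ → ℝ}
    (h : ∀ x ∈ Ioo (0 : ℝ) 1, ∀ y ∈ Ioo (0 : ℝ) 1, G x y = H x y) :
    dInt w₁ w₂ G = dInt w₁ w₂ H := by
  refine integral_congr_ae ?_
  filter_upwards [prod_ae_mem h₁ h₂] with z hz using h _ hz.1 _ hz.2

lemma dInt_eq_integral {G : ℝ → ℝ → ℝ} (hm : Measurable fun z : ℝ × ℝ => G z.1 z.2) {A : ℝ}
    (hA : ∀ x ∈ Ioo (0 : ℝ) 1, ∀ y ∈ Ioo (0 : ℝ) 1, |G x y| ≤ A) :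
    dInt w₁ w₂ G =
      ∫ x in Ioo (0 : ℝ) 1, ∫ y in Ioo (0 : ℝ) 1, w₁ x * (w₂ y * G x y) := by
  have := h₁.isFiniteMeasure
  have := h₂.isFiniteMeasure
  rw [dInt, integral_prod _ (integrable_prod_of_bound h₁ h₂ hm hA), h₁.integral_wMeas]
  congr 1; ext x
  rw [h₂.integral_wMeas, integral_const_mul]

end

/-- The kernel `k` on the unit square is bounded by `B`, and its error of best approximation by
polynomials of degree `m` decays like `B q ^ m`. -/
structure KernelApprox (k : ℝ → ℝ → ℝ) (q B : ℝ) : Prop where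
  meas : Measurable fun z : ℝ × ℝ => k z.1 z.2
  bound : ∀ x ∈ Ioo (0 : ℝ) 1, ∀ y ∈ Ioo (0 : ℝ) 1, |k x y| ≤ B
  approx : ∀ m : ℕ, ∃ κ ∈ biPoly m,
    ∀ x ∈ Ioo (0 : ℝ) 1, ∀ y ∈ Ioo (0 : ℝ) 1, |k x y - κ x y| ≤ B * q ^ m

lemma KernelApprox.nonneg {k : ℝ → ℝ → ℝ} {q B : ℝ} (hk : KernelApprox k q B) : 0 ≤ B :=
  (abs_nonneg _).trans (hk.bound (1 / 2) (by norm_num) (1 / 2) (by norm_num))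

/-- The error of the tensor product Gaussian rule for a polynomial times a kernel. -/
lemma abs_dInt_sub_dGauss_le {w₁ w₂ : ℝ → ℝ} (h₁ : IsWeight w₁) (h₂ : IsWeight w₂) {k : ℝ → ℝ → ℝ}
    {q B : ℝ} (hk : KernelApprox k q B) (hq0 : 0 < q) (hq1 : q ≤ 1) {d : ℕ} {f : ℝ → ℝ → ℝ}
    (hf : f ∈ biPoly d) {A : ℝ} (hA : ∀ x ∈ Ioo (0 : ℝ) 1, ∀ y ∈ Ioo (0 : ℝ) 1, |f x y| ≤ A) (n : ℕ) :
    |dInt w₁ w₂ (fun x y => f x y * k x y) - dGauss w₁ w₂ n (fun x y => f x y * k x y)| ≤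
      2 * ((wMeas w₁).real univ * (wMeas w₂).real univ) * (A * B) *
        q ^ (2 * (n : ℤ) - 1 - (d : ℤ)) := by
  have := h₁.isFiniteMeasure
  have := h₂.isFiniteMeasure
  have hA0 : 0 ≤ A := (abs_nonneg _).trans (hA (1 / 2) (by norm_num) (1 / 2) (by norm_num))
  have hB0 := hk.nonneg
  set M := (wMeas w₁).real univ * (wMeas w₂).real univ with hM
  have hM0 : 0 ≤ M := by positivity
  have hfm := (continuous_of_mem_biPoly hf).measurable
  have hfk : ∀ x ∈ Ioo (0 : ℝ) 1, ∀ y ∈ Ioo (0 : ℝ) 1, |f x y * k x y| ≤ A * B := by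
    intro x hx y hy
    rw [abs_mul]
    exact mul_le_mul (hA x hx y hy) (hk.bound x hx y hy) (abs_nonneg _) hA0
  rcases lt_or_ge d (2 * n) with hd | hd
  -- The choice $m=2n-1-d$ is the largest degree for which $f$ times the approximating polynomial is
  -- still integrated exactly, so only the remainder contributes, once to the integral and once to
  -- the rule.
  · obtain ⟨m, hm⟩ : ∃ m : ℕ, m + d + 1 = 2 * n := ⟨2 * n - 1 - d, by omega⟩
    obtain ⟨κ, hκ, happ⟩ := hk.approx m
    have hfκ : (fun x y => f x y * κ x y) ∈ biPoly (d + m) := biPoly_mul hf hκ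
    have hex := dGauss_biPoly h₁ h₂ (n := n) (by omega) hfκ
    have hbd : ∀ x ∈ Ioo (0 : ℝ) 1, ∀ y ∈ Ioo (0 : ℝ) 1,
        |f x y * k x y - f x y * κ x y| ≤ A * (B * q ^ m) := by
      intro x hx y hy
      rw [← mul_sub, abs_mul]
      exact mul_le_mul (hA x hx y hy) (happ x hx y hy) (abs_nonneg _) hA0
    have e1 : dInt w₁ w₂ (fun x y => f x y * k x y) = dInt w₁ w₂ (fun x y => f x y * κ x y) +
        dInt w₁ w₂ (fun x y => f x y * k x y - f x y * κ x y) := by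
      rw [dInt, dInt, dInt, ← integral_add (integrable_biPoly h₁ h₂ hfκ)]
      · congr 1; ext z; ring
      · exact (integrable_prod_of_bound h₁ h₂ (hfm.mul hk.meas) hfk).sub
          (integrable_biPoly h₁ h₂ hfκ)
    have e2 : dGauss w₁ w₂ n (fun x y => f x y * k x y) =
        dGauss w₁ w₂ n (fun x y => f x y * κ x y) +
        dGauss w₁ w₂ n (fun x y => f x y * k x y - f x y * κ x y) := by
      simp only [dGauss, ← gauss_add]
      congr 1; ext x; congr 1; ext y; ring
    have hz : q ^ (2 * (n : ℤ) - 1 - (d : ℤ)) = q ^ m := by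
      rw [← zpow_natCast]; congr 1; omega
    have b1 := abs_dInt_le h₁ h₂ hbd
    have b2 := abs_dGauss_le h₁ h₂ n (by positivity) hbd
    rw [e1, e2, hex, hz, add_sub_add_left_eq_sub]
    refine (abs_sub _ _).trans ?_
    rw [← hM] at b1 b2
    linarith
  · have b1 := abs_dInt_le h₁ h₂ hfk
    have b2 := abs_dGauss_le h₁ h₂ n (by positivity) hfk
    rw [← hM] at b1 b2
    -- Without exactness the exponent is negative, so the decay factor is at least $1$ and the crude
    -- bound on integral and rule suffices.
    have hz : 1 ≤ q ^ (2 * (n : ℤ) - 1 - (d : ℤ)) := by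
      obtain ⟨e, he⟩ : ∃ e : ℕ, 2 * (n : ℤ) - 1 - (d : ℤ) = -(e : ℤ) := ⟨d + 1 - 2 * n, by omega⟩
      rw [he, zpow_neg, zpow_natCast]
      exact (one_le_inv₀ (by positivity)).2 (pow_le_one₀ hq0.le hq1)
    refine (abs_sub _ _).trans ?_
    calc _ ≤ 2 * M * (A * B) * 1 := by linarith
      _ ≤ _ := by gcongr

/-! ### Polynomial approximation of the kernels -/

/-- Truncation of the binomial series, whose radius of convergence is at least $1$. For
$q=\sqrt{t_0}<1$ the coefficients satisfy $|c_k|q^k\le K$; together with $|t|^k\le q^{2k}$ this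
bounds the terms by $Kq^k$. Half of the decay pays for the coefficients, hence the square root in
the rate. -/
lemma exists_poly_one_add_rpow (σ : ℝ) {t₀ : ℝ} (h0 : 0 < t₀) (h1 : t₀ < 1) :
    ∃ C : ℝ, 0 < C ∧ (∀ t : ℝ, |t| ≤ t₀ → |(1 + t) ^ (-σ)| ≤ C) ∧
      ∀ m : ℕ, ∃ P : ℝ[X], P.natDegree ≤ m ∧
        ∀ t : ℝ, |t| ≤ t₀ → |(1 + t) ^ (-σ) - P.eval t| ≤ C * √t₀ ^ m := by
  have hf := Real.one_add_rpow_hasFPowerSeriesOnBall_zero (a := -σ)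
  set c : ℕ → ℝ := fun k => (binomialSeries ℝ (-σ)).coeff k with hc
  set q := √t₀ with hq
  have hq0 : 0 < q := Real.sqrt_pos.2 h0
  have hqq : q * q = t₀ := Real.mul_self_sqrt h0.le
  have hq1 : q < 1 := by nlinarith
  obtain ⟨K, hK0, hK⟩ := (binomialSeries ℝ (-σ)).norm_mul_pow_le_of_lt_radius (r := ⟨q, hq0.le⟩)
    (lt_of_lt_of_le (ENNReal.coe_lt_one_iff.2 (by exact hq1)) hf.r_le)
  have hcK : ∀ k, |c k| * q ^ k ≤ K := by
    intro k
    have := hK k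
    rw [FormalMultilinearSeries.norm_apply_eq_norm_coef] at this
    exact this
  have hsum : ∀ t : ℝ, |t| ≤ t₀ → HasSum (fun k => c k * t ^ k) ((1 + t) ^ (-σ)) := by
    intro t ht
    have hmem : t ∈ Metric.eball (0 : ℝ) 1 := by
      rw [Metric.mem_eball, edist_zero_right]
      rw [← ofReal_norm, Real.norm_eq_abs]
      exact ENNReal.ofReal_lt_one.2 (ht.trans_lt h1)
    have := hf.hasSum hmem
    simpa [FormalMultilinearSeries.apply_eq_pow_smul_coeff, hc, mul_comm] using this
  have hterm : ∀ t : ℝ, |t| ≤ t₀ → ∀ k, |c k * t ^ k| ≤ K * q ^ k := by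
    intro t ht k
    rw [abs_mul, abs_pow]
    calc |c k| * |t| ^ k ≤ |c k| * t₀ ^ k := by gcongr
      _ = |c k| * q ^ k * q ^ k := by rw [← hqq, mul_pow]; ring
      _ ≤ K * q ^ k := by gcongr; exact hcK k
  have hgeo : HasSum (fun k => K * q ^ k) (K * (1 - q)⁻¹) :=
    (hasSum_geometric_of_lt_one hq0.le hq1).mul_left K
  have hpos : 0 < (1 - q)⁻¹ := inv_pos.2 (by linarith)
  refine ⟨K * (1 - q)⁻¹, by positivity, fun t ht => ?_, fun m => ?_⟩
  · rw [← (hsum t ht).tsum_eq]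
    exact tsum_of_norm_bounded (f := fun k => c k * t ^ k) hgeo (hterm t ht)
  · refine ⟨∑ k ∈ Finset.range (m + 1), C (c k) * X ^ k, ?_, fun t ht => ?_⟩
    · refine natDegree_sum_le_of_forall_le _ _ fun k hk => ?_
      exact (natDegree_C_mul_X_pow_le _ _).trans (Nat.lt_succ_iff.1 (Finset.mem_range.1 hk))
    · have h2 := (hasSum_nat_add_iff' (m + 1)).2 (hsum t ht)
      simp only [eval_finsetSum, eval_mul, eval_C, eval_pow, eval_X]
      rw [← h2.tsum_eq]
      have hgeo2 : HasSum (fun k => K * q ^ (k + (m + 1))) (K * (1 - q)⁻¹ * q ^ (m + 1)) := by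
        have := hgeo.mul_right (q ^ (m + 1))
        simpa only [pow_add, mul_assoc] using this
      refine (tsum_of_norm_bounded (f := fun k => c (k + (m + 1)) * t ^ (k + (m + 1))) hgeo2
        fun k => hterm t ht _).trans ?_
      have : q ^ (m + 1) ≤ q ^ m := pow_le_pow_of_le_one hq0.le hq1.le (Nat.le_succ m)
      gcongr

/-- Powers of affine functions whose variation is small compared with their value at the centre
of the unit square are well approximated by polynomials. -/
lemma exists_kernelApprox_affine (σ : ℝ) {t₀ : ℝ} (h0 : 0 < t₀) (h1 : t₀ < 1) :
    ∃ C : ℝ, 0 < C ∧ ∀ A a b c : ℝ, c = A + a / 2 + b / 2 → 0 < c → (|a| + |b|) / 2 ≤ t₀ * c →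
      KernelApprox (fun x y => (|A + a * x + b * y| ^ σ)⁻¹) (√t₀) (C * (c ^ σ)⁻¹) := by
  obtain ⟨C, hC, hbd, happ⟩ := exists_poly_one_add_rpow σ h0 h1
  refine ⟨C, hC, fun A a b c hc hc0 hab => ?_⟩
  -- The relative deviation of the affine function from its value $c$ at the centre; the hypothesis
  -- says that $|\tau|\le t_0$ on the square.
  set τ : ℝ → ℝ → ℝ := fun x y => (A / c - 1) + (a / c) * x + (b / c) * y with hτ
  have hτb : ∀ x ∈ Ioo (0 : ℝ) 1, ∀ y ∈ Ioo (0 : ℝ) 1, |τ x y| ≤ t₀ := by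
    intro x hx y hy
    have e : τ x y = (a * (x - 1 / 2) + b * (y - 1 / 2)) / c := by
      simp only [hτ]; field_simp; rw [hc]; ring
    rw [e, abs_div, abs_of_pos hc0, div_le_iff₀ hc0]
    refine le_trans ?_ hab
    have hx' : |x - 1 / 2| ≤ 1 / 2 := abs_le.2 ⟨by linarith [hx.1], by linarith [hx.2]⟩
    have hy' : |y - 1 / 2| ≤ 1 / 2 := abs_le.2 ⟨by linarith [hy.1], by linarith [hy.2]⟩
    calc _ ≤ |a| * |x - 1 / 2| + |b| * |y - 1 / 2| := by
          rw [← abs_mul, ← abs_mul]; exact abs_add_le _ _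
      _ ≤ |a| * (1 / 2) + |b| * (1 / 2) := by gcongr
      _ = _ := by ring
  have heq : ∀ x ∈ Ioo (0 : ℝ) 1, ∀ y ∈ Ioo (0 : ℝ) 1,
      (|A + a * x + b * y| ^ σ)⁻¹ = (c ^ σ)⁻¹ * (1 + τ x y) ^ (-σ) := by
    intro x hx y hy
    have hpos : 0 < 1 + τ x y := by have := (abs_le.1 (hτb x hx y hy)).1; linarith
    have e : A + a * x + b * y = c * (1 + τ x y) := by simp only [hτ]; field_simp; ring
    rw [e, abs_of_pos (mul_pos hc0 hpos), Real.mul_rpow hc0.le hpos.le, Real.rpow_neg hpos.le,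
      mul_inv]
  have hcσ : 0 < (c ^ σ)⁻¹ := inv_pos.2 (Real.rpow_pos_of_pos hc0 σ)
  refine ⟨by fun_prop, fun x hx y hy => ?_, fun m => ?_⟩
  · rw [heq x hx y hy, abs_mul, abs_of_pos hcσ, mul_comm]
    gcongr
    exact hbd _ (hτb x hx y hy)
  · obtain ⟨P, hP, hPe⟩ := happ m
    refine ⟨(c ^ σ)⁻¹ • fun x y => P.eval (τ x y),
      Submodule.smul_mem _ _ (biPoly_eval (biPoly_affine _ _ _) hP), fun x hx y hy => ?_⟩
    rw [heq x hx y hy]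
    simp only [Pi.smul_apply, smul_eq_mul]
    rw [← mul_sub, abs_mul, abs_of_pos hcσ]
    calc _ ≤ (c ^ σ)⁻¹ * (C * √t₀ ^ m) := by gcongr; exact hPe _ (hτb x hx y hy)
      _ = _ := by ring

/-! ### Inverse estimates for polynomials -/

/-- Chebyshev polynomials are extremal for the derivative at $1$, and $T_n'(1)=n^2$. The
normalisations $\pm A^{-1}P$ give both signs. -/
lemma eval_derivative_one_le {P : ℝ[X]} {n : ℕ} (hP : P.natDegree ≤ n) {A : ℝ} (hA : 0 < A)
    (hbd : ∀ x ∈ Icc (-1 : ℝ) 1, |P.eval x| ≤ A) : |P.derivative.eval 1| ≤ A * n ^ 2 := by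
  have key : ∀ c : ℝ, |c| = A⁻¹ → c * P.derivative.eval 1 ≤ n ^ 2 := by
    intro c hc
    have := Polynomial.Chebyshev.eval_iterate_derivative_le_of_forall_abs_le_one (n := n)
      (P := C c * P) (k := 1) (x := 1) le_rfl
      ((degree_C_mul_le_degree _ _).trans (natDegree_le_iff_degree_le.1 hP)) (fun x hx => by
        rw [eval_mul, eval_C, abs_mul, hc]
        calc A⁻¹ * |P.eval x| ≤ A⁻¹ * A := by gcongr; exact hbd x hx
          _ = 1 := inv_mul_cancel₀ hA.ne')
    simpa [Polynomial.Chebyshev.derivative_T_eval_one] using this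
  have h1 := key A⁻¹ (abs_of_pos (inv_pos.2 hA))
  have h2 := key (-A⁻¹) (by rw [abs_neg, abs_of_pos (inv_pos.2 hA)])
  have h3 : |A⁻¹ * P.derivative.eval 1| ≤ n ^ 2 := abs_le.2 ⟨by linarith, h1⟩
  rw [abs_mul, abs_of_pos (inv_pos.2 hA), inv_mul_le_iff₀ hA] at h3
  exact h3

/-- The affine map `L` takes $[-1,1]$ to the segment from $x+l$ to $x$ and sends $1$ to $x$, so any
point can serve as the endpoint of the previous estimate. -/
lemma abs_derivative_endpoint_le {P : ℝ[X]} {n : ℕ} (hP : P.natDegree ≤ n) {A : ℝ} (hA : 0 < A)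
    {x l : ℝ} (hl : l ≠ 0) (hbd : ∀ t ∈ Icc (0 : ℝ) 1, |P.eval (x + l * t)| ≤ A) :
    |P.derivative.eval x| ≤ 2 * A * n ^ 2 / |l| := by
  set L : ℝ[X] := C (x + l / 2) + C (-(l / 2)) * X with hL
  have hdeg : (P.comp L).natDegree ≤ n := by
    refine natDegree_comp_le.trans ?_
    have : L.natDegree ≤ 1 := by rw [hL]; compute_degree
    calc _ ≤ P.natDegree * 1 := Nat.mul_le_mul_left _ this
      _ ≤ n := by omega
  have := eval_derivative_one_le hdeg hA fun t ht => by
    have h := hbd ((1 - t) / 2) ⟨by linarith [ht.2], by linarith [ht.1]⟩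
    rw [eval_comp]
    have e : L.eval t = x + l * ((1 - t) / 2) := by
      simp only [hL, eval_add, eval_C, eval_mul, eval_X]; ring
    rwa [e]
  have e : (P.comp L).derivative.eval 1 = -(l / 2) * P.derivative.eval x := by
    rw [derivative_comp, eval_mul, eval_comp]
    simp [hL]
  rw [e, abs_mul, abs_neg, abs_div, abs_two] at this
  rw [le_div_iff₀ (abs_pos.2 hl)]
  linarith

/-- Markov's inequality on `[0, 1]`, with a suboptimal constant. -/
lemma markov_inequality {P : ℝ[X]} {n : ℕ} (hP : P.natDegree ≤ n) {A : ℝ}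
    (hbd : ∀ x ∈ Icc (0 : ℝ) 1, |P.eval x| ≤ A) :
    ∀ x ∈ Icc (0 : ℝ) 1, |P.derivative.eval x| ≤ 4 * n ^ 2 * A := by
  have pos : ∀ A : ℝ, 0 < A → (∀ x ∈ Icc (0 : ℝ) 1, |P.eval x| ≤ A) →
      ∀ x ∈ Icc (0 : ℝ) 1, |P.derivative.eval x| ≤ 4 * n ^ 2 * A := by
    intro A hA hbd x hx
    -- Every point of $[0,1]$ is an endpoint of a subinterval of length at least $1/2$; this turns
    -- the endpoint estimate into the constant $4$.
    obtain ⟨l, hl, hl'⟩ : ∃ l : ℝ, 1 / 2 ≤ |l| ∧ x + l ∈ Icc (0 : ℝ) 1 := by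
      rcases le_total x (1 / 2) with h | h
      · refine ⟨1 - x, ?_, by simp⟩
        rw [abs_of_nonneg (by linarith)]; linarith
      · refine ⟨-x, ?_, by simp⟩
        rw [abs_neg, abs_of_nonneg (by linarith)]; exact h
    have hl0 : 0 < |l| := by linarith
    have := abs_derivative_endpoint_le hP hA (abs_pos.1 hl0) (x := x) fun t ht => hbd _ (by
      have e : x + l * t = (1 - t) * x + t * (x + l) := by ring
      rw [e]
      exact ⟨add_nonneg (mul_nonneg (by linarith [ht.2]) hx.1) (mul_nonneg ht.1 hl'.1), by
        nlinarith [ht.1, ht.2, hx.2, hl'.2]⟩)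
    refine this.trans ?_
    rw [div_le_iff₀ hl0]
    have h0 : 0 ≤ A * (n : ℝ) ^ 2 := by positivity
    nlinarith
  have hA0 : 0 ≤ A := (abs_nonneg _).trans (hbd 0 (by simp))
  intro x hx
  -- The bound $A$ may be zero while the normalisation above needs it positive; the perturbation of
  -- $A$ is chosen so that it contributes at most $\varepsilon$.
  refine le_of_forall_pos_le_add fun ε hε => ?_
  have h := pos (A + ε / (4 * n ^ 2 + 1)) (by positivity)
    (fun y hy => (hbd y hy).trans (by linarith [show 0 < ε / (4 * (n : ℝ) ^ 2 + 1) by positivity])) x hx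
  refine h.trans ?_
  rw [mul_add]
  gcongr
  rw [mul_div_assoc', div_le_iff₀ (by positivity)]
  nlinarith

lemma integrableOn_eval_sq (P : ℝ[X]) (a b : ℝ) : IntegrableOn (fun y => P.eval y ^ 2) (Ioo a b) :=
  (Continuous.integrableOn_Icc (by fun_prop)).mono_set Ioo_subset_Icc_self

lemma exists_max_abs_eval (P : ℝ[X]) :
    ∃ x₀ ∈ Icc (0 : ℝ) 1, ∀ x ∈ Icc (0 : ℝ) 1, |P.eval x| ≤ |P.eval x₀| :=
  isCompact_Icc.exists_isMaxOn (nonempty_Icc.2 zero_le_one)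
    (continuous_abs.comp P.continuous).continuousOn

/-- By Markov's inequality $|P|$ stays above half of its maximum $A$ on an interval of length
$\delta$ next to the maximum point. The integral is therefore at least $\delta A^2/4=A^2/(32n^2)$.
-/
lemma eval_sq_le_integral {P : ℝ[X]} {n : ℕ} (hn : n ≠ 0) (hP : P.natDegree ≤ n) {x : ℝ}
    (hx : x ∈ Icc (0 : ℝ) 1) :
    P.eval x ^ 2 ≤ 32 * n ^ 2 * ∫ y in Ioo (0 : ℝ) 1, P.eval y ^ 2 := by
  obtain ⟨x₀, hx₀, hmax⟩ := exists_max_abs_eval P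
  set A := |P.eval x₀| with hA
  have hn1 : (1 : ℝ) ≤ n := by exact_mod_cast Nat.one_le_iff_ne_zero.2 hn
  -- Chosen so that the derivative bound $4n^2A$ times $\delta$ is $A/2$; moreover $\delta\le 1/2$,
  -- so an interval of this length fits into $[0,1]$ on one side of $x_0$.
  set δ : ℝ := 1 / (8 * n ^ 2) with hδ
  have hδ0 : 0 < δ := by positivity
  have hδn : 8 * (n : ℝ) ^ 2 * δ = 1 := by rw [hδ]; field_simp
  have hδ1 : δ ≤ 1 / 2 := by nlinarith
  have hder := markov_inequality hP hmax
  obtain ⟨a, ha0, ha1, hax⟩ : ∃ a : ℝ, 0 ≤ a ∧ a + δ ≤ 1 ∧ ∀ y ∈ Ioo a (a + δ), |y - x₀| ≤ δ := by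
    rcases le_total x₀ (1 / 2) with h | h
    · exact ⟨x₀, hx₀.1, by linarith, fun y hy => abs_le.2 ⟨by linarith [hy.1], by linarith [hy.2]⟩⟩
    · exact ⟨x₀ - δ, by linarith, by linarith [hx₀.2],
        fun y hy => abs_le.2 ⟨by linarith [hy.1], by linarith [hy.2]⟩⟩
  have hsub : Ioo a (a + δ) ⊆ Ioo (0 : ℝ) 1 := Ioo_subset_Ioo ha0 ha1
  have hlow : ∀ y ∈ Ioo a (a + δ), A ^ 2 / 4 ≤ P.eval y ^ 2 := by
    intro y hy
    have hy' := Ioo_subset_Icc_self (hsub hy)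
    have hmv := (convex_Icc (0 : ℝ) 1).norm_image_sub_le_of_norm_hasDerivWithin_le
      (f := fun z => P.eval z) (f' := fun z => P.derivative.eval z) (C := 4 * n ^ 2 * A)
      (fun z _ => (P.hasDerivAt z).hasDerivWithinAt) hder hx₀ hy'
    have h1 : |P.eval y - P.eval x₀| ≤ A / 2 := by
      refine hmv.trans ?_
      rw [Real.norm_eq_abs]
      have hA0 : 0 ≤ A := abs_nonneg _
      calc 4 * (n : ℝ) ^ 2 * A * |y - x₀| ≤ 4 * (n : ℝ) ^ 2 * A * δ := by
            gcongr; exact hax y hy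
        _ = A / 2 := by linear_combination A / 2 * hδn
    have h2 : A / 2 ≤ |P.eval y| := by
      have := abs_sub_abs_le_abs_sub (P.eval x₀) (P.eval y)
      rw [abs_sub_comm] at this
      linarith
    rw [← sq_abs (P.eval y)]
    have : 0 ≤ A := abs_nonneg _
    nlinarith
  have hint : A ^ 2 / 4 * δ ≤ ∫ y in Ioo (0 : ℝ) 1, P.eval y ^ 2 := by
    calc A ^ 2 / 4 * δ = ∫ _ in Ioo a (a + δ), A ^ 2 / 4 := by
          rw [setIntegral_const, smul_eq_mul, measureReal_def, Real.volume_Ioo]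
          rw [add_sub_cancel_left, ENNReal.toReal_ofReal hδ0.le, mul_comm]
      _ ≤ ∫ y in Ioo a (a + δ), P.eval y ^ 2 :=
          setIntegral_mono_on (by simp) (integrableOn_eval_sq P _ _) measurableSet_Ioo hlow
      _ ≤ _ := setIntegral_mono_set (integrableOn_eval_sq P _ _)
          (Filter.Eventually.of_forall fun y => sq_nonneg _) hsub.eventuallyLE
  have hle : P.eval x ^ 2 ≤ A ^ 2 := by
    rw [← sq_abs (P.eval x)]
    exact pow_le_pow_left₀ (abs_nonneg _) (hmax x hx) 2
  calc P.eval x ^ 2 ≤ A ^ 2 := hle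
    _ = 32 * n ^ 2 * (A ^ 2 / 4 * δ) := by linear_combination -(A ^ 2) * hδn
    _ ≤ _ := by gcongr

lemma derivative_sq_le_integral {P : ℝ[X]} {n : ℕ} (hP : P.natDegree ≤ n) {x : ℝ}
    (hx : x ∈ Icc (0 : ℝ) 1) :
    P.derivative.eval x ^ 2 ≤ 512 * n ^ 6 * ∫ y in Ioo (0 : ℝ) 1, P.eval y ^ 2 := by
  obtain ⟨x₀, hx₀, hmax⟩ := exists_max_abs_eval P
  have hder := markov_inequality hP hmax x hx
  rcases Nat.eq_zero_or_pos n with rfl | hn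
  · have : P.derivative.eval x = 0 := abs_nonpos_iff.1 (by simpa using hder)
    simp [this]
  · have h2 := eval_sq_le_integral hn.ne' hP hx₀
    calc P.derivative.eval x ^ 2 = |P.derivative.eval x| ^ 2 := (sq_abs _).symm
      _ ≤ (4 * n ^ 2 * |P.eval x₀|) ^ 2 := pow_le_pow_left₀ (abs_nonneg _) hder 2
      _ = 16 * n ^ 4 * P.eval x₀ ^ 2 := by rw [mul_pow, sq_abs]; ring
      _ ≤ 16 * n ^ 4 * (32 * n ^ 2 * ∫ y in Ioo (0 : ℝ) 1, P.eval y ^ 2) := by gcongr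
      _ = _ := by ring

lemma integrable_sub_sq (P Q : ℝ[X]) :
    Integrable (fun z : ℝ × ℝ => (P.eval z.1 - Q.eval z.2) ^ 2)
      ((volume.restrict (Ioo (0 : ℝ) 1)).prod (volume.restrict (Ioo (0 : ℝ) 1))) := by
  rw [Measure.prod_restrict]
  refine IntegrableOn.mono_set (t := Icc (0 : ℝ) 1 ×ˢ Icc (0 : ℝ) 1) ?_
    (prod_mono Ioo_subset_Icc_self Ioo_subset_Icc_self)
  exact ContinuousOn.integrableOn_compact (isCompact_Icc.prod isCompact_Icc) (by fun_prop)

lemma le_integral_Ioo_of_le {c : ℝ} {f : ℝ → ℝ} (hf : IntegrableOn f (Ioo (0 : ℝ) 1))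
    (h : ∀ x ∈ Ioo (0 : ℝ) 1, c ≤ f x) : c ≤ ∫ x in Ioo (0 : ℝ) 1, f x := by
  calc c = ∫ _ in Ioo (0 : ℝ) 1, c := by simp
    _ ≤ _ := setIntegral_mono_on (by simp) hf measurableSet_Ioo h

/-- Subtracting the constant $P(y)$ does not change the derivative. Applying the previous inverse
estimate to $P-P(y)$ and averaging over $y\in(0,1)$ brings in differences, as required by the
seminorm. -/
lemma derivative_sq_le_double_integral {P : ℝ[X]} {n : ℕ} (hP : P.natDegree ≤ n) {x : ℝ}
    (hx : x ∈ Icc (0 : ℝ) 1) :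
    P.derivative.eval x ^ 2 ≤ 512 * n ^ 6 * ∫ z, (P.eval z.1 - P.eval z.2) ^ 2
      ∂((volume.restrict (Ioo (0 : ℝ) 1)).prod (volume.restrict (Ioo (0 : ℝ) 1))) := by
  rw [integral_prod _ (integrable_sub_sq P P), ← integral_const_mul]
  refine le_integral_Ioo_of_le ((integrable_sub_sq P P).integral_prod_left.const_mul _) fun y _ => ?_
  have := derivative_sq_le_integral (P := P - C (P.eval y)) (n := n) (by simpa using hP) hx
  simp only [derivative_sub, derivative_C, sub_zero, eval_sub, eval_C] at this
  convert this using 4 with z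
  ring

/-- The inverse estimate is applied in each variable separately, whence $1024=32^2$ and $n^4$. -/
lemma sub_sq_le_double_integral {P Q : ℝ[X]} {n : ℕ} (hn : n ≠ 0) (hP : P.natDegree ≤ n)
    (hQ : Q.natDegree ≤ n) {x y : ℝ} (hx : x ∈ Icc (0 : ℝ) 1) (hy : y ∈ Icc (0 : ℝ) 1) :
    (P.eval x - Q.eval y) ^ 2 ≤ 1024 * n ^ 4 * ∫ z, (P.eval z.1 - Q.eval z.2) ^ 2
      ∂((volume.restrict (Ioo (0 : ℝ) 1)).prod (volume.restrict (Ioo (0 : ℝ) 1))) := by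
  rw [integral_prod _ (integrable_sub_sq P Q)]
  have h1 := eval_sq_le_integral (P := P - C (Q.eval y)) (n := n) hn (by simpa using hP) hx
  simp only [eval_sub, eval_C] at h1
  refine h1.trans ?_
  rw [show 1024 * (n : ℝ) ^ 4 = 32 * n ^ 2 * (32 * n ^ 2) by ring,
    mul_assoc (32 * (n : ℝ) ^ 2) (32 * (n : ℝ) ^ 2)]
  refine mul_le_mul_of_nonneg_left ?_ (by positivity)
  rw [← integral_const_mul]
  have hi := integrableOn_eval_sq (P - C (Q.eval y)) 0 1
  simp only [eval_sub, eval_C] at hi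
  refine setIntegral_mono_on hi ((integrable_sub_sq P Q).integral_prod_left.const_mul _)
    measurableSet_Ioo fun t _ => ?_
  have h2 := eval_sq_le_integral (P := C (P.eval t) - Q) (n := n) hn
    ((natDegree_sub_le _ _).trans (max_le (by simp) hQ)) hy
  simpa only [eval_sub, eval_C] using h2

/-! ### Mesh geometry -/

namespace Mesh

variable (𝒯 : Mesh)

lemma lo_lt_hi (i : Fin 𝒯.M) : 𝒯.lo i < 𝒯.hi i := 𝒯.strictMono Fin.castSucc_lt_succ

lemma h_pos (i : Fin 𝒯.M) : 0 < 𝒯.h i := sub_pos.2 (𝒯.lo_lt_hi i)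

lemma neg_one_le_node (k : Fin (𝒯.M + 1)) : -1 ≤ 𝒯.node k := by
  rw [← 𝒯.node_zero]; exact 𝒯.strictMono.monotone (Fin.zero_le k)

lemma node_le_one (k : Fin (𝒯.M + 1)) : 𝒯.node k ≤ 1 := by
  rw [← 𝒯.node_last]; exact 𝒯.strictMono.monotone (Fin.le_last k)

lemma M_pos : 0 < 𝒯.M := by
  rcases Nat.eq_zero_or_pos 𝒯.M with h | h
  · have e : (Fin.last 𝒯.M) = 0 := by ext; simp [h]
    have := 𝒯.node_last
    rw [e, 𝒯.node_zero] at this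
    norm_num at this
  · exact h

lemma elt_subset_Om (i : Fin 𝒯.M) : 𝒯.elt i ⊆ Om :=
  Ioo_subset_Ioo (𝒯.neg_one_le_node _) (𝒯.node_le_one _)

lemma closure_elt (i : Fin 𝒯.M) : closure (𝒯.elt i) = Icc (𝒯.lo i) (𝒯.hi i) :=
  closure_Ioo (𝒯.lo_lt_hi i).ne

lemma hi_le_lo {i j : Fin 𝒯.M} (hij : i < j) : 𝒯.hi i ≤ 𝒯.lo j :=
  𝒯.strictMono.monotone (by simp only [Fin.le_def, Fin.val_succ, Fin.val_castSucc]; exact hij)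

lemma elt_disjoint {i j : Fin 𝒯.M} (hij : i ≠ j) :
    Disjoint (Ioc (𝒯.lo i) (𝒯.hi i)) (Ioc (𝒯.lo j) (𝒯.hi j)) := by
  rw [Set.disjoint_left]
  intro x hx hy
  rcases lt_or_gt_of_ne hij with h | h
  · exact absurd (hx.2.trans (𝒯.hi_le_lo h)) (not_le.2 hy.1)
  · exact absurd (hy.2.trans (𝒯.hi_le_lo h)) (not_le.2 hx.1)

lemma iUnion_Ioc : ⋃ i, Ioc (𝒯.lo i) (𝒯.hi i) = Ioc (-1) 1 := by
  refine Subset.antisymm (iUnion_subset fun i =>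
    Ioc_subset_Ioc (𝒯.neg_one_le_node _) (𝒯.node_le_one _)) fun x hx => ?_
  have key : ∀ k : Fin (𝒯.M + 1), x ≤ 𝒯.node k → ∃ i, x ∈ Ioc (𝒯.lo i) (𝒯.hi i) := by
    intro k
    induction k using Fin.induction with
    | zero => intro h; rw [𝒯.node_zero] at h; exact absurd h (not_le.2 hx.1)
    | succ k ih =>
      intro h
      by_cases hk : x ≤ 𝒯.node k.castSucc
      · exact ih hk
      · exact ⟨k, not_le.1 hk, h⟩
  obtain ⟨i, hi⟩ := key (Fin.last _) (by rw [𝒯.node_last]; exact hx.2)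
  exact mem_iUnion.2 ⟨i, hi⟩

lemma restrict_Om : volume.restrict Om = ∑ i, volume.restrict (𝒯.elt i) := by
  have h1 : volume.restrict Om = volume.restrict (Ioc (-1 : ℝ) 1) :=
    Measure.restrict_congr_set Ioo_ae_eq_Ioc
  rw [h1, ← 𝒯.iUnion_Ioc, Measure.restrict_iUnion (fun i j hij => 𝒯.elt_disjoint hij)
    fun i => measurableSet_Ioc, Measure.sum_fintype]
  exact Finset.sum_congr rfl fun i _ => (Measure.restrict_congr_set Ioo_ae_eq_Ioc).symm

/-- A function that is Lipschitz continuous on every element and continuous is Lipschitz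
continuous. -/
lemma lipschitz_of_elements {f : ℝ → ℝ} {K : ℝ}
    (h : ∀ i, ∀ x ∈ Icc (𝒯.lo i) (𝒯.hi i), ∀ y ∈ Icc (𝒯.lo i) (𝒯.hi i), x ≤ y →
      |f x - f y| ≤ K * (y - x)) :
    ∀ x ∈ Icc (-1 : ℝ) 1, ∀ y ∈ Icc (-1 : ℝ) 1, x ≤ y → |f x - f y| ≤ K * (y - x) := by
  have key : ∀ k : Fin (𝒯.M + 1), ∀ x, -1 ≤ x → ∀ y, x ≤ y → y ≤ 𝒯.node k →
      |f x - f y| ≤ K * (y - x) := by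
    intro k
    induction k using Fin.induction with
    | zero =>
      intro x hx y hxy hy
      rw [𝒯.node_zero] at hy
      obtain rfl : x = y := by linarith
      simp
    | succ k ih =>
      intro x hx y hxy hy
      by_cases hy' : y ≤ 𝒯.node k.castSucc
      · exact ih x hx y hxy hy'
      · push Not at hy'
        by_cases hx' : x ≤ 𝒯.node k.castSucc
        · have h1 := ih x hx _ hx' le_rfl
          have h2 := h k (𝒯.lo k) ⟨le_rfl, (𝒯.lo_lt_hi k).le⟩ y ⟨hy'.le, hy⟩ hy'.le
          have h3 := abs_sub_le (f x) (f (𝒯.lo k)) (f y)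
          simp only [lo] at h2 h3
          linarith
        · push Not at hx'
          exact h k x ⟨hx'.le, hxy.trans hy⟩ y ⟨hy'.le, hy⟩ hxy
  intro x hx y hy hxy
  exact key (Fin.last _) x hx.1 y hxy (by rw [𝒯.node_last]; exact hy.2)

/-- Lipschitz continuous functions vanishing outside `Ω` that are polynomials of degree at most
`r` on the closed elements. -/
structure IsPiecewisePoly (r : ℕ) (u : ℝ → ℝ) : Prop where
  lip : ∃ K : ℝ, 0 < K ∧ ∀ x y, |u x - u y| ≤ K * |x - y|
  zero : ∀ x, x ∉ Om → u x = 0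
  poly : ∀ i, ∃ q : ℝ[X], q.natDegree ≤ r ∧ ∀ x ∈ Icc (𝒯.lo i) (𝒯.hi i), u x = q.eval x

end Mesh

/-! ### Regularity of the splines -/

lemma volume_restrict_Om_univ : (volume.restrict Om) univ = 2 := by
  rw [Measure.restrict_apply_univ, Om, Real.volume_Ioo]
  norm_num

lemma two_rpow_half_le : (2 : ℝ≥0∞) ^ (1 / 2 : ℝ) ≤ 2 := by
  calc (2 : ℝ≥0∞) ^ (1 / 2 : ℝ) ≤ 2 ^ (1 : ℝ) :=
        ENNReal.rpow_le_rpow_of_exponent_le (by norm_num) (by norm_num)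
    _ = 2 := ENNReal.rpow_one 2

/-- Elements of `H¹₀(Ω)` have a continuous representative that vanishes at the boundary. -/
lemma MemH10.exists_continuous {u : ℝ → ℝ} (hu : MemH10 u) :
    ∃ G : ℝ → ℝ, Continuous G ∧ G (-1) = 0 ∧ G 1 = 0 ∧ u =ᵐ[volume.restrict Om] G := by
  obtain ⟨g, ⟨hu2, hg2, -⟩, happ⟩ := hu
  have hfin : IsFiniteMeasure (volume.restrict Om) := ⟨by rw [volume_restrict_Om_univ]; simp⟩
  have hOm : MeasurableSet Om := measurableSet_Ioo
  have hgint : IntegrableOn g Om := hg2.integrable one_le_two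
  set g₀ := Om.indicator g with hg₀
  have hg₀int : Integrable g₀ := hgint.integrable_indicator hOm
  set G : ℝ → ℝ := fun x => ∫ t in (-1 : ℝ)..x, g₀ t with hG
  have hGc : Continuous G :=
    intervalIntegral.continuous_primitive (fun a b => hg₀int.intervalIntegrable) _
  -- With $G$ the primitive of $g$ that vanishes at $-1$, the fundamental theorem of calculus and
  -- Hölder's inequality make a test function uniformly close to $G$ once its derivative is close to
  -- $g$ in $L^2$.
  have hclose : ∀ φ, IsTest φ → ∀ x ∈ Icc (-1 : ℝ) 1,
      ‖φ x - G x‖ₑ ≤ eLpNorm (fun x => g x - deriv φ x) 2 (volume.restrict Om) * 2 := by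
    intro φ hφ x hx
    have hφ1 : ContDiff ℝ 1 φ := hφ.1.of_le (by exact_mod_cast le_top)
    have hφ' : Continuous (deriv φ) := hφ1.continuous_deriv le_rfl
    have hm1 : φ (-1) = 0 := by
      refine image_eq_zero_of_notMem_tsupport fun h => ?_
      exact lt_irrefl _ (hφ.2.2 h).1
    have hftc : ∫ t in (-1 : ℝ)..x, deriv φ t = φ x := by
      rw [intervalIntegral.integral_deriv_eq_sub
        (fun t _ => (hφ1.differentiable one_ne_zero).differentiableAt)
        (hφ'.intervalIntegrable _ _), hm1, sub_zero]
    have hsub : φ x - G x = ∫ t in (-1 : ℝ)..x, (deriv φ t - g₀ t) := by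
      rw [intervalIntegral.integral_sub (hφ'.intervalIntegrable _ _) hg₀int.intervalIntegrable,
        hftc]
    have hae : Ioc (-1 : ℝ) x ≤ᵐ[volume] Om := by
      have : Ioo (-1 : ℝ) x ⊆ Om := Ioo_subset_Ioo le_rfl hx.2
      exact Ioo_ae_eq_Ioc.symm.le.trans this.eventuallyLE
    rw [hsub, intervalIntegral.integral_of_le hx.1]
    calc ‖∫ t in Ioc (-1 : ℝ) x, (deriv φ t - g₀ t)‖ₑ
        ≤ ∫⁻ t in Ioc (-1 : ℝ) x, ‖deriv φ t - g₀ t‖ₑ := enorm_integral_le_lintegral_enorm _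
      _ ≤ ∫⁻ t in Om, ‖deriv φ t - g₀ t‖ₑ := lintegral_mono' (Measure.restrict_mono_ae hae) le_rfl
      _ = ∫⁻ t in Om, ‖g t - deriv φ t‖ₑ := by
          refine setLIntegral_congr_fun hOm fun t ht => ?_
          simp only [hg₀, indicator_of_mem ht]
          rw [← enorm_neg, neg_sub]
      _ = eLpNorm (fun x => g x - deriv φ x) 1 (volume.restrict Om) :=
          eLpNorm_one_eq_lintegral_enorm.symm
      _ ≤ eLpNorm (fun x => g x - deriv φ x) 2 (volume.restrict Om) *
            (volume.restrict Om) univ ^ (1 / (1 : ℝ≥0∞).toReal - 1 / (2 : ℝ≥0∞).toReal) :=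
          eLpNorm_le_eLpNorm_mul_rpow_measure_univ one_le_two
            (hg2.1.sub hφ'.aestronglyMeasurable)
      _ ≤ _ := by
          gcongr
          rw [volume_restrict_Om_univ]
          have e : 1 / (1 : ℝ≥0∞).toReal - 1 / (2 : ℝ≥0∞).toReal = 1 / 2 := by simp; norm_num
          rw [e]
          exact two_rpow_half_le
  have hG1 : G 1 = 0 := by
    rw [← enorm_eq_zero, ← nonpos_iff_eq_zero]
    refine le_of_forall_pos_le_add fun ε hε => ?_
    rw [zero_add]
    obtain ⟨φ, hφ, -, h2⟩ := happ (ε / 2) (ENNReal.half_pos hε.ne')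
    have hφ1 : φ 1 = 0 := image_eq_zero_of_notMem_tsupport fun h => lt_irrefl _ (hφ.2.2 h).2
    have := hclose φ hφ 1 (by simp)
    rw [hφ1, zero_sub, enorm_neg] at this
    refine this.trans ((mul_le_mul_left h2.le 2).trans ?_)
    rw [ENNReal.div_mul_cancel (by simp) (by simp)]
  refine ⟨G, hGc, by simp [hG], hG1, ?_⟩
  have hz : eLpNorm (fun x => u x - G x) 2 (volume.restrict Om) = 0 := by
    rw [← nonpos_iff_eq_zero]
    refine le_of_forall_pos_le_add fun ε hε => ?_
    rw [zero_add]
    -- One share is for $u-\varphi$ and four are for $\varphi-G$: a factor $2$ from the uniform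
    -- estimate and a factor $2\ge\sqrt2$ from the measure of $\Omega$.
    obtain ⟨φ, hφ, h1, h2⟩ := happ (ε / 5) (ENNReal.div_pos hε.ne' (by simp))
    have hsplit : (fun x => u x - G x) = (fun x => u x - φ x) + fun x => φ x - G x := by
      ext x; simp
    have hb : eLpNorm (fun x => φ x - G x) 2 (volume.restrict Om) ≤ ε / 5 * 2 * 2 := by
      have h3 : ∀ᵐ x ∂(volume.restrict Om), ‖φ x - G x‖ₑ ≤ ε / 5 * 2 := by
        filter_upwards [ae_restrict_mem hOm] with x hx
        exact (hclose φ hφ x (Ioo_subset_Icc_self hx)).trans (mul_le_mul_left h2.le 2)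
      refine (eLpNorm_mono_enorm_ae (g := fun _ => ε / 5 * 2) (by simpa using h3)).trans ?_
      rw [eLpNorm_const' _ (by simp) (by simp), volume_restrict_Om_univ]
      simp only [enorm_eq_self]
      gcongr
      have e : 1 / (2 : ℝ≥0∞).toReal = 1 / 2 := by simp
      rw [e]
      exact two_rpow_half_le
    rw [hsplit]
    refine (eLpNorm_add_le (hu2.1.sub hφ.1.continuous.aestronglyMeasurable)
      (hφ.1.continuous.sub hGc).aestronglyMeasurable one_le_two).trans ?_
    calc _ ≤ ε / 5 + ε / 5 * 2 * 2 := add_le_add h1.le hb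
      _ = ε / 5 * 5 := by ring
      _ = ε := ENNReal.div_mul_cancel (by simp) (by simp)
  filter_upwards [(eLpNorm_eq_zero_iff (hu2.1.sub hGc.aestronglyMeasurable) (by simp)).1 hz]
    with x hx
  exact sub_eq_zero.1 hx

lemma exists_lipschitz_eval (q : ℝ[X]) (a b : ℝ) :
    ∃ K : ℝ, ∀ x ∈ Icc a b, ∀ y ∈ Icc a b, |q.eval x - q.eval y| ≤ K * |x - y| := by
  obtain ⟨K, hK⟩ := isCompact_Icc.exists_bound_of_continuousOn (s := Icc a b)
    (f := fun x => q.derivative.eval x) q.derivative.continuous.continuousOn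
  refine ⟨K, fun x hx y hy => ?_⟩
  have := (convex_Icc a b).norm_image_sub_le_of_norm_hasDerivWithin_le
    (f := fun z => q.eval z) (f' := fun z => q.derivative.eval z) (C := K)
    (fun z _ => (q.hasDerivAt z).hasDerivWithinAt) hK hy hx
  exact this

/-- The continuous representative agrees almost everywhere with the element polynomial, hence
everywhere on the closed element by continuity. Being Lipschitz on each element, it is Lipschitz on
$[-1,1]$. Agreement on the open elements serves the quadrature rules, almost everywhere agreement
the integrals. -/
lemma Mesh.exists_isPiecewisePoly (𝒯 : Mesh) {r : ℕ} {u : ℝ → ℝ} (hu : u ∈ 𝒯.spline0 r) :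
    ∃ v, 𝒯.IsPiecewisePoly r v ∧ (∀ i, ∀ x ∈ 𝒯.elt i, u x = v x) ∧ u =ᵐ[volume] v := by
  obtain ⟨⟨-, hpoly⟩, hH10, hzero⟩ := hu
  obtain ⟨G, hGc, hGm, hG1, hae⟩ := hH10.exists_continuous
  choose q hqd hq using hpoly
  have hqG : ∀ i, EqOn G (fun x => (q i).eval x) (Icc (𝒯.lo i) (𝒯.hi i)) := by
    intro i
    refine Measure.eqOn_Icc_of_ae_eq volume (𝒯.lo_lt_hi i).ne ?_ hGc.continuousOn
      (q i).continuous.continuousOn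
    have h1 : (volume.restrict (Icc (𝒯.lo i) (𝒯.hi i))) = volume.restrict (𝒯.elt i) :=
      (Measure.restrict_congr_set Ioo_ae_eq_Icc).symm
    rw [h1]
    have h2 := ae_mono (Measure.restrict_mono (𝒯.elt_subset_Om i) le_rfl) hae
    filter_upwards [h2, ae_restrict_mem measurableSet_Ioo] with x hx hx'
    rw [← hx, hq i x hx']
  have hlipG : ∃ K : ℝ, 0 < K ∧ ∀ x ∈ Icc (-1 : ℝ) 1, ∀ y ∈ Icc (-1 : ℝ) 1, x ≤ y →
      |G x - G y| ≤ K * (y - x) := by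
    choose K hK using fun i => exists_lipschitz_eval (q i) (𝒯.lo i) (𝒯.hi i)
    refine ⟨1 + ∑ i, |K i|, by positivity, 𝒯.lipschitz_of_elements fun i x hx y hy hxy => ?_⟩
    rw [hqG i hx, hqG i hy]
    refine (hK i x hx y hy).trans ?_
    rw [abs_sub_comm, abs_of_nonneg (sub_nonneg.2 hxy)]
    refine mul_le_mul_of_nonneg_right ?_ (sub_nonneg.2 hxy)
    have := Finset.single_le_sum (f := fun i => |K i|) (fun i _ => abs_nonneg _) (Finset.mem_univ i)
    linarith [le_abs_self (K i)]
  obtain ⟨K, hK0, hK⟩ := hlipG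
  -- Composition with the projection to $[-1,1]$ extends $G$ by its zero boundary values and keeps
  -- the Lipschitz constant.
  set P : ℝ → ℝ := fun x => max (-1) (min 1 x) with hP
  have hPmem : ∀ x, P x ∈ Icc (-1 : ℝ) 1 := fun x =>
    ⟨le_max_left _ _, max_le (by norm_num) (min_le_left _ _)⟩
  have hPid : ∀ x ∈ Icc (-1 : ℝ) 1, P x = x := fun x hx => by
    rw [hP]; simp [hx.1, hx.2]
  refine ⟨fun x => G (P x), ⟨⟨K, hK0, ?_⟩, ?_, ?_⟩, ?_, ?_⟩
  · have mono : ∀ x y, x ≤ y → |G (P x) - G (P y)| ≤ K * (y - x) := by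
      intro x y hxy
      refine (hK _ (hPmem x) _ (hPmem y) (by simp only [hP]; gcongr)).trans ?_
      refine mul_le_mul_of_nonneg_left ?_ hK0.le
      simp only [hP]
      rcases max_cases (-1 : ℝ) (min 1 x) with h | h <;> rcases min_cases (1 : ℝ) x with h' | h' <;>
      rcases max_cases (-1 : ℝ) (min 1 y) with h'' | h'' <;>
      rcases min_cases (1 : ℝ) y with h''' | h''' <;> linarith
    intro x y
    rcases le_total x y with h | h
    · rw [abs_sub_comm x y, abs_of_nonneg (sub_nonneg.2 h)]; exact mono x y h
    · rw [abs_sub_comm (G _), abs_of_nonneg (sub_nonneg.2 h)]; exact mono y x h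
  · intro x hx
    rcases le_or_gt x (-1) with h | h
    · have : P x = -1 := by
        rw [hP]; exact max_eq_left ((min_le_right _ _).trans h)
      simp only [this, hGm]
    · have h1 : 1 ≤ x := not_lt.1 fun h1 => hx ⟨h, h1⟩
      have : P x = 1 := by rw [hP]; simp [h1]
      simp only [this, hG1]
  · intro i
    refine ⟨q i, hqd i, fun x hx => ?_⟩
    have hx' : x ∈ Icc (-1 : ℝ) 1 :=
      ⟨(𝒯.neg_one_le_node _).trans hx.1, hx.2.trans (𝒯.node_le_one _)⟩
    simp only [hPid x hx']
    exact hqG i hx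
  · intro i x hx
    have hx' := 𝒯.elt_subset_Om i hx
    change u x = G (P x)
    rw [hPid x (Ioo_subset_Icc_self hx'), hqG i (Ioo_subset_Icc_self hx), hq i x hx]
  · have := (ae_restrict_iff' (μ := volume) (measurableSet_Ioo : MeasurableSet Om)).1 hae
    filter_upwards [this] with x hx
    by_cases hxO : x ∈ Om
    · rw [hx hxO, hPid x (Ioo_subset_Icc_self hxO)]
    · rw [hzero x hxO]
      rcases le_or_gt x (-1) with h | h
      · have : P x = -1 := by
          rw [hP]; exact max_eq_left ((min_le_right _ _).trans h)
        simp only [this, hGm]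
      · have h1 : 1 ≤ x := not_lt.1 fun h1 => hxO ⟨h, h1⟩
        have : P x = 1 := by rw [hP]; simp [h1]
        simp only [this, hG1]

/-- A continuous piecewise constant function is Lipschitz with constant $0$, hence constant, and it
vanishes at $-1$. -/
lemma Mesh.IsPiecewisePoly.eq_zero {𝒯 : Mesh} {u : ℝ → ℝ} (hu : 𝒯.IsPiecewisePoly 0 u) : u = 0 := by
  have h := 𝒯.lipschitz_of_elements (f := u) (K := 0) fun i x hx y hy _ => by
    obtain ⟨q, hq, hqu⟩ := hu.poly i
    rw [hqu x hx, hqu y hy, eq_C_of_natDegree_eq_zero (Nat.le_zero.1 hq)]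
    simp
  ext x
  by_cases hx : x ∈ Om
  · have := h (-1) (by simp) x (Ioo_subset_Icc_self hx) hx.1.le
    rw [hu.zero (-1) (by simp [Om]), zero_mul, zero_sub, abs_neg] at this
    exact abs_nonpos_iff.1 this
  · exact hu.zero x hx

/-! ### The bilinear form as a sum over the elements -/

/-- The integrand of the bilinear form. -/
noncomputable def kern (s : ℝ) (u v : ℝ → ℝ) (z : ℝ × ℝ) : ℝ :=
  (u z.1 - u z.2) * (v z.1 - v z.2) / |z.1 - z.2| ^ (1 + 2 * s)

/-- Lipschitz continuous functions vanishing outside `Ω`. -/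
structure IsLip (u : ℝ → ℝ) : Prop where
  lip : ∃ K : ℝ, 0 < K ∧ ∀ x y, |u x - u y| ≤ K * |x - y|
  zero : ∀ x, x ∉ Om → u x = 0

/-! ### Integrability of the integrand of the form -/

lemma IsLip.continuous {u : ℝ → ℝ} (hu : IsLip u) : Continuous u := by
  obtain ⟨K, hK, h⟩ := hu.lip
  refine (LipschitzWith.of_dist_le_mul (K := ⟨K, hK.le⟩) fun x y => ?_).continuous
  exact h x y

lemma IsLip.measurable_kern {u v : ℝ → ℝ} (hu : IsLip u) (hv : IsLip v) (s : ℝ) :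
    Measurable (kern s u v) := by
  have h1 := hu.continuous.measurable
  have h2 := hv.continuous.measurable
  unfold kern
  fun_prop

lemma IsLip.exists_abs_sub_le {u : ℝ → ℝ} (hu : IsLip u) :
    ∃ K : ℝ, 0 < K ∧ ∀ x y, |u x - u y| ≤ K * min |x - y| 1 := by
  obtain ⟨K, hK, h⟩ := hu.lip
  have hb : ∀ x, |u x| ≤ 2 * K := by
    intro x
    by_cases hx : x ∈ Om
    · have := h x 1
      rw [hu.zero 1 (by simp [Om]), sub_zero] at this
      refine this.trans ?_
      rw [mul_comm]
      gcongr
      exact abs_le.2 ⟨by linarith [hx.1], by linarith [hx.2]⟩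
    · rw [hu.zero x hx, abs_zero]; positivity
  refine ⟨4 * K, by positivity, fun x y => ?_⟩
  rcases min_cases |x - y| 1 with h' | h'
  · rw [h'.1]
    exact (h x y).trans (by gcongr; linarith)
  · rw [h'.1]
    have := (abs_sub _ _).trans (add_le_add (hb x) (hb y))
    linarith

/-- Near the origin the function is $|t|^{1-2s}$, integrable since $s<1$; away from it the function
is $|t|^{-1-2s}$, integrable since $s>0$. -/
lemma integrable_majorant {s : ℝ} (hs0 : 0 < s) (hs1 : s < 1) :
    Integrable fun t : ℝ => min |t| 1 ^ 2 / |t| ^ (1 + 2 * s) := by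
  have hpos : IntegrableOn (fun t : ℝ => min |t| 1 ^ 2 / |t| ^ (1 + 2 * s)) (Ioi 0) := by
    rw [← Ioc_union_Ioi_eq_Ioi zero_le_one]
    refine IntegrableOn.union ?_ ?_
    · have h1 : IntegrableOn (fun t : ℝ => t ^ (1 - 2 * s)) (Ioc 0 1) :=
        (intervalIntegrable_iff_integrableOn_Ioc_of_le zero_le_one).1
          (intervalIntegral.intervalIntegrable_rpow' (by linarith))
      refine h1.congr_fun (fun t ht => ?_) measurableSet_Ioc
      simp only
      rw [abs_of_pos ht.1, min_eq_left ht.2, ← Real.rpow_natCast, ← Real.rpow_sub ht.1]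
      congr 1; push_cast; ring
    · have h1 : IntegrableOn (fun t : ℝ => t ^ (-(1 + 2 * s))) (Ioi 1) :=
        integrableOn_Ioi_rpow_of_lt (by linarith) one_pos
      refine h1.congr_fun (fun t ht => ?_) measurableSet_Ioi
      have ht0 : 0 < t := one_pos.trans ht
      simp only
      rw [abs_of_pos ht0, min_eq_right (le_of_lt ht), Real.rpow_neg ht0.le]
      simp
  have hneg : IntegrableOn (fun t : ℝ => min |t| 1 ^ 2 / |t| ^ (1 + 2 * s)) (Iic 0) := by
    rw [integrableOn_Iic_iff_integrableOn_Iio]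
    have hpos' : IntegrableOn (fun t : ℝ => min |t| 1 ^ 2 / |t| ^ (1 + 2 * s)) (Ioi (-0)) := by
      simpa using hpos
    simpa using hpos'.comp_neg_Iio
  have := hneg.union hpos
  rwa [Iic_union_Ioi, integrableOn_univ] at this

/-- The integrand vanishes unless $x$ or $y$ lies in $\Omega$, so it is dominated by a multiple of
$(\chi(x)+\chi(y))\,\psi(x-y)$ with $\chi$ the indicator of $\Omega$ and $\psi$ the majorant. Both
summands are integrands of a convolution of integrable functions, up to exchanging the variables. -/
lemma IsLip.integrable_kern {u v : ℝ → ℝ} (hu : IsLip u) (hv : IsLip v) {s : ℝ} (hs0 : 0 < s)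
    (hs1 : s < 1) : Integrable (kern s u v) (volume.prod volume) := by
  obtain ⟨K, hK, hKu⟩ := hu.exists_abs_sub_le
  obtain ⟨L, hL, hLv⟩ := hv.exists_abs_sub_le
  set ψ : ℝ → ℝ := fun t => min |t| 1 ^ 2 / |t| ^ (1 + 2 * s) with hψ
  have hψi : Integrable ψ := integrable_majorant hs0 hs1
  have hψ0 : ∀ t, 0 ≤ ψ t := fun t => by positivity
  set χ : ℝ → ℝ := Om.indicator fun _ => 1 with hχ
  have hχi : Integrable χ := by
    refine IntegrableOn.integrable_indicator ?_ measurableSet_Ioo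
    simp [Om]
  have hχ0 : ∀ x, 0 ≤ χ x := fun x => indicator_nonneg (fun _ _ => zero_le_one) x
  have h1 : Integrable (fun p : ℝ × ℝ => χ p.2 * ψ (p.1 - p.2)) (volume.prod volume) := by
    simpa using hχi.convolution_integrand (ContinuousLinearMap.mul ℝ ℝ) hψi
  have h2 := ((h1.add h1.swap).const_mul (K * L))
  refine h2.mono' (hu.measurable_kern hv s).aestronglyMeasurable
    (Filter.Eventually.of_forall fun z => ?_)
  obtain ⟨x, y⟩ := z
  have hsymm : ψ (y - x) = ψ (x - y) := by simp only [hψ, abs_sub_comm]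
  simp only [Function.comp_apply, Pi.add_apply, Prod.swap_prod_mk, hsymm, Real.norm_eq_abs]
  by_cases hxy : x ∈ Om ∨ y ∈ Om
  · have hχ1 : 1 ≤ χ y + χ x := by
      rcases hxy with h | h
      · have : χ x = 1 := indicator_of_mem h _
        linarith [hχ0 y]
      · have : χ y = 1 := indicator_of_mem h _
        linarith [hχ0 x]
    have hk : |kern s u v (x, y)| ≤ K * L * ψ (x - y) := by
      simp only [kern, hψ]
      rw [abs_div, abs_mul, abs_of_nonneg (Real.rpow_nonneg (abs_nonneg (x - y)) _), mul_div_assoc']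
      refine div_le_div_of_nonneg_right ?_ (by positivity)
      calc _ ≤ (K * min |x - y| 1) * (L * min |x - y| 1) :=
            mul_le_mul (hKu x y) (hLv x y) (abs_nonneg _) (by positivity)
        _ = _ := by ring
    refine hk.trans ?_
    have : 0 ≤ K * L * ψ (x - y) := mul_nonneg (by positivity) (hψ0 _)
    nlinarith
  · push Not at hxy
    simp only [kern, hu.zero x hxy.1, hu.zero y hxy.2]
    simp only [sub_self, zero_mul, zero_div, abs_zero]
    have := hψ0 (x - y)
    have := hχ0 x
    have := hχ0 y
    positivity

/-! ### Integrals over the complement and decomposition of the form -/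

lemma setIntegral_Ioi_kernel {s x : ℝ} (hs : 0 < s) (hx : x < 1) :
    IntegrableOn (fun y => (|x - y| ^ (1 + 2 * s))⁻¹) (Ioi 1) ∧
    ∫ y in Ioi 1, (|x - y| ^ (1 + 2 * s))⁻¹ = (2 * s)⁻¹ * ((1 - x) ^ (2 * s))⁻¹ := by
  have hx' : 0 < 1 - x := by linarith
  have hpre : (fun y : ℝ => y - x) ⁻¹' (Ioi (1 - x)) = Ioi 1 := by ext y; simp
  have hmp := measurePreserving_sub_right volume x
  have hemb := (MeasurableEquiv.subRight x).measurableEmbedding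
  have h := hmp.setIntegral_preimage_emb hemb (fun t => t ^ (-(1 + 2 * s))) (Ioi (1 - x))
  have h' := (hmp.integrableOn_comp_preimage hemb (f := fun t => t ^ (-(1 + 2 * s)))
    (s := Ioi (1 - x))).2 (integrableOn_Ioi_rpow_of_lt (by linarith) hx')
  rw [hpre] at h h'
  have hfun : EqOn ((fun t : ℝ => t ^ (-(1 + 2 * s))) ∘ fun y => y - x)
      (fun y => (|x - y| ^ (1 + 2 * s))⁻¹) (Ioi 1) := by
    intro y hy
    have hy' : (1 : ℝ) < y := hy
    simp only [Function.comp_apply]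
    rw [abs_sub_comm, abs_of_pos (by linarith), Real.rpow_neg (by linarith)]
  refine ⟨h'.congr_fun hfun measurableSet_Ioi, ?_⟩
  rw [← setIntegral_congr_fun measurableSet_Ioi hfun]
  simp only [Function.comp_apply]
  rw [h, integral_Ioi_rpow_of_lt (by linarith) hx']
  rw [show -(1 + 2 * s) + 1 = -(2 * s) by ring, Real.rpow_neg hx'.le]
  field_simp

lemma setIntegral_Iio_kernel {s x : ℝ} (hs : 0 < s) (hx : -1 < x) :
    IntegrableOn (fun y => (|x - y| ^ (1 + 2 * s))⁻¹) (Iio (-1)) ∧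
    ∫ y in Iio (-1), (|x - y| ^ (1 + 2 * s))⁻¹ = (2 * s)⁻¹ * ((x + 1) ^ (2 * s))⁻¹ := by
  have hx' : 0 < x + 1 := by linarith
  have hpre : (fun y : ℝ => x - y) ⁻¹' (Ioi (x + 1)) = Iio (-1) := by
    ext y; simp only [mem_preimage, mem_Ioi, mem_Iio]; constructor <;> intro h <;> linarith
  have hmp := Measure.measurePreserving_sub_left volume x
  have hemb := (MeasurableEquiv.subLeft x).measurableEmbedding
  have h := hmp.setIntegral_preimage_emb hemb (fun t => t ^ (-(1 + 2 * s))) (Ioi (x + 1))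
  have h' := (hmp.integrableOn_comp_preimage hemb (f := fun t => t ^ (-(1 + 2 * s)))
    (s := Ioi (x + 1))).2 (integrableOn_Ioi_rpow_of_lt (by linarith) hx')
  rw [hpre] at h h'
  have hfun : EqOn ((fun t : ℝ => t ^ (-(1 + 2 * s))) ∘ fun y => x - y)
      (fun y => (|x - y| ^ (1 + 2 * s))⁻¹) (Iio (-1)) := by
    intro y hy
    have hy' : y < -1 := hy
    simp only [Function.comp_apply]
    rw [abs_of_pos (by linarith), Real.rpow_neg (by linarith)]
  refine ⟨h'.congr_fun hfun measurableSet_Iio, ?_⟩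
  rw [← setIntegral_congr_fun measurableSet_Iio hfun]
  simp only [Function.comp_apply]
  rw [h, integral_Ioi_rpow_of_lt (by linarith) hx']
  rw [show -(1 + 2 * s) + 1 = -(2 * s) by ring, Real.rpow_neg hx'.le]
  field_simp

lemma setIntegral_compl_kernel {s x : ℝ} (hs : 0 < s) (hx : x ∈ Om) :
    ∫ y in Omᶜ, (|x - y| ^ (1 + 2 * s))⁻¹ =
      (2 * s)⁻¹ * (((x + 1) ^ (2 * s))⁻¹ + ((1 - x) ^ (2 * s))⁻¹) := by
  obtain ⟨i1, e1⟩ := setIntegral_Ioi_kernel hs hx.2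
  obtain ⟨i2, e2⟩ := setIntegral_Iio_kernel hs hx.1
  have hset : (Omᶜ : Set ℝ) =ᵐ[volume] (Iio (-1) ∪ Ioi 1 : Set ℝ) := by
    have : Omᶜ = Iic (-1) ∪ Ici 1 := by
      ext y; simp only [Om, mem_compl_iff, mem_Ioo, mem_union, mem_Iic, mem_Ici]
      by_cases h : y ≤ -1
      · simp [h, not_lt.2 h]
      · simp [h, not_le.1 h]
    rw [this]
    exact Iio_ae_eq_Iic.symm.union Ioi_ae_eq_Ici.symm
  rw [setIntegral_congr_set hset, setIntegral_union _ measurableSet_Ioi i2 i1, e1, e2, mul_add]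
  rw [Set.disjoint_left]
  intro y hy hy'
  simp only [mem_Iio, mem_Ioi] at hy hy'
  linarith

lemma restrict_prod_le (A B : Set ℝ) :
    (volume.restrict A).prod (volume.restrict B) ≤ (volume : Measure ℝ).prod volume := by
  rw [Measure.prod_restrict]
  exact Measure.restrict_le_self

section

variable {u v : ℝ → ℝ} (hu : IsLip u) (hv : IsLip v) {s : ℝ} (hs0 : 0 < s) (hs1 : s < 1)
include hu hv hs0 hs1

lemma IsLip.integrable_kern_restrict (A B : Set ℝ) :
    Integrable (kern s u v) ((volume.restrict A).prod (volume.restrict B)) :=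
  (hu.integrable_kern hv hs0 hs1).mono_measure (restrict_prod_le A B)

lemma IsLip.integral_kern_compl :
    ∫ z, kern s u v z ∂((volume.restrict Om).prod (volume.restrict Omᶜ)) =
      ∫ x in Om, (2 * s)⁻¹ * (u x * v x * (((x + 1) ^ (2 * s))⁻¹ + ((1 - x) ^ (2 * s))⁻¹)) := by
  rw [integral_prod _ (hu.integrable_kern_restrict hv hs0 hs1 Om Omᶜ)]
  refine setIntegral_congr_fun measurableSet_Ioo fun x hx => ?_
  have : ∀ y ∈ Omᶜ, kern s u v (x, y) = u x * v x * (|x - y| ^ (1 + 2 * s))⁻¹ := by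
    intro y hy
    simp only [kern, hu.zero y hy, hv.zero y hy, sub_zero, div_eq_mul_inv]
  rw [setIntegral_congr_fun (s := Omᶜ) measurableSet_Ioo.compl this, integral_const_mul,
    setIntegral_compl_kernel hs0 hx]
  ring

/-- The plane is cut into four blocks by $\Omega$ and its complement. The block of the complement
with itself contributes nothing, and the mixed blocks agree by the symmetry of the integrand. -/
lemma IsLip.integral_kern_eq :
    ∫ x, ∫ y, (u x - u y) * (v x - v y) / |x - y| ^ (1 + 2 * s) =
      ∫ z, kern s u v z ∂((volume.restrict Om).prod (volume.restrict Om)) +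
      2 * ∫ z, kern s u v z ∂((volume.restrict Om).prod (volume.restrict Omᶜ)) := by
  have hI := hu.integrable_kern hv hs0 hs1
  have hR := fun A B => hu.integrable_kern_restrict hv hs0 hs1 A B
  have h1 : ∫ x, ∫ y, (u x - u y) * (v x - v y) / |x - y| ^ (1 + 2 * s) =
      ∫ z, kern s u v z ∂((volume : Measure ℝ).prod volume) := (integral_prod _ hI).symm
  have hvol : (volume : Measure ℝ).prod volume =
      (((volume.restrict Om).prod (volume.restrict Om)) +
        ((volume.restrict Om).prod (volume.restrict Omᶜ))) +
      (((volume.restrict Omᶜ).prod (volume.restrict Om)) +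
        ((volume.restrict Omᶜ).prod (volume.restrict Omᶜ))) := by
    rw [← Measure.prod_add, ← Measure.prod_add, ← Measure.add_prod,
      Measure.restrict_add_restrict_compl (s := Om) measurableSet_Ioo]
  have hzero : ∫ z, kern s u v z ∂((volume.restrict Omᶜ).prod (volume.restrict Omᶜ)) = 0 := by
    rw [integral_prod _ (hR _ _)]
    refine setIntegral_eq_zero_of_forall_eq_zero fun x hx =>
      setIntegral_eq_zero_of_forall_eq_zero fun y hy => ?_
    simp [kern, hu.zero x hx, hu.zero y hy]
  have hsymm : ∫ z, kern s u v z ∂((volume.restrict Omᶜ).prod (volume.restrict Om)) =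
      ∫ z, kern s u v z ∂((volume.restrict Om).prod (volume.restrict Omᶜ)) := by
    rw [← integral_prod_swap]
    congr 1; ext z
    simp only [kern, Prod.fst_swap, Prod.snd_swap]
    rw [abs_sub_comm]; ring
  rw [h1, hvol, integral_add_measure ((hR _ _).add_measure (hR _ _)) ((hR _ _).add_measure (hR _ _)),
    integral_add_measure (hR _ _) (hR _ _), integral_add_measure (hR _ _) (hR _ _), hzero, hsymm]
  ring

omit hv in
lemma IsLip.slobSq_eq :
    slobSq s u = ∫ z, kern s u u z ∂((volume.restrict Om).prod (volume.restrict Om)) := by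
  rw [integral_prod _ (hu.integrable_kern_restrict hu hs0 hs1 Om Om)]
  simp only [slobSq, kern, sq_abs, ← sq]

omit hv in
lemma IsLip.integral_kern_self_le_slobSq {A B : Set ℝ} (hA : A ⊆ Om) (hB : B ⊆ Om) :
    ∫ z, kern s u u z ∂((volume.restrict A).prod (volume.restrict B)) ≤ slobSq s u := by
  rw [hu.slobSq_eq hs0 hs1]
  refine integral_mono_measure ?_ (Filter.Eventually.of_forall fun z => ?_)
    (hu.integrable_kern_restrict hu hs0 hs1 _ _)
  · exact Measure.prod_mono (Measure.restrict_mono hA le_rfl) (Measure.restrict_mono hB le_rfl)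
  · simp only [kern, Pi.zero_apply]
    exact div_nonneg (mul_self_nonneg _) (Real.rpow_nonneg (abs_nonneg _) _)

end

/-- Boundedness of the weighted product of two Lipschitz functions that vanish at an endpoint. -/
lemma abs_mul_mul_inv_rpow_le {s K L a b d : ℝ} (hs1 : s < 1) (hd : 0 < d) (hd2 : d ≤ 2)
    (hK : 0 ≤ K) (hL : 0 ≤ L) (ha : |a| ≤ K * d) (hb : |b| ≤ L * d) :
    |a * b * (d ^ (2 * s))⁻¹| ≤ K * L * 2 ^ (2 - 2 * s) := by
  rw [abs_mul, abs_mul, abs_inv, abs_of_pos (Real.rpow_pos_of_pos hd _)]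
  calc |a| * |b| * (d ^ (2 * s))⁻¹ ≤ (K * d) * (L * d) * (d ^ (2 * s))⁻¹ := by
        gcongr
    _ = K * L * (d ^ (2 : ℝ) * d ^ (-(2 * s))) := by
        rw [Real.rpow_neg hd.le, Real.rpow_two]; ring
    _ = K * L * d ^ (2 - 2 * s) := by rw [← Real.rpow_add hd]; rfl
    _ ≤ _ := by gcongr; linarith

lemma integrableOn_Om_of_bound {f : ℝ → ℝ} (hf : Measurable f) {A : ℝ} (h : ∀ x ∈ Om, |f x| ≤ A) :
    IntegrableOn f Om := by
  have hfin : IsFiniteMeasure (volume.restrict Om) := ⟨by rw [volume_restrict_Om_univ]; simp⟩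
  refine Integrable.of_bound hf.aestronglyMeasurable A ?_
  filter_upwards [ae_restrict_mem measurableSet_Ioo] with x hx using h x hx

lemma IsLip.integrableOn_left {u v : ℝ → ℝ} (hu : IsLip u) (hv : IsLip v) {s : ℝ} (hs1 : s < 1) :
    IntegrableOn (fun x => u x * v x * ((x + 1) ^ (2 * s))⁻¹) Om := by
  obtain ⟨K, hK, hKu⟩ := hu.lip
  obtain ⟨L, hL, hLv⟩ := hv.lip
  have h1 := hu.continuous.measurable
  have h2 := hv.continuous.measurable
  refine integrableOn_Om_of_bound (by fun_prop) (A := K * L * 2 ^ (2 - 2 * s)) fun x hx => ?_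
  have hx1 : 0 < x + 1 := by linarith [hx.1]
  refine abs_mul_mul_inv_rpow_le hs1 hx1 (by linarith [hx.2]) hK.le hL.le ?_ ?_
  · simpa [hu.zero (-1) (by simp [Om]), abs_of_pos hx1] using hKu x (-1)
  · simpa [hv.zero (-1) (by simp [Om]), abs_of_pos hx1] using hLv x (-1)

lemma IsLip.integrableOn_right {u v : ℝ → ℝ} (hu : IsLip u) (hv : IsLip v) {s : ℝ} (hs1 : s < 1) :
    IntegrableOn (fun x => u x * v x * ((1 - x) ^ (2 * s))⁻¹) Om := by
  obtain ⟨K, hK, hKu⟩ := hu.lip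
  obtain ⟨L, hL, hLv⟩ := hv.lip
  have h1 := hu.continuous.measurable
  have h2 := hv.continuous.measurable
  refine integrableOn_Om_of_bound (by fun_prop) (A := K * L * 2 ^ (2 - 2 * s)) fun x hx => ?_
  have hx1 : 0 < 1 - x := by linarith [hx.2]
  refine abs_mul_mul_inv_rpow_le hs1 hx1 (by linarith [hx.1]) hK.le hL.le ?_ ?_
  · simpa [hu.zero 1 (by simp [Om]), abs_sub_comm x, abs_of_pos hx1] using hKu x 1
  · simpa [hv.zero 1 (by simp [Om]), abs_sub_comm x, abs_of_pos hx1] using hLv x 1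

/-- The bilinear form as a sum of the contributions of the elements. -/
lemma Mesh.formA_eq_sum (𝒯 : Mesh) {u v : ℝ → ℝ} (hu : IsLip u) (hv : IsLip v) {s : ℝ}
    (hs0 : 0 < s) (hs1 : s < 1) :
    formA s u v = Cs s / 2 * ((∑ i, ∑ j,
      ∫ z, kern s u v z ∂((volume.restrict (𝒯.elt i)).prod (volume.restrict (𝒯.elt j)))) +
      2 * ∑ i, (2 * s)⁻¹ * ((∫ x in 𝒯.elt i, u x * v x * ((x + 1) ^ (2 * s))⁻¹) +
        ∫ x in 𝒯.elt i, u x * v x * ((1 - x) ^ (2 * s))⁻¹)) := by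
  have hl := hu.integrableOn_left hv hs1
  have hr := hu.integrableOn_right hv hs1
  rw [formA, hu.integral_kern_eq hv hs0 hs1, hu.integral_kern_compl hv hs0 hs1]
  congr 3
  · rw [𝒯.restrict_Om, ← Measure.sum_fintype, Measure.prod_sum, Measure.sum_fintype,
      integral_finsetSum_measure fun p _ => hu.integrable_kern_restrict hv hs0 hs1 _ _,
      Fintype.sum_prod_type]
  · rw [integral_const_mul, ← Finset.mul_sum]
    congr 1
    simp only [mul_add]
    rw [integral_add hl hr, Finset.sum_add_distrib, 𝒯.restrict_Om]
    rw [IntegrableOn, 𝒯.restrict_Om, integrable_finsetSum_measure] at hl hr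
    rw [integral_finsetSum_measure hl, integral_finsetSum_measure hr]

/-! ### Transformation to the reference square -/

lemma map_affine_restrict (a : ℝ) {l : ℝ} (hl : 0 < l) :
    volume.restrict (Ioo a (a + l)) =
      ENNReal.ofReal l • (volume.restrict (Ioo (0 : ℝ) 1)).map fun x => a + x * l := by
  have h1 : (volume : Measure ℝ) = ENNReal.ofReal l • volume.map fun x => a + x * l := by
    have e : (fun x : ℝ => a + x * l) = (fun x => a + x) ∘ fun x => x * l := rfl
    rw [e, ← Measure.map_map (by fun_prop) (by fun_prop), ← Measure.map_smul]
    have := Real.smul_map_volume_mul_right hl.ne'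
    rw [abs_of_pos hl] at this
    rw [this, (measurePreserving_add_left volume a).map_eq]
  have hpre : (fun x : ℝ => a + x * l) ⁻¹' Ioo a (a + l) = Ioo 0 1 := by
    ext x; simp [hl]
  have hmeas : Measurable fun x : ℝ => a + x * l := by fun_prop
  conv_lhs => rw [h1]
  rw [Measure.restrict_smul, Measure.restrict_map hmeas measurableSet_Ioo, hpre]

lemma measurableEmbedding_affine (a : ℝ) {l : ℝ} (hl : 0 < l) :
    MeasurableEmbedding fun x : ℝ => a + x * l :=
  ((Homeomorph.mulRight₀ l hl.ne').trans (Homeomorph.addLeft a)).measurableEmbedding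

lemma Mesh.restrict_elt (𝒯 : Mesh) (i : Fin 𝒯.M) : volume.restrict (𝒯.elt i) =
    ENNReal.ofReal (𝒯.h i) • (volume.restrict (Ioo (0 : ℝ) 1)).map fun x => 𝒯.lo i + x * 𝒯.h i := by
  rw [← map_affine_restrict _ (𝒯.h_pos i), Mesh.elt, Mesh.h, add_sub_cancel]

lemma Mesh.setIntegral_elt (𝒯 : Mesh) (i : Fin 𝒯.M) (f : ℝ → ℝ) :
    ∫ x in 𝒯.elt i, f x = 𝒯.h i * ∫ x in Ioo (0 : ℝ) 1, f (𝒯.lo i + x * 𝒯.h i) := by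
  rw [𝒯.restrict_elt, integral_smul_measure,
    (measurableEmbedding_affine _ (𝒯.h_pos i)).integral_map,
    ENNReal.toReal_ofReal (𝒯.h_pos i).le, smul_eq_mul]

lemma Mesh.restrict_elt_prod (𝒯 : Mesh) (i j : Fin 𝒯.M) :
    (volume.restrict (𝒯.elt i)).prod (volume.restrict (𝒯.elt j)) =
      ENNReal.ofReal (𝒯.h i * 𝒯.h j) •
      ((volume.restrict (Ioo (0 : ℝ) 1)).prod (volume.restrict (Ioo (0 : ℝ) 1))).map
        (Prod.map (fun x => 𝒯.lo i + x * 𝒯.h i) fun x => 𝒯.lo j + x * 𝒯.h j) := by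
  rw [𝒯.restrict_elt, 𝒯.restrict_elt, Measure.prod_smul_left, Measure.prod_smul_right,
    Measure.map_prod_map _ _ (by fun_prop) (by fun_prop), smul_smul,
    ENNReal.ofReal_mul (𝒯.h_pos i).le]

lemma Mesh.integral_elt_prod (𝒯 : Mesh) (i j : Fin 𝒯.M) (F : ℝ × ℝ → ℝ) :
    ∫ z, F z ∂((volume.restrict (𝒯.elt i)).prod (volume.restrict (𝒯.elt j))) =
      𝒯.h i * 𝒯.h j * ∫ z, F (𝒯.lo i + z.1 * 𝒯.h i, 𝒯.lo j + z.2 * 𝒯.h j)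
        ∂((volume.restrict (Ioo (0 : ℝ) 1)).prod (volume.restrict (Ioo (0 : ℝ) 1))) := by
  have hpos := mul_pos (𝒯.h_pos i) (𝒯.h_pos j)
  rw [𝒯.restrict_elt_prod, integral_smul_measure,
    ((measurableEmbedding_affine _ (𝒯.h_pos i)).prodMap
      (measurableEmbedding_affine _ (𝒯.h_pos j))).integral_map,
    ENNReal.toReal_ofReal hpos.le, smul_eq_mul]
  rfl

lemma Mesh.integrable_elt_prod (𝒯 : Mesh) (i j : Fin 𝒯.M) {F : ℝ × ℝ → ℝ}
    (hF : Integrable F ((volume.restrict (𝒯.elt i)).prod (volume.restrict (𝒯.elt j)))) :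
    Integrable (fun z => F (𝒯.lo i + z.1 * 𝒯.h i, 𝒯.lo j + z.2 * 𝒯.h j))
        ((volume.restrict (Ioo (0 : ℝ) 1)).prod (volume.restrict (Ioo (0 : ℝ) 1))) := by
  have hpos := mul_pos (𝒯.h_pos i) (𝒯.h_pos j)
  rw [𝒯.restrict_elt_prod, integrable_smul_measure (by simpa using hpos) (by simp),
    ((measurableEmbedding_affine _ (𝒯.h_pos i)).prodMap
      (measurableEmbedding_affine _ (𝒯.h_pos j))).integrable_map_iff] at hF
  exact hF

lemma setIntegral_triangle (g : ℝ → ℝ) {x : ℝ} (hx : x ∈ Ioo (0 : ℝ) 1) :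
    ∫ y in Ioo 0 x, g y = ∫ y in Ioo (0 : ℝ) 1, x * g (x * y) := by
  have h := intervalIntegral.smul_integral_comp_mul_left (a := 0) (b := 1) g x
  rw [mul_zero, mul_one, smul_eq_mul] at h
  rw [integral_const_mul, ← integral_Ioc_eq_integral_Ioo, ← integral_Ioc_eq_integral_Ioo,
    ← intervalIntegral.integral_of_le hx.1.le, ← intervalIntegral.integral_of_le zero_le_one, h]

/-- The diagonal is a null set, so `S` is left unspecified there. This lets the lemma cover both the
strict triangle and, after a swap of variables, its complement. -/
lemma integral_indicator_triangle {f : ℝ × ℝ → ℝ} {S : Set (ℝ × ℝ)} (hS : MeasurableSet S)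
    (hf : Integrable f
      ((volume.restrict (Ioo (0 : ℝ) 1)).prod (volume.restrict (Ioo (0 : ℝ) 1))))
    (hS' : ∀ x y : ℝ, y < x → (x, y) ∈ S) (hS'' : ∀ x y : ℝ, x < y → (x, y) ∉ S) :
    ∫ z in S, f z ∂((volume.restrict (Ioo (0 : ℝ) 1)).prod (volume.restrict (Ioo (0 : ℝ) 1))) =
      ∫ x in Ioo (0 : ℝ) 1, ∫ y in Ioo (0 : ℝ) 1, x * f (x, x * y) := by
  rw [← integral_indicator hS, integral_prod _ (hf.indicator hS)]
  refine setIntegral_congr_fun measurableSet_Ioo fun x hx => ?_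
  rw [← setIntegral_triangle (fun y => f (x, y)) hx]
  have hsub : Ioo 0 x ⊆ Ioo (0 : ℝ) 1 := Ioo_subset_Ioo le_rfl hx.2.le
  have hae : ∀ᵐ y ∂(volume.restrict (Ioo (0 : ℝ) 1)),
      S.indicator f (x, y) = (Ioo 0 x).indicator (fun y => f (x, y)) y := by
    have hne : ∀ᵐ y ∂(volume.restrict (Ioo (0 : ℝ) 1)), y ≠ x :=
      ae_restrict_of_ae (Measure.ae_ne volume x)
    filter_upwards [hne, ae_restrict_mem measurableSet_Ioo] with y hy hy'
    rcases lt_or_gt_of_ne hy with h | h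
    · rw [indicator_of_mem (hS' x y h), indicator_of_mem (show y ∈ Ioo 0 x from ⟨hy'.1, h⟩)]
    · rw [indicator_of_notMem (hS'' x y h),
        indicator_of_notMem (fun h' : y ∈ Ioo 0 x => lt_asymm h h'.2)]
  rw [integral_congr_ae hae, setIntegral_indicator measurableSet_Ioo, inter_eq_right.2 hsub]

/-- The Duffy transformation on the unit square. -/
lemma integral_duffy {f : ℝ × ℝ → ℝ} (hf : Integrable f
    ((volume.restrict (Ioo (0 : ℝ) 1)).prod (volume.restrict (Ioo (0 : ℝ) 1)))) :
    ∫ z, f z ∂((volume.restrict (Ioo (0 : ℝ) 1)).prod (volume.restrict (Ioo (0 : ℝ) 1))) =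
      (∫ x in Ioo (0 : ℝ) 1, ∫ y in Ioo (0 : ℝ) 1, x * f (x, x * y)) +
      ∫ x in Ioo (0 : ℝ) 1, ∫ y in Ioo (0 : ℝ) 1, x * f (x * y, x) := by
  have hS : MeasurableSet {z : ℝ × ℝ | z.2 < z.1} := measurableSet_lt measurable_snd measurable_fst
  have hT : MeasurableSet {z : ℝ × ℝ | z.2 ≤ z.1} := measurableSet_le measurable_snd measurable_fst
  rw [← integral_add_compl hS hf, integral_indicator_triangle hS hf (fun _ _ h => h)
    fun _ _ h => not_lt.2 h.le]
  congr 1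
  -- Exchanging the variables turns the complement of the strict triangle into the closed one.
  have hsw := integral_indicator_triangle hT hf.swap (fun _ _ h => le_of_lt h)
    fun _ _ h => not_le.2 h
  simp only [Function.comp_apply, Prod.swap_prod_mk] at hsw
  rw [← hsw, ← integral_indicator hS.compl, ← integral_indicator hT, ← integral_prod_swap]
  congr 1; ext ⟨x, y⟩
  simp [indicator]

/-! ### Bounds for the element polynomials -/

lemma slobSq_nonneg (s : ℝ) (u : ℝ → ℝ) : 0 ≤ slobSq s u :=
  integral_nonneg fun _ => integral_nonneg fun _ =>
    div_nonneg (sq_nonneg _) (Real.rpow_nonneg (abs_nonneg _) _)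

lemma tildeNorm_nonneg (s : ℝ) (u : ℝ → ℝ) : 0 ≤ tildeNorm s u := Real.sqrt_nonneg _

lemma tildeNorm_sq (s : ℝ) (u : ℝ → ℝ) : tildeNorm s u ^ 2 =
    (∫ x in Om, |u x| ^ 2) + slobSq s u + ∫ x in Om, |u x / bdryDist x ^ s| ^ 2 := by
  have h1 : 0 ≤ ∫ x in Om, |u x| ^ 2 := integral_nonneg fun _ => sq_nonneg _
  have h2 : 0 ≤ ∫ x in Om, |u x / bdryDist x ^ s| ^ 2 := integral_nonneg fun _ => sq_nonneg _
  have h3 := slobSq_nonneg s u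
  rw [tildeNorm, Real.sq_sqrt (by positivity)]

lemma slobSq_le_tildeNorm_sq (s : ℝ) (u : ℝ → ℝ) : slobSq s u ≤ tildeNorm s u ^ 2 := by
  have h1 : 0 ≤ ∫ x in Om, |u x| ^ 2 := integral_nonneg fun _ => sq_nonneg _
  have h2 : 0 ≤ ∫ x in Om, |u x / bdryDist x ^ s| ^ 2 := integral_nonneg fun _ => sq_nonneg _
  rw [tildeNorm_sq]; linarith

lemma integral_bdry_le_tildeNorm_sq (s : ℝ) (u : ℝ → ℝ) :
    ∫ x in Om, |u x / bdryDist x ^ s| ^ 2 ≤ tildeNorm s u ^ 2 := by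
  have h1 : 0 ≤ ∫ x in Om, |u x| ^ 2 := integral_nonneg fun _ => sq_nonneg _
  have h2 := slobSq_nonneg s u
  rw [tildeNorm_sq]; linarith

lemma one_le_cast_of_ne_zero {r : ℕ} (hr : r ≠ 0) : (1 : ℝ) ≤ r := by
  exact_mod_cast Nat.one_le_iff_ne_zero.2 hr

/-! ### Distance to the boundary -/

lemma frontier_Om : frontier Om = {-1, 1} := frontier_Ioo (by norm_num)

lemma bdryDist_le_left {x : ℝ} (hx : x ∈ Om) : bdryDist x ≤ x + 1 := by
  have := Metric.infDist_le_dist_of_mem (x := x) (s := frontier Om) (y := -1)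
    (by rw [frontier_Om]; simp)
  rwa [Real.dist_eq, sub_neg_eq_add, abs_of_pos (by linarith [hx.1])] at this

lemma bdryDist_le_right {x : ℝ} (hx : x ∈ Om) : bdryDist x ≤ 1 - x := by
  have := Metric.infDist_le_dist_of_mem (x := x) (s := frontier Om) (y := 1)
    (by rw [frontier_Om]; simp)
  rwa [Real.dist_eq, abs_sub_comm, abs_of_pos (by linarith [hx.2])] at this

lemma bdryDist_pos {x : ℝ} (hx : x ∈ Om) : 0 < bdryDist x := by
  have hne : (frontier Om).Nonempty := by rw [frontier_Om]; simp
  refine (isClosed_frontier.notMem_iff_infDist_pos hne).1 fun h => ?_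
  rw [frontier_Om] at h
  rcases h with h | h
  · exact absurd hx.1 (by rw [h]; exact lt_irrefl _)
  · rw [mem_singleton_iff] at h
    exact absurd hx.2 (by rw [h]; exact lt_irrefl _)

lemma div_rpow_sq {a d s : ℝ} (hd : 0 < d) : |a / d ^ s| ^ 2 = a * a * (d ^ (2 * s))⁻¹ := by
  rw [sq_abs, div_pow, mul_comm 2 s, Real.rpow_mul hd.le, Real.rpow_two]
  ring

lemma IsLip.integrableOn_bdry {u : ℝ → ℝ} (hu : IsLip u) {s : ℝ} (hs1 : s < 1) :
    IntegrableOn (fun x => |u x / bdryDist x ^ s| ^ 2) Om := by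
  obtain ⟨K, hK, hKu⟩ := hu.lip
  have h1 := hu.continuous.measurable
  have h2 : Measurable bdryDist := (Metric.continuous_infDist_pt _).measurable
  refine integrableOn_Om_of_bound (by fun_prop) (A := K * K * 2 ^ (2 - 2 * s)) fun x hx => ?_
  have hpos := bdryDist_pos hx
  have hle : |u x| ≤ K * bdryDist x := by
    rw [← div_le_iff₀' hK]
    refine (Metric.le_infDist (by rw [frontier_Om]; simp)).2 fun {y} hy => ?_
    rw [div_le_iff₀' hK]
    have := hKu x y
    rw [frontier_Om] at hy
    have hy0 : u y = 0 := hu.zero y fun hy' => by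
      rcases hy with rfl | hy
      · exact lt_irrefl _ hy'.1
      · rw [mem_singleton_iff] at hy; subst hy; exact lt_irrefl _ hy'.2
    rwa [hy0, sub_zero] at this
  rw [div_rpow_sq hpos]
  exact abs_mul_mul_inv_rpow_le hs1 hpos (by linarith [bdryDist_le_left hx, bdryDist_le_right hx])
    hK.le hK.le hle hle

lemma Mesh.IsPiecewisePoly.isLip {𝒯 : Mesh} {r : ℕ} {u : ℝ → ℝ} (hu : 𝒯.IsPiecewisePoly r u) :
    IsLip u := ⟨hu.lip, hu.zero⟩

/-- `U` are the pullbacks of the piecewise polynomial `u` to the reference element. -/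
structure Mesh.IsRef (𝒯 : Mesh) (r : ℕ) (u : ℝ → ℝ) (U : Fin 𝒯.M → ℝ[X]) : Prop where
  lip : IsLip u
  deg : ∀ i, (U i).natDegree ≤ r
  eval : ∀ i, ∀ x ∈ Icc (0 : ℝ) 1, u (𝒯.lo i + x * 𝒯.h i) = (U i).eval x

lemma Mesh.IsPiecewisePoly.exists_isRef {𝒯 : Mesh} {r : ℕ} {u : ℝ → ℝ}
    (hu : 𝒯.IsPiecewisePoly r u) : ∃ U, 𝒯.IsRef r u U := by
  choose q hq hqu using hu.poly
  refine ⟨fun i => (q i).comp (C (𝒯.lo i) + X * C (𝒯.h i)), hu.isLip, fun i => ?_, fun i x hx => ?_⟩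
  · refine natDegree_comp_le.trans ?_
    have : (C (𝒯.lo i) + X * C (𝒯.h i)).natDegree ≤ 1 := by compute_degree
    calc _ ≤ (q i).natDegree * 1 := Nat.mul_le_mul_left _ this
      _ ≤ r := by rw [mul_one]; exact hq i
  · rw [hqu i]
    · simp [mul_comm x]
    · have hh := 𝒯.h_pos i
      have e : 𝒯.hi i = 𝒯.lo i + 𝒯.h i := by simp [Mesh.h]
      rw [e]
      constructor
      · nlinarith [hx.1]
      · nlinarith [hx.2]

/-! ### Scaled bounds of the element polynomials by the norm -/

namespace Mesh.IsRef

variable {𝒯 : Mesh} {r : ℕ} {u : ℝ → ℝ} {U : Fin 𝒯.M → ℝ[X]} (hU : 𝒯.IsRef r u U)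
include hU

/-- The seminorm restricted to the pair of elements is bounded below by replacing the distance of
the points by its upper bound `D`. What remains is the unweighted double integral that the inverse
estimates need. -/
lemma pair_bound {s : ℝ} (hs0 : 0 < s) (hs1 : s < 1) (i j : Fin 𝒯.M) {D : ℝ}
    (hDb : ∀ x ∈ Ioo (0 : ℝ) 1, ∀ y ∈ Ioo (0 : ℝ) 1,
      |𝒯.lo i + x * 𝒯.h i - (𝒯.lo j + y * 𝒯.h j)| ≤ D) :
    𝒯.h i * 𝒯.h j * (D ^ (1 + 2 * s))⁻¹ * ∫ z, ((U i).eval z.1 - (U j).eval z.2) ^ 2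
      ∂((volume.restrict (Ioo (0 : ℝ) 1)).prod (volume.restrict (Ioo (0 : ℝ) 1))) ≤
      tildeNorm s u ^ 2 := by
  have hpos := mul_pos (𝒯.h_pos i) (𝒯.h_pos j)
  refine le_trans ?_ (slobSq_le_tildeNorm_sq s u)
  refine le_trans ?_ (hU.lip.integral_kern_self_le_slobSq hs0 hs1 (𝒯.elt_subset_Om i)
    (𝒯.elt_subset_Om j))
  have hint := 𝒯.integrable_elt_prod i j
    (hU.lip.integrable_kern_restrict hU.lip hs0 hs1 (𝒯.elt i) (𝒯.elt j))
  rw [𝒯.integral_elt_prod, mul_assoc, ← integral_const_mul]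
  refine mul_le_mul_of_nonneg_left ?_ hpos.le
  refine integral_mono_ae ((integrable_sub_sq _ _).const_mul _) hint ?_
  rw [Measure.prod_restrict]
  filter_upwards [ae_restrict_mem (measurableSet_Ioo.prod measurableSet_Ioo)] with z hz
  simp only [kern]
  rw [hU.eval i _ (Ioo_subset_Icc_self hz.1), hU.eval j _ (Ioo_subset_Icc_self hz.2), ← sq]
  set t := |𝒯.lo i + z.1 * 𝒯.h i - (𝒯.lo j + z.2 * 𝒯.h j)| with ht
  -- For coinciding points the kernel is a quotient by zero; the difference of the values vanishes
  -- as well, so both sides are zero.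
  rcases (abs_nonneg (𝒯.lo i + z.1 * 𝒯.h i - (𝒯.lo j + z.2 * 𝒯.h j))).eq_or_lt with h0 | h0
  · have e : 𝒯.lo i + z.1 * 𝒯.h i = 𝒯.lo j + z.2 * 𝒯.h j := by
      rw [← sub_eq_zero]; exact abs_eq_zero.1 h0.symm
    have e' : (U i).eval z.1 = (U j).eval z.2 := by
      rw [← hU.eval i _ (Ioo_subset_Icc_self hz.1), ← hU.eval j _ (Ioo_subset_Icc_self hz.2), e]
    rw [e', sub_self]; simp
  · rw [mul_comm, ← div_eq_mul_inv]
    have hle : t ^ (1 + 2 * s) ≤ D ^ (1 + 2 * s) :=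
      Real.rpow_le_rpow h0.le (hDb _ hz.1 _ hz.2) (by linarith)
    exact div_le_div_of_nonneg_left (sq_nonneg _) (Real.rpow_pos_of_pos h0 _) hle

/-- Here the diameter $D=h$ gives the scaling $h^2h^{-(1+2s)}=h^{1-2s}$. -/
lemma derivative_bound {s : ℝ} (hs0 : 0 < s) (hs1 : s < 1) (i : Fin 𝒯.M) {x : ℝ}
    (hx : x ∈ Icc (0 : ℝ) 1) :
    𝒯.h i ^ (1 - 2 * s) * (U i).derivative.eval x ^ 2 ≤ 512 * (r ^ 3 * tildeNorm s u) ^ 2 := by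
  have hh := 𝒯.h_pos i
  have h1 := hU.pair_bound hs0 hs1 i i (D := 𝒯.h i) (fun x hx y hy => by
    have e : 𝒯.lo i + x * 𝒯.h i - (𝒯.lo i + y * 𝒯.h i) = (x - y) * 𝒯.h i := by ring
    rw [e, abs_mul, abs_of_pos hh]
    have : |x - y| ≤ 1 := abs_le.2 ⟨by linarith [hx.1, hy.2], by linarith [hx.2, hy.1]⟩
    nlinarith)
  have h2 := derivative_sq_le_double_integral (hU.deg i) hx
  have e : 𝒯.h i * 𝒯.h i * (𝒯.h i ^ (1 + 2 * s))⁻¹ = 𝒯.h i ^ (1 - 2 * s) := by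
    rw [← sq, ← Real.rpow_two, ← Real.rpow_neg hh.le, ← Real.rpow_add hh]
    congr 1; ring
  rw [e] at h1
  have hp : 0 < 𝒯.h i ^ (1 - 2 * s) := Real.rpow_pos_of_pos hh _
  calc _ ≤ 𝒯.h i ^ (1 - 2 * s) * (512 * r ^ 6 * ∫ z, ((U i).eval z.1 - (U i).eval z.2) ^ 2
      ∂((volume.restrict (Ioo (0 : ℝ) 1)).prod (volume.restrict (Ioo (0 : ℝ) 1)))) := by gcongr
    _ = 512 * r ^ 6 * (𝒯.h i ^ (1 - 2 * s) * ∫ z, ((U i).eval z.1 - (U i).eval z.2) ^ 2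
      ∂((volume.restrict (Ioo (0 : ℝ) 1)).prod (volume.restrict (Ioo (0 : ℝ) 1)))) := by ring
    _ ≤ 512 * r ^ 6 * tildeNorm s u ^ 2 := by gcongr
    _ = _ := by ring

lemma difference_bound (hr : r ≠ 0) {s : ℝ} (hs0 : 0 < s) (hs1 : s < 1) (i j : Fin 𝒯.M) {D : ℝ}
    (hD : 0 < D) (hDb : ∀ x ∈ Ioo (0 : ℝ) 1, ∀ y ∈ Ioo (0 : ℝ) 1,
      |𝒯.lo i + x * 𝒯.h i - (𝒯.lo j + y * 𝒯.h j)| ≤ D) {x y : ℝ} (hx : x ∈ Icc (0 : ℝ) 1)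
    (hy : y ∈ Icc (0 : ℝ) 1) :
    𝒯.h i * 𝒯.h j * (D ^ (1 + 2 * s))⁻¹ * ((U i).eval x - (U j).eval y) ^ 2 ≤
      1024 * (r ^ 3 * tildeNorm s u) ^ 2 := by
  have h1 := hU.pair_bound hs0 hs1 i j hDb
  have h2 := sub_sq_le_double_integral hr (hU.deg i) (hU.deg j) hx hy
  have hp : 0 < 𝒯.h i * 𝒯.h j * (D ^ (1 + 2 * s))⁻¹ :=
    mul_pos (mul_pos (𝒯.h_pos i) (𝒯.h_pos j)) (inv_pos.2 (Real.rpow_pos_of_pos hD _))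
  have hr1 := one_le_cast_of_ne_zero hr
  calc _ ≤ 𝒯.h i * 𝒯.h j * (D ^ (1 + 2 * s))⁻¹ *
        (1024 * r ^ 4 * ∫ z, ((U i).eval z.1 - (U j).eval z.2) ^ 2
      ∂((volume.restrict (Ioo (0 : ℝ) 1)).prod (volume.restrict (Ioo (0 : ℝ) 1)))) := by gcongr
    _ = 1024 * r ^ 4 * (𝒯.h i * 𝒯.h j * (D ^ (1 + 2 * s))⁻¹ *
        ∫ z, ((U i).eval z.1 - (U j).eval z.2) ^ 2
      ∂((volume.restrict (Ioo (0 : ℝ) 1)).prod (volume.restrict (Ioo (0 : ℝ) 1)))) := by ring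
    _ ≤ 1024 * r ^ 4 * tildeNorm s u ^ 2 := by gcongr
    -- Differences cost only $r^2$ after taking roots; the larger power, admissible because $r\ge1$,
    -- matches the derivative bound.
    _ ≤ 1024 * r ^ 6 * tildeNorm s u ^ 2 := by gcongr; norm_num
    _ = _ := by ring

/-- Near the complement, values rather than differences occur. They are controlled by the weighted
term of the norm, because $\operatorname{dist}(x,\partial\Omega)^{-2s}\ge\delta^{-2s}$ on the
element. -/
lemma value_bound (hr : r ≠ 0) {s : ℝ} (hs0 : 0 < s) (hs1 : s < 1) (i : Fin 𝒯.M) {δ : ℝ}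
    (hδb : ∀ x ∈ 𝒯.elt i, bdryDist x ≤ δ) {x : ℝ} (hx : x ∈ Icc (0 : ℝ) 1) :
    𝒯.h i * (δ ^ (2 * s))⁻¹ * (U i).eval x ^ 2 ≤ 32 * (r ^ 3 * tildeNorm s u) ^ 2 := by
  have hh := 𝒯.h_pos i
  have hmem : ∀ y ∈ Ioo (0 : ℝ) 1, 𝒯.lo i + y * 𝒯.h i ∈ 𝒯.elt i := by
    intro y hy
    have e : 𝒯.hi i = 𝒯.lo i + 𝒯.h i := by simp [Mesh.h]
    refine ⟨?_, ?_⟩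
    · nlinarith [hy.1]
    · rw [e]; nlinarith [hy.2]
  have hδ : 0 < δ := by
    have h := hmem (1 / 2) (by norm_num)
    exact (bdryDist_pos (𝒯.elt_subset_Om i h)).trans_le (hδb _ h)
  have hr1 := one_le_cast_of_ne_zero hr
  have hδp : 0 < (δ ^ (2 * s))⁻¹ := inv_pos.2 (Real.rpow_pos_of_pos hδ _)
  have hI := (hU.lip.integrableOn_bdry hs1).mono_set (𝒯.elt_subset_Om i)
  have h1 : 𝒯.h i * ((δ ^ (2 * s))⁻¹ * ∫ y in Ioo (0 : ℝ) 1, (U i).eval y ^ 2) ≤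
      tildeNorm s u ^ 2 := by
    calc _ = ∫ y in 𝒯.elt i, (δ ^ (2 * s))⁻¹ * u y ^ 2 := by
          rw [𝒯.setIntegral_elt, ← integral_const_mul]
          congr 1
          refine setIntegral_congr_fun measurableSet_Ioo fun y hy => ?_
          rw [hU.eval i y (Ioo_subset_Icc_self hy)]
      _ ≤ ∫ y in 𝒯.elt i, |u y / bdryDist y ^ s| ^ 2 := by
          refine setIntegral_mono_on ?_ hI measurableSet_Ioo fun y hy => ?_
          · have := hU.lip.continuous
            exact (Continuous.integrableOn_Icc (by fun_prop)).mono_set Ioo_subset_Icc_self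
          · have hp := bdryDist_pos (𝒯.elt_subset_Om i hy)
            rw [div_rpow_sq hp, mul_comm, sq]
            have : bdryDist y ^ (2 * s) ≤ δ ^ (2 * s) :=
              Real.rpow_le_rpow hp.le (hδb y hy) (by linarith)
            have hp' := Real.rpow_pos_of_pos hp (2 * s)
            have := mul_self_nonneg (u y)
            gcongr
      _ ≤ ∫ y in Om, |u y / bdryDist y ^ s| ^ 2 :=
          setIntegral_mono_set (hU.lip.integrableOn_bdry hs1)
            (Filter.Eventually.of_forall fun _ => sq_nonneg _) (𝒯.elt_subset_Om i).eventuallyLE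
      _ ≤ _ := integral_bdry_le_tildeNorm_sq s u
  have h2 := eval_sq_le_integral hr (hU.deg i) hx
  calc _ ≤ 𝒯.h i * (δ ^ (2 * s))⁻¹ * (32 * r ^ 2 * ∫ y in Ioo (0 : ℝ) 1, (U i).eval y ^ 2) := by
        gcongr
    _ = 32 * r ^ 2 * (𝒯.h i * ((δ ^ (2 * s))⁻¹ * ∫ y in Ioo (0 : ℝ) 1, (U i).eval y ^ 2)) := by ring
    _ ≤ 32 * r ^ 2 * tildeNorm s u ^ 2 := by gcongr
    _ ≤ 32 * r ^ 6 * tildeNorm s u ^ 2 := by gcongr; norm_num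
    _ = _ := by ring

end Mesh.IsRef

/-! ### Quadrature errors on pairs of elements -/

lemma abs_mul_le_of_weighted_sq {X κ R S a b : ℝ} (hX : 0 < X) (hκ : 0 ≤ κ) (hR : 0 ≤ R)
    (hS : 0 ≤ S) (ha : X * a ^ 2 ≤ κ * R ^ 2) (hb : X * b ^ 2 ≤ κ * S ^ 2) :
    |a * b| ≤ κ * (R * S) / X := by
  rw [le_div_iff₀ hX]
  have h : (|a * b| * X) ^ 2 ≤ (κ * (R * S)) ^ 2 := by
    calc (|a * b| * X) ^ 2 = (X * a ^ 2) * (X * b ^ 2) := by rw [mul_pow, sq_abs]; ring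
      _ ≤ (κ * R ^ 2) * (κ * S ^ 2) := mul_le_mul ha hb (by positivity) (by positivity)
      _ = _ := by ring
  exact (abs_le_of_sq_le_sq' h (by positivity)).2

/-- `X` is the power of the mesh size with which the squares of `f` and `g` are controlled, so
$|fg|\le\kappa RS/X$. The hypothesis `hK` says that the prefactor times the size of the kernel is at
most a multiple of `X`; thus the mesh size drops out of the bound. -/
lemma error_of_weighted_bounds {w₁ w₂ : ℝ → ℝ} (h₁ : IsWeight w₁) (h₂ : IsWeight w₂)
    {k : ℝ → ℝ → ℝ} {q B : ℝ} (hk : KernelApprox k q B) (hq0 : 0 < q) (hq1 : q ≤ 1) {r p : ℕ}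
    {f g : ℝ → ℝ → ℝ} (hf : f ∈ biPoly r) (hg : g ∈ biPoly p) {X κ R S c K : ℝ} (hX : 0 < X)
    (hκ : 0 ≤ κ) (hR : 0 ≤ R) (hS : 0 ≤ S) (hc : 0 ≤ c)
    (hfb : ∀ x ∈ Ioo (0 : ℝ) 1, ∀ y ∈ Ioo (0 : ℝ) 1, X * f x y ^ 2 ≤ κ * R ^ 2)
    (hgb : ∀ x ∈ Ioo (0 : ℝ) 1, ∀ y ∈ Ioo (0 : ℝ) 1, X * g x y ^ 2 ≤ κ * S ^ 2)
    (hK : c * B ≤ K * X) (n : ℕ) :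
    |c * dInt w₁ w₂ (fun x y => f x y * g x y * k x y) -
      c * dGauss w₁ w₂ n (fun x y => f x y * g x y * k x y)| ≤
      2 * ((wMeas w₁).real univ * (wMeas w₂).real univ) * K * κ * (R * S) *
        q ^ (2 * (n : ℤ) - 1 - ((r + p : ℕ) : ℤ)) := by
  have hfg : (fun x y => f x y * g x y) ∈ biPoly (r + p) := biPoly_mul hf hg
  have h := abs_dInt_sub_dGauss_le h₁ h₂ hk hq0 hq1 hfg (A := κ * (R * S) / X)
    (fun x hx y hy => abs_mul_le_of_weighted_sq hX hκ hR hS (hfb x hx y hy) (hgb x hx y hy)) n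
  set E := q ^ (2 * (n : ℤ) - 1 - ((r + p : ℕ) : ℤ)) with hE
  have hE0 : 0 ≤ E := by positivity
  rw [← mul_sub, abs_mul, abs_of_nonneg hc]
  calc _ ≤ c * (2 * ((wMeas w₁).real univ * (wMeas w₂).real univ) * (κ * (R * S) / X * B) * E) := by
        gcongr
    _ = 2 * ((wMeas w₁).real univ * (wMeas w₂).real univ) * (κ * (R * S)) * E * (c * B) / X := by
        ring
    _ ≤ 2 * ((wMeas w₁).real univ * (wMeas w₂).real univ) * (κ * (R * S)) * E * (K * X) / X := by
        gcongr
    _ = _ := by field_simp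

lemma kernelApprox_one {q : ℝ} (hq : 0 ≤ q) : KernelApprox (fun _ _ => 1) q 1 :=
  ⟨measurable_const, fun _ _ _ _ => by simp,
    fun m => ⟨_, biPoly_const 1 m, fun _ _ _ _ => by simpa using pow_nonneg hq m⟩⟩

/-! ### Polynomial difference quotients -/

lemma exists_derivative_eq (P : ℝ[X]) {a b : ℝ} (ha : a ∈ Icc (0 : ℝ) 1) (hb : b ∈ Icc (0 : ℝ) 1) :
    ∃ ξ ∈ Icc (0 : ℝ) 1, P.eval b - P.eval a = P.derivative.eval ξ * (b - a) := by
  have key : ∀ a b : ℝ, a ∈ Icc (0 : ℝ) 1 → b ∈ Icc (0 : ℝ) 1 → a < b →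
      ∃ ξ ∈ Icc (0 : ℝ) 1, P.eval b - P.eval a = P.derivative.eval ξ * (b - a) := by
    intro a b ha hb hab
    obtain ⟨ξ, hξ, h⟩ := exists_hasDerivAt_eq_slope (fun x => P.eval x)
      (fun x => P.derivative.eval x) hab P.continuous.continuousOn fun x _ => P.hasDerivAt x
    refine ⟨ξ, ⟨ha.1.trans hξ.1.le, hξ.2.le.trans hb.2⟩, ?_⟩
    rw [h, div_mul_cancel₀ _ (sub_pos.2 hab).ne']
  rcases lt_trichotomy a b with h | h | h
  · exact key a b ha hb h
  · exact ⟨a, ha, by rw [h]; ring⟩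
  · obtain ⟨ξ, hξ, e⟩ := key b a hb ha h
    exact ⟨ξ, hξ, by linear_combination -e⟩

/-- For monomials, $x^k-(xy)^k=(x-xy)\,x^{k-1}\sum_{j<k}y^j$ by the geometric sum. -/
lemma exists_biPoly_slope {P : ℝ[X]} {r : ℕ} (hP : P.natDegree ≤ r) :
    ∃ g ∈ biPoly r, ∀ x y, g x y * (x - x * y) = P.eval x - P.eval (x * y) := by
  refine ⟨∑ k ∈ Finset.range (r + 1), P.coeff k •
    ∑ j ∈ Finset.range k, fun x y => x ^ (k - 1) * y ^ j, ?_, fun x y => ?_⟩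
  · refine Submodule.sum_mem _ fun k hk => Submodule.smul_mem _ _ (Submodule.sum_mem _ fun j hj => ?_)
    rw [Finset.mem_range] at hk hj
    exact biPoly_monomial (by omega) (by omega)
  · rw [eval_eq_sum_range' (Nat.lt_succ_of_le hP), eval_eq_sum_range' (Nat.lt_succ_of_le hP),
      ← Finset.sum_sub_distrib]
    simp only [Finset.sum_apply, Pi.smul_apply, smul_eq_mul, Finset.sum_mul, ← Finset.mul_sum]
    refine Finset.sum_congr rfl fun k _ => ?_
    rcases Nat.eq_zero_or_pos k with rfl | hk
    · simp
    · have h1 := mul_neg_geom_sum y k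
      have h2 : x ^ k = x ^ (k - 1) * x := by rw [← pow_succ, Nat.sub_add_cancel hk]
      rw [mul_pow, h2]
      linear_combination P.coeff k * x ^ (k - 1) * x * h1

lemma eval_sub_eval_zero (P : ℝ[X]) (x : ℝ) : P.eval x - P.eval 0 = x * P.divX.eval x := by
  have h := congrArg (eval x) P.divX_mul_X_add
  simp only [eval_add, eval_mul, eval_X, eval_C, coeff_zero_eq_eval_zero] at h
  linear_combination -h

/-- The common value at the shared vertex cancels, so both terms are divisible by $x$. Dividing
$Q(xy)-Q(0)$ by $x$ leaves $y$ times a polynomial of degree at most $r-1$ in $xy$, so the degree in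
each variable stays at most $r$. -/
lemma exists_biPoly_adjacent {P Q : ℝ[X]} {r : ℕ} (hr : r ≠ 0) (hP : P.natDegree ≤ r)
    (hQ : Q.natDegree ≤ r) (h0 : P.eval 0 = Q.eval 0) :
    ∃ g ∈ biPoly r, ∀ x y, g x y * x = P.eval x - Q.eval (x * y) := by
  have hQ' : (fun x y : ℝ => y * Q.divX.eval (x * y)) ∈ biPoly r := by
    have := biPoly_mul biPoly_snd (biPoly_eval biPoly_prod (P := Q.divX) (d := r - 1)
      (by rw [natDegree_divX_eq_natDegree_tsub_one]; omega))
    exact biPoly_mono (by omega) this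
  have hP' : (fun x _ : ℝ => P.divX.eval x) ∈ biPoly r :=
    biPoly_eval biPoly_fst (by rw [natDegree_divX_eq_natDegree_tsub_one]; omega)
  refine ⟨_, (biPoly r).sub_mem hP' hQ', fun x y => ?_⟩
  simp only [Pi.sub_apply]
  linear_combination -eval_sub_eval_zero P x + eval_sub_eval_zero Q (x * y) - h0

/-- The base of the geometric decay of the quadrature errors on `γ`-shape regular meshes. -/
noncomputable def rate (γ : ℝ) : ℝ := √(1 / (1 + γ))

lemma rate_pos {γ : ℝ} (hγ : 0 < γ) : 0 < rate γ := Real.sqrt_pos.2 (by positivity)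

lemma rate_lt_one {γ : ℝ} (hγ : 0 < γ) : rate γ < 1 := by
  rw [rate, Real.sqrt_lt' one_pos, one_pow, div_lt_one (by positivity)]
  linarith

/-- The decay factor of the quadrature errors. -/
noncomputable def decay (γ : ℝ) (r p n : ℕ) : ℝ := rate γ ^ (2 * (n : ℤ) - 1 - ((r + p : ℕ) : ℤ))

lemma decay_nonneg {γ : ℝ} (hγ : 0 < γ) (r p n : ℕ) : 0 ≤ decay γ r p n :=
  (zpow_pos (rate_pos hγ) _).le

lemma rpow_shift {x s : ℝ} (hx : 0 < x) : x ^ 2 * (x ^ (1 + 2 * s))⁻¹ * x = x ^ (2 - 2 * s) := by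
  rw [← Real.rpow_two, ← Real.rpow_neg hx.le, ← Real.rpow_add hx]
  nth_rewrite 2 [← Real.rpow_one x]
  rw [← Real.rpow_add hx]
  congr 1; ring

lemma rpow_shift' {x s : ℝ} (hx : 0 < x) : x ^ 2 * (x ^ (1 + 2 * s))⁻¹ = x ^ (1 - 2 * s) := by
  rw [← Real.rpow_two, ← Real.rpow_neg hx.le, ← Real.rpow_add hx]
  congr 1; ring

lemma rpow_shift'' {x s : ℝ} (hx : 0 < x) : x * (x ^ (2 * s))⁻¹ = x ^ (1 - 2 * s) := by
  nth_rewrite 1 [← Real.rpow_one x]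
  rw [← Real.rpow_neg hx.le, ← Real.rpow_add hx]
  congr 1

/-- The quadrature error on identical elements. -/
lemma exists_error_identical {γ : ℝ} (hγ : 0 < γ) {s : ℝ} (hs0 : 0 < s) (hs1 : s < 1) :
    ∃ K : ℝ, 0 ≤ K ∧ ∀ (𝒯 : Mesh) (r p n : ℕ) (u v u₀ v₀ : ℝ → ℝ) (U V : Fin 𝒯.M → ℝ[X]),
      𝒯.IsRef r u U → 𝒯.IsRef p v V →
      (∀ i, ∀ x ∈ Ioo (0 : ℝ) 1, 𝒯.pull i u₀ x = (U i).eval x) →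
      (∀ i, ∀ x ∈ Ioo (0 : ℝ) 1, 𝒯.pull i v₀ x = (V i).eval x) → ∀ i,
      |∫ z, kern s u v z ∂((volume.restrict (𝒯.elt i)).prod (volume.restrict (𝒯.elt i))) -
        𝒯.QId s n u₀ v₀ i| ≤
        K * ((r ^ 3 * tildeNorm s u) * (p ^ 3 * tildeNorm s v)) * decay γ r p n := by
  have hw₁ : IsWeight fun x => (1 - x) ^ (0 : ℝ) * x ^ (2 - 2 * s) :=
    isWeight_jacobi_right (by linarith)
  have hw₂ : IsWeight fun x => (1 - x) ^ (1 - 2 * s) * x ^ (0 : ℝ) :=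
    isWeight_jacobi_left (by linarith)
  refine ⟨2 * ((wMeas fun x => (1 - x) ^ (0 : ℝ) * x ^ (2 - 2 * s)).real univ *
    (wMeas fun x => (1 - x) ^ (1 - 2 * s) * x ^ (0 : ℝ)).real univ) * 2 * 512, by positivity, ?_⟩
  intro 𝒯 r p n u v u₀ v₀ U V hU hV hu₀ hv₀ i
  have hh := 𝒯.h_pos i
  obtain ⟨f, hf, hfe⟩ := exists_biPoly_slope (hU.deg i)
  obtain ⟨g, hg, hge⟩ := exists_biPoly_slope (hV.deg i)
  have hX : 0 < 𝒯.h i ^ (1 - 2 * s) := Real.rpow_pos_of_pos hh _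
  have hne : ∀ x ∈ Ioo (0 : ℝ) 1, ∀ y ∈ Ioo (0 : ℝ) 1, 0 < x - x * y := fun x hx y hy => by
    have := mul_pos hx.1 (sub_pos.2 hy.2); linarith
  have hbound : ∀ (P : ℝ[X]) (g : ℝ → ℝ → ℝ) (c : ℝ),
      (∀ x y, g x y * (x - x * y) = P.eval x - P.eval (x * y)) →
      (∀ x ∈ Icc (0 : ℝ) 1, 𝒯.h i ^ (1 - 2 * s) * P.derivative.eval x ^ 2 ≤ c) →
      ∀ x ∈ Ioo (0 : ℝ) 1, ∀ y ∈ Ioo (0 : ℝ) 1, 𝒯.h i ^ (1 - 2 * s) * g x y ^ 2 ≤ c := by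
    intro P g c hge hd x hx y hy
    -- The difference quotient is a value of the derivative, to which the scaled derivative bound
    -- applies.
    obtain ⟨ξ, hξ, e⟩ := exists_derivative_eq P (a := x * y) (b := x)
      ⟨mul_nonneg hx.1.le hy.1.le, mul_le_one₀ hx.2.le hy.1.le hy.2.le⟩ (Ioo_subset_Icc_self hx)
    rw [← hge] at e
    rw [mul_right_cancel₀ (hne x hx y hy).ne' e]
    exact hd ξ hξ
  have herr := error_of_weighted_bounds hw₁ hw₂ (kernelApprox_one (rate_pos hγ).le) (rate_pos hγ)
    (rate_lt_one hγ).le hf hg (K := 2) hX (by norm_num : (0 : ℝ) ≤ 512)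
    (mul_nonneg (by positivity) (tildeNorm_nonneg s u))
    (mul_nonneg (by positivity) (tildeNorm_nonneg s v)) (c := 2 * 𝒯.h i ^ (1 - 2 * s))
    (by positivity)
    (hbound _ f _ hfe fun x hx => hU.derivative_bound hs0 hs1 i hx)
    (hbound _ g _ hge fun x hx => hV.derivative_bound hs0 hs1 i hx) (by linarith) n
  simp only [mul_one] at herr
  have hfc := continuous_of_mem_biPoly hf
  have hgc := continuous_of_mem_biPoly hg
  obtain ⟨A, hA⟩ := (isCompact_Icc.prod isCompact_Icc).exists_bound_of_continuousOn
    (s := Icc (0 : ℝ) 1 ×ˢ Icc (0 : ℝ) 1) (hfc.mul hgc).continuousOn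
  have hI : ∫ z, kern s u v z ∂((volume.restrict (𝒯.elt i)).prod (volume.restrict (𝒯.elt i))) =
      2 * 𝒯.h i ^ (1 - 2 * s) * dInt (fun x => (1 - x) ^ (0 : ℝ) * x ^ (2 - 2 * s))
        (fun x => (1 - x) ^ (1 - 2 * s) * x ^ (0 : ℝ)) (fun x y => f x y * g x y) := by
    have hint := 𝒯.integrable_elt_prod i i
      (hU.lip.integrable_kern_restrict hV.lip hs0 hs1 (𝒯.elt i) (𝒯.elt i))
    rw [dInt_eq_integral hw₁ hw₂ (G := fun x y => f x y * g x y) (hfc.mul hgc).measurable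
      (fun x hx y hy => hA (x, y) ⟨Ioo_subset_Icc_self hx, Ioo_subset_Icc_self hy⟩),
      𝒯.integral_elt_prod, integral_duffy hint]
    -- The two Duffy triangles contribute equally by symmetry; this is the factor $2$ in the rule.
    have hsw : (∫ x in Ioo (0 : ℝ) 1, ∫ y in Ioo (0 : ℝ) 1,
        x * kern s u v (𝒯.lo i + x * y * 𝒯.h i, 𝒯.lo i + x * 𝒯.h i)) =
        ∫ x in Ioo (0 : ℝ) 1, ∫ y in Ioo (0 : ℝ) 1,
        x * kern s u v (𝒯.lo i + x * 𝒯.h i, 𝒯.lo i + x * y * 𝒯.h i) := by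
      congr 1; ext x; congr 1; ext y
      simp only [kern]
      rw [abs_sub_comm]; ring
    rw [hsw, ← two_mul, ← integral_const_mul, ← integral_const_mul, ← integral_const_mul]
    refine setIntegral_congr_fun measurableSet_Ioo fun x hx => ?_
    simp only
    rw [← integral_const_mul, ← integral_const_mul, ← integral_const_mul]
    refine setIntegral_congr_fun measurableSet_Ioo fun y hy => ?_
    have hxy : x * y ∈ Icc (0 : ℝ) 1 :=
      ⟨mul_nonneg hx.1.le hy.1.le, mul_le_one₀ hx.2.le hy.1.le hy.2.le⟩
    have hy1 : 0 < 1 - y := sub_pos.2 hy.2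
    simp only [kern]
    rw [hU.eval i x (Ioo_subset_Icc_self hx), hV.eval i x (Ioo_subset_Icc_self hx),
      hU.eval i _ hxy, hV.eval i _ hxy, ← hfe, ← hge]
    -- The two quotients supply $(x(1-y))^2$ and the Jacobian supplies $x$. Against the kernel
    -- $(x(1-y))^{-1-2s}$ this leaves $x^{2-2s}(1-y)^{1-2s}$, the product of the two Jacobi weights,
    -- and no further kernel.
    have e : 𝒯.lo i + x * 𝒯.h i - (𝒯.lo i + x * y * 𝒯.h i) = 𝒯.h i * (x * (1 - y)) := by ring
    rw [e, abs_of_pos (mul_pos hh (mul_pos hx.1 hy1)), Real.mul_rpow hh.le (mul_pos hx.1 hy1).le,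
      Real.mul_rpow hx.1.le hy1.le, ← rpow_shift hx.1, ← rpow_shift' hy1, ← rpow_shift' hh,
      Real.rpow_zero, Real.rpow_zero, div_eq_mul_inv, mul_inv, mul_inv]
    ring
  have hQ : 𝒯.QId s n u₀ v₀ i =
      2 * 𝒯.h i ^ (1 - 2 * s) * dGauss (fun x => (1 - x) ^ (0 : ℝ) * x ^ (2 - 2 * s))
        (fun x => (1 - x) ^ (1 - 2 * s) * x ^ (0 : ℝ)) n (fun x y => f x y * g x y) := by
    rw [Mesh.QId]
    congr 1
    refine dGauss_congr hw₁ hw₂ n (G := fun x y => (𝒯.pull i u₀ x - 𝒯.pull i u₀ (x * y)) *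
      (𝒯.pull i v₀ x - 𝒯.pull i v₀ (x * y)) / |x - x * y| ^ 2) fun x hx y hy => ?_
    have hxy : x * y ∈ Ioo (0 : ℝ) 1 := ⟨mul_pos hx.1 hy.1, mul_lt_one_of_nonneg_of_lt_one_left
      hx.1.le hx.2 hy.2.le⟩
    have hn := (hne x hx y hy).ne'
    rw [hu₀ i x hx, hu₀ i _ hxy, hv₀ i x hx, hv₀ i _ hxy, ← hfe, ← hge, sq_abs]
    rw [div_eq_iff (pow_ne_zero 2 hn)]
    ring
  rw [hI, hQ]
  exact herr

lemma dGauss_swap (w₁ w₂ : ℝ → ℝ) (n : ℕ) (G : ℝ → ℝ → ℝ) :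
    dGauss w₁ w₂ n G = dGauss w₂ w₁ n fun y x => G x y := by
  simp only [dGauss, gauss, Finset.mul_sum]
  rw [Finset.sum_comm]
  refine Finset.sum_congr rfl fun y _ => Finset.sum_congr rfl fun x _ => ?_
  ring

lemma measurePreserving_one_sub :
    MeasurePreserving (fun x : ℝ => 1 - x) (volume.restrict (Ioo (0 : ℝ) 1))
      (volume.restrict (Ioo (0 : ℝ) 1)) := by
  have := (Measure.measurePreserving_sub_left volume (1 : ℝ)).restrict_preimage
    (measurableSet_Ioo (a := (0 : ℝ)) (b := 1))
  have hpre : (fun x : ℝ => 1 - x) ⁻¹' Ioo (0 : ℝ) 1 = Ioo 0 1 := by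
    ext x; simp only [mem_preimage, mem_Ioo]; constructor <;> rintro ⟨h, h'⟩ <;> constructor <;>
      linarith
  rwa [hpre] at this

lemma measurePreserving_reflect :
    MeasurePreserving (Prod.map (fun x : ℝ => 1 - x) id)
      ((volume.restrict (Ioo (0 : ℝ) 1)).prod (volume.restrict (Ioo (0 : ℝ) 1)))
      ((volume.restrict (Ioo (0 : ℝ) 1)).prod (volume.restrict (Ioo (0 : ℝ) 1))) :=
  measurePreserving_one_sub.prod (MeasurePreserving.id _)

lemma measurableEmbedding_reflect :
    MeasurableEmbedding (Prod.map (fun x : ℝ => 1 - x) (id : ℝ → ℝ)) :=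
  (MeasurableEquiv.subLeft (1 : ℝ)).measurableEmbedding.prodMap MeasurableEmbedding.id

/-- The quadrature error on one of the two triangles of a pair of adjacent elements. -/
lemma exists_error_triangle {γ : ℝ} (hγ : 0 < γ) {s : ℝ} (hs0 : 0 < s) (hs1 : s < 1) :
    ∃ K : ℝ, 0 ≤ K ∧ ∀ (r p n : ℕ), r ≠ 0 → p ≠ 0 → ∀ (l l' : ℝ), 0 < l → 0 < l' → γ * l' ≤ l →
      ∀ (P Q P' Q' : ℝ[X]), P.natDegree ≤ r → Q.natDegree ≤ r → P'.natDegree ≤ p →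
      Q'.natDegree ≤ p → P.eval 0 = Q.eval 0 → P'.eval 0 = Q'.eval 0 →
      ∀ (R S : ℝ), 0 ≤ R → 0 ≤ S →
      (∀ x ∈ Icc (0 : ℝ) 1, l ^ (1 - 2 * s) * P.derivative.eval x ^ 2 ≤ 512 * R ^ 2) →
      (∀ x ∈ Icc (0 : ℝ) 1, l' ^ (1 - 2 * s) * Q.derivative.eval x ^ 2 ≤ 512 * R ^ 2) →
      (∀ x ∈ Icc (0 : ℝ) 1, l ^ (1 - 2 * s) * P'.derivative.eval x ^ 2 ≤ 512 * S ^ 2) →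
      (∀ x ∈ Icc (0 : ℝ) 1, l' ^ (1 - 2 * s) * Q'.derivative.eval x ^ 2 ≤ 512 * S ^ 2) →
      |l * l' * (∫ x in Ioo (0 : ℝ) 1, ∫ y in Ioo (0 : ℝ) 1,
          x * ((P.eval x - Q.eval (x * y)) * (P'.eval x - Q'.eval (x * y)) /
            |l * x + l' * (x * y)| ^ (1 + 2 * s))) -
        l * l' * dGauss (fun x => (1 - x) ^ (0 : ℝ) * x ^ (2 - 2 * s)) (fun _ => 1) n (fun x y =>
          (P.eval x - Q.eval (x * y)) * (P'.eval x - Q'.eval (x * y)) /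
            (|l + y * l'| ^ (1 + 2 * s) * x ^ 2))| ≤
      K * (R * S) * decay γ r p n := by
  have hw₁ : IsWeight fun x => (1 - x) ^ (0 : ℝ) * x ^ (2 - 2 * s) :=
    isWeight_jacobi_right (by linarith)
  have hγ1 : 0 < 1 + γ := by linarith
  obtain ⟨C, hC, hker⟩ := exists_kernelApprox_affine (1 + 2 * s) (t₀ := 1 / (1 + γ))
    (by positivity) (by rw [div_lt_one hγ1]; linarith)
  refine ⟨2 * ((wMeas fun x => (1 - x) ^ (0 : ℝ) * x ^ (2 - 2 * s)).real univ *
    (wMeas fun _ => 1).real univ) * C * (2 * (γ⁻¹ + (γ ^ (2 * s))⁻¹) * 512), by positivity, ?_⟩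
  intro r p n hr hp l l' hl hl' hll P Q P' Q' hP hQ hP' hQ' h0 h0' R S hR hS bP bQ bP' bQ'
  obtain ⟨f, hf, hfe⟩ := exists_biPoly_adjacent hr hP hQ h0
  obtain ⟨g, hg, hge⟩ := exists_biPoly_adjacent hp hP' hQ' h0'
  have hlp : 0 < l ^ (2 * s) := Real.rpow_pos_of_pos hl _
  have hl'p : 0 < l' ^ (2 * s) := Real.rpow_pos_of_pos hl' _
  have hγp : 0 < γ ^ (2 * s) := Real.rpow_pos_of_pos hγ _
  -- This scale is what the kernel bound produces below. Since $\gamma l'\le l$, it is dominated by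
  -- multiples of both $l^{1-2s}$ and $l'^{1-2s}$, the scales of the derivative bounds on the two
  -- elements.
  set X := l' * (l ^ (2 * s))⁻¹ with hX
  have hX0 : 0 < X := by positivity
  have hX1 : X ≤ γ⁻¹ * l ^ (1 - 2 * s) := by
    rw [← rpow_shift'' hl, hX, ← mul_assoc]
    gcongr
    rw [inv_mul_eq_div, le_div_iff₀ hγ]; linarith
  have hX2 : X ≤ (γ ^ (2 * s))⁻¹ * l' ^ (1 - 2 * s) := by
    rw [← rpow_shift'' hl', hX, mul_left_comm, ← mul_inv, ← Real.mul_rpow hγ.le hl'.le]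
    gcongr
  have hc0 : 0 < l + l' / 2 := by positivity
  -- After the Duffy transformation the kernel depends on $l+l'y$ only. The smallness condition
  -- $(1+\gamma)l'/2\le l+l'/2$ reduces to $\gamma l'\le 2l$.
  have hk := hker l 0 l' (l + l' / 2) (by ring) hc0 (by
    rw [abs_zero, zero_add, abs_of_pos hl', div_mul_eq_mul_div, one_mul, le_div_iff₀ hγ1]
    nlinarith)
  have hbound : ∀ (P Q : ℝ[X]) (g : ℝ → ℝ → ℝ) (R : ℝ), P.eval 0 = Q.eval 0 →
      (∀ x y, g x y * x = P.eval x - Q.eval (x * y)) →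
      (∀ x ∈ Icc (0 : ℝ) 1, l ^ (1 - 2 * s) * P.derivative.eval x ^ 2 ≤ 512 * R ^ 2) →
      (∀ x ∈ Icc (0 : ℝ) 1, l' ^ (1 - 2 * s) * Q.derivative.eval x ^ 2 ≤ 512 * R ^ 2) →
      ∀ x ∈ Ioo (0 : ℝ) 1, ∀ y ∈ Ioo (0 : ℝ) 1,
        X * g x y ^ 2 ≤ 2 * (γ⁻¹ + (γ ^ (2 * s))⁻¹) * 512 * R ^ 2 := by
    intro P Q g R h0 hge bP bQ x hx y hy
    have hz : (0 : ℝ) ∈ Icc (0 : ℝ) 1 := by simp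
    obtain ⟨ξ, hξ, e1⟩ := exists_derivative_eq P hz (Ioo_subset_Icc_self hx)
    obtain ⟨η, hη, e2⟩ := exists_derivative_eq Q (b := x * y) hz
      ⟨mul_nonneg hx.1.le hy.1.le, mul_le_one₀ hx.2.le hy.1.le hy.2.le⟩
    have e : g x y = P.derivative.eval ξ - y * Q.derivative.eval η := by
      apply mul_right_cancel₀ hx.1.ne'
      rw [hge]
      linear_combination e1 - e2 + h0
    set a := P.derivative.eval ξ
    set b := Q.derivative.eval η
    have hsq : g x y ^ 2 ≤ 2 * (a ^ 2 + b ^ 2) := by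
      rw [e]
      have h1 : (y * b) ^ 2 ≤ b ^ 2 := by
        rw [mul_pow]
        exact mul_le_of_le_one_left (sq_nonneg b) (pow_le_one₀ hy.1.le hy.2.le)
      nlinarith [sq_nonneg (a + y * b)]
    calc X * g x y ^ 2 ≤ X * (2 * (a ^ 2 + b ^ 2)) := by gcongr
      _ = 2 * (X * a ^ 2 + X * b ^ 2) := by ring
      _ ≤ 2 * (γ⁻¹ * l ^ (1 - 2 * s) * a ^ 2 + (γ ^ (2 * s))⁻¹ * l' ^ (1 - 2 * s) * b ^ 2) := by
          gcongr
      _ = 2 * (γ⁻¹ * (l ^ (1 - 2 * s) * a ^ 2) + (γ ^ (2 * s))⁻¹ * (l' ^ (1 - 2 * s) * b ^ 2)) := by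
          ring
      _ ≤ 2 * (γ⁻¹ * (512 * R ^ 2) + (γ ^ (2 * s))⁻¹ * (512 * R ^ 2)) := by
          refine mul_le_mul_of_nonneg_left (add_le_add
            (mul_le_mul_of_nonneg_left (bP ξ hξ) (by positivity))
            (mul_le_mul_of_nonneg_left (bQ η hη) (by positivity))) (by norm_num)
      _ = _ := by ring
  have hKX : l * l' * (C * ((l + l' / 2) ^ (1 + 2 * s))⁻¹) ≤ C * X := by
    have h1 : l ^ (1 + 2 * s) ≤ (l + l' / 2) ^ (1 + 2 * s) :=
      Real.rpow_le_rpow hl.le (by linarith) (by linarith)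
    have h2 : 0 < l ^ (1 + 2 * s) := Real.rpow_pos_of_pos hl _
    calc _ ≤ l * l' * (C * (l ^ (1 + 2 * s))⁻¹) := by gcongr
      _ = C * X := by
        rw [Real.rpow_add hl, Real.rpow_one, hX]
        field_simp
  have herr := error_of_weighted_bounds hw₁ isWeight_one hk (rate_pos hγ) (rate_lt_one hγ).le hf hg
    hX0 (by positivity) hR hS (by positivity : (0 : ℝ) ≤ l * l') (hbound P Q f R h0 hfe bP bQ)
    (hbound P' Q' g S h0' hge bP' bQ') hKX n
  have hkern : ∀ x y : ℝ, (|l + 0 * x + l' * y| ^ (1 + 2 * s))⁻¹ = (|l + y * l'| ^ (1 + 2 * s))⁻¹ := by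
    intro x y; rw [zero_mul, add_zero, mul_comm l']
  simp only [hkern] at herr hk
  have hfg := biPoly_mul hf hg
  have hfgc := continuous_of_mem_biPoly hfg
  obtain ⟨A, hA⟩ := (isCompact_Icc.prod isCompact_Icc).exists_bound_of_continuousOn
    (s := Icc (0 : ℝ) 1 ×ˢ Icc (0 : ℝ) 1) hfgc.continuousOn
  have hI : dInt (fun x => (1 - x) ^ (0 : ℝ) * x ^ (2 - 2 * s)) (fun _ => 1)
      (fun x y => f x y * g x y * (|l + y * l'| ^ (1 + 2 * s))⁻¹) =
      ∫ x in Ioo (0 : ℝ) 1, ∫ y in Ioo (0 : ℝ) 1,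
          x * ((P.eval x - Q.eval (x * y)) * (P'.eval x - Q'.eval (x * y)) /
            |l * x + l' * (x * y)| ^ (1 + 2 * s)) := by
    rw [dInt_eq_integral hw₁ isWeight_one
      (G := fun x y => f x y * g x y * (|l + y * l'| ^ (1 + 2 * s))⁻¹)
      (hfgc.measurable.mul hk.meas) (A := A * (C * ((l + l' / 2) ^ (1 + 2 * s))⁻¹))]
    · refine setIntegral_congr_fun measurableSet_Ioo fun x hx =>
        setIntegral_congr_fun measurableSet_Ioo fun y hy => ?_
      have hly : 0 < l + y * l' := by have := mul_pos hy.1 hl'; linarith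
      have e : l * x + l' * (x * y) = x * (l + y * l') := by ring
      rw [← hfe, ← hge, e, abs_mul, abs_of_pos hx.1, Real.mul_rpow hx.1.le (abs_nonneg _),
        ← rpow_shift hx.1, Real.rpow_zero, div_eq_mul_inv, mul_inv]
      ring
    · intro x hx y hy
      rw [abs_mul]
      have h1 := hA (x, y) ⟨Ioo_subset_Icc_self hx, Ioo_subset_Icc_self hy⟩
      exact mul_le_mul h1 (hk.bound x hx y hy) (abs_nonneg _) ((norm_nonneg _).trans h1)
  have hQ : dGauss (fun x => (1 - x) ^ (0 : ℝ) * x ^ (2 - 2 * s)) (fun _ => 1) n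
      (fun x y => f x y * g x y * (|l + y * l'| ^ (1 + 2 * s))⁻¹) =
      dGauss (fun x => (1 - x) ^ (0 : ℝ) * x ^ (2 - 2 * s)) (fun _ => 1) n (fun x y =>
          (P.eval x - Q.eval (x * y)) * (P'.eval x - Q'.eval (x * y)) /
            (|l + y * l'| ^ (1 + 2 * s) * x ^ 2)) := by
    refine dGauss_congr hw₁ isWeight_one n fun x hx y hy => ?_
    rw [← hfe, ← hge, div_eq_mul_inv, mul_inv]
    have := hx.1.ne'
    field_simp
  rw [hI, hQ] at herr
  exact herr

/-- The quadrature error on adjacent elements. -/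
lemma exists_error_adjacent {γ : ℝ} (hγ : 0 < γ) {s : ℝ} (hs0 : 0 < s) (hs1 : s < 1) :
    ∃ K : ℝ, 0 ≤ K ∧ ∀ (𝒯 : Mesh) (r p n : ℕ) (u v u₀ v₀ : ℝ → ℝ) (U V : Fin 𝒯.M → ℝ[X]),
      r ≠ 0 → p ≠ 0 → 𝒯.IsRef r u U → 𝒯.IsRef p v V →
      (∀ i, ∀ x ∈ Ioo (0 : ℝ) 1, 𝒯.pull i u₀ x = (U i).eval x) →
      (∀ i, ∀ x ∈ Ioo (0 : ℝ) 1, 𝒯.pull i v₀ x = (V i).eval x) → ∀ i j,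
      γ * 𝒯.h i ≤ 𝒯.h j → γ * 𝒯.h j ≤ 𝒯.h i → 𝒯.hi i = 𝒯.lo j →
      |∫ z, kern s u v z ∂((volume.restrict (𝒯.elt i)).prod (volume.restrict (𝒯.elt j))) -
        𝒯.QAdj s n u₀ v₀ i j| ≤
        K * ((r ^ 3 * tildeNorm s u) * (p ^ 3 * tildeNorm s v)) * decay γ r p n := by
  have hw₁ : IsWeight fun x => (1 - x) ^ (0 : ℝ) * x ^ (2 - 2 * s) :=
    isWeight_jacobi_right (by linarith)
  obtain ⟨K, hK, hKe⟩ := exists_error_triangle hγ hs0 hs1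
  refine ⟨2 * K, by positivity, ?_⟩
  intro 𝒯 r p n u v u₀ v₀ U V hr hp hU hV hu₀ hv₀ i j hij hji hadj
  have hlo : 𝒯.lo j = 𝒯.lo i + 𝒯.h i := by rw [← hadj]; simp [Mesh.h]
  have href : ∀ {r : ℕ} {u : ℝ → ℝ} {U : Fin 𝒯.M → ℝ[X]}, 𝒯.IsRef r u U →
      ((U i).comp (1 - X)).natDegree ≤ r ∧ ((U i).comp (1 - X)).eval 0 = (U j).eval 0 ∧
      ∀ x ∈ Icc (0 : ℝ) 1, 𝒯.h i ^ (1 - 2 * s) * ((U i).comp (1 - X)).derivative.eval x ^ 2 ≤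
        512 * (r ^ 3 * tildeNorm s u) ^ 2 := by
    intro r u U hU
    refine ⟨?_, ?_, fun x hx => ?_⟩
    · refine natDegree_comp_le.trans ?_
      have : (1 - X : ℝ[X]).natDegree ≤ 1 := by compute_degree
      calc _ ≤ (U i).natDegree * 1 := Nat.mul_le_mul_left _ this
        _ ≤ r := by rw [mul_one]; exact hU.deg i
    · have h1 := hU.eval i 1 (by simp)
      have h2 := hU.eval j 0 (by simp)
      rw [hlo] at h2
      simp only [eval_comp, eval_sub, eval_one, eval_X, sub_zero]
      rw [← h1, ← h2]; simp
    · have := hU.derivative_bound hs0 hs1 i (x := 1 - x) ⟨by linarith [hx.2], by linarith [hx.1]⟩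
      rw [derivative_comp]
      simpa using this
  obtain ⟨dP, zP, bP⟩ := href hU
  obtain ⟨dP', zP', bP'⟩ := href hV
  have hN := mul_nonneg (by positivity : (0 : ℝ) ≤ (r : ℝ) ^ 3) (tildeNorm_nonneg s u)
  have hN' := mul_nonneg (by positivity : (0 : ℝ) ≤ (p : ℝ) ^ 3) (tildeNorm_nonneg s v)
  -- The left element is reflected so that the shared vertex corresponds to $0$ on both reference
  -- intervals.
  set P := (U i).comp (1 - X) with hPdef
  set P' := (V i).comp (1 - X) with hPdef'
  have ePe : ∀ x, P.eval x = (U i).eval (1 - x) := fun x => by simp [hPdef]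
  have ePe' : ∀ x, P'.eval x = (V i).eval (1 - x) := fun x => by simp [hPdef']
  have err1 := hKe r p n hr hp (𝒯.h i) (𝒯.h j) (𝒯.h_pos i) (𝒯.h_pos j) hji P (U j) P' (V j) dP
    (hU.deg j) dP' (hV.deg j) zP zP' _ _ hN hN' bP (fun x hx => hU.derivative_bound hs0 hs1 j hx) bP'
    (fun x hx => hV.derivative_bound hs0 hs1 j hx)
  have err2 := hKe r p n hr hp (𝒯.h j) (𝒯.h i) (𝒯.h_pos j) (𝒯.h_pos i) hij (U j) P (V j) P'
    (hU.deg j) dP (hV.deg j) dP' zP.symm zP'.symm _ _ hN hN'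
    (fun x hx => hU.derivative_bound hs0 hs1 j hx) bP
    (fun x hx => hV.derivative_bound hs0 hs1 j hx) bP'
  set T₁ := ∫ x in Ioo (0 : ℝ) 1, ∫ y in Ioo (0 : ℝ) 1,
    x * ((P.eval x - (U j).eval (x * y)) * (P'.eval x - (V j).eval (x * y)) /
      |𝒯.h i * x + 𝒯.h j * (x * y)| ^ (1 + 2 * s)) with hT₁
  set T₂ := ∫ x in Ioo (0 : ℝ) 1, ∫ y in Ioo (0 : ℝ) 1,
    x * (((U j).eval x - P.eval (x * y)) * ((V j).eval x - P'.eval (x * y)) /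
      |𝒯.h j * x + 𝒯.h i * (x * y)| ^ (1 + 2 * s)) with hT₂
  have hI : ∫ z, kern s u v z ∂((volume.restrict (𝒯.elt i)).prod (volume.restrict (𝒯.elt j))) =
      𝒯.h i * 𝒯.h j * T₁ + 𝒯.h j * 𝒯.h i * T₂ := by
    have hint := 𝒯.integrable_elt_prod i j
      (hU.lip.integrable_kern_restrict hV.lip hs0 hs1 (𝒯.elt i) (𝒯.elt j))
    have hint' := (measurePreserving_reflect.integrable_comp_emb measurableEmbedding_reflect).2 hint
    rw [𝒯.integral_elt_prod,
      ← measurePreserving_reflect.integral_comp measurableEmbedding_reflect,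
      mul_comm (𝒯.h j), ← mul_add]
    congr 1
    refine (integral_duffy hint').trans ?_
    have hF : ∀ a ∈ Icc (0 : ℝ) 1, ∀ b ∈ Icc (0 : ℝ) 1,
        kern s u v (𝒯.lo i + (1 - a) * 𝒯.h i, 𝒯.lo j + b * 𝒯.h j) =
        (P.eval a - (U j).eval b) * (P'.eval a - (V j).eval b) /
          |𝒯.h i * a + 𝒯.h j * b| ^ (1 + 2 * s) := by
      intro a ha b hb
      have ha' : 1 - a ∈ Icc (0 : ℝ) 1 := ⟨by linarith [ha.2], by linarith [ha.1]⟩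
      simp only [kern]
      rw [hU.eval i _ ha', hV.eval i _ ha', hU.eval j b hb, hV.eval j b hb, ePe, ePe', hlo]
      congr 2
      rw [← abs_neg]
      congr 1; ring
    have hmem : ∀ x ∈ Ioo (0 : ℝ) 1, ∀ y ∈ Ioo (0 : ℝ) 1, x * y ∈ Icc (0 : ℝ) 1 :=
      fun x hx y hy => ⟨mul_nonneg hx.1.le hy.1.le, mul_le_one₀ hx.2.le hy.1.le hy.2.le⟩
    congr 1
    · refine setIntegral_congr_fun measurableSet_Ioo fun x hx =>
        setIntegral_congr_fun measurableSet_Ioo fun y hy => ?_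
      simp only [Function.comp_apply, Prod.map_apply, id]
      rw [hF x (Ioo_subset_Icc_self hx) _ (hmem x hx y hy)]
    · refine setIntegral_congr_fun measurableSet_Ioo fun x hx =>
        setIntegral_congr_fun measurableSet_Ioo fun y hy => ?_
      simp only [Function.comp_apply, Prod.map_apply, id]
      rw [hF _ (hmem x hx y hy) x (Ioo_subset_Icc_self hx), add_comm (𝒯.h i * _)]
      ring
  have hQ : 𝒯.QAdj s n u₀ v₀ i j =
      𝒯.h i * 𝒯.h j * dGauss (fun x => (1 - x) ^ (0 : ℝ) * x ^ (2 - 2 * s)) (fun _ => 1) n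
        (fun x y => (P.eval x - (U j).eval (x * y)) * (P'.eval x - (V j).eval (x * y)) /
            (|𝒯.h i + y * 𝒯.h j| ^ (1 + 2 * s) * x ^ 2)) +
      𝒯.h j * 𝒯.h i * dGauss (fun x => (1 - x) ^ (0 : ℝ) * x ^ (2 - 2 * s)) (fun _ => 1) n
        (fun x y => ((U j).eval x - P.eval (x * y)) * ((V j).eval x - P'.eval (x * y)) /
            (|𝒯.h j + y * 𝒯.h i| ^ (1 + 2 * s) * x ^ 2)) := by
    have hm1 : ∀ x ∈ Ioo (0 : ℝ) 1, 1 - x ∈ Ioo (0 : ℝ) 1 :=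
      fun x hx => ⟨by linarith [hx.2], by linarith [hx.1]⟩
    have hm2 : ∀ x ∈ Ioo (0 : ℝ) 1, ∀ y ∈ Ioo (0 : ℝ) 1, x * y ∈ Ioo (0 : ℝ) 1 :=
      fun x hx y hy => ⟨mul_pos hx.1 hy.1,
        mul_lt_one_of_nonneg_of_lt_one_left hx.1.le hx.2 hy.2.le⟩
    rw [Mesh.QAdj, mul_comm (𝒯.h j), ← mul_add]
    congr 2
    · refine dGauss_congr hw₁ isWeight_one n (G := fun x y =>
        (𝒯.pull i u₀ (1 - x) - 𝒯.pull j u₀ (x * y)) *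
          (𝒯.pull i v₀ (1 - x) - 𝒯.pull j v₀ (x * y)) /
          (|𝒯.h i + y * 𝒯.h j| ^ (1 + 2 * s) * x ^ 2)) fun x hx y hy => ?_
      rw [hu₀ i _ (hm1 x hx), hv₀ i _ (hm1 x hx), hu₀ j _ (hm2 x hx y hy), hv₀ j _ (hm2 x hx y hy),
        ePe, ePe']
    -- In the second triangle the roles of the elements are exchanged, and the rule lists its
    -- singular variable second.
    · rw [dGauss_swap]
      refine dGauss_congr isWeight_one hw₁ n (G := fun x y =>
        (𝒯.pull i u₀ (1 - x * y) - 𝒯.pull j u₀ y) *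
          (𝒯.pull i v₀ (1 - x * y) - 𝒯.pull j v₀ y) /
          (|x * 𝒯.h i + 𝒯.h j| ^ (1 + 2 * s) * y ^ 2)) fun x hx y hy => ?_
      rw [hu₀ i _ (hm1 _ (hm2 x hx y hy)), hv₀ i _ (hm1 _ (hm2 x hx y hy)), hu₀ j _ hy, hv₀ j _ hy,
        ePe, ePe', mul_comm y x, add_comm (𝒯.h j)]
      ring
  rw [hI, hQ, add_sub_add_comm]
  refine (abs_add_le _ _).trans ((add_le_add err1 err2).trans (le_of_eq ?_))
  ring

/-! ### Quadrature errors on separated elements -/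

lemma wMeas_one : wMeas (fun _ => 1) = volume.restrict (Ioo (0 : ℝ) 1) := by
  simp [wMeas]

lemma wMeas_one_real : (wMeas fun _ => 1).real univ = 1 := by
  simp [wMeas_one]

lemma inv_rpow_le_of_le_two_mul {c D σ τ : ℝ} (hc : 0 < c) (hD : 0 < D) (hDc : D ≤ 2 * c)
    (hσ : 0 ≤ σ) (hστ : σ ≤ τ) : (c ^ σ)⁻¹ ≤ 2 ^ τ * (D ^ σ)⁻¹ := by
  have h1 : D ^ σ ≤ 2 ^ τ * c ^ σ := by
    calc D ^ σ ≤ (2 * c) ^ σ := Real.rpow_le_rpow hD.le hDc hσ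
      _ = 2 ^ σ * c ^ σ := Real.mul_rpow (by norm_num) hc.le
      _ ≤ 2 ^ τ * c ^ σ := by
        have := Real.rpow_pos_of_pos hc σ
        gcongr
        norm_num
  have h2 := Real.rpow_pos_of_pos hc σ
  have h3 := Real.rpow_pos_of_pos hD σ
  rw [← div_eq_mul_inv, le_div_iff₀ h3, inv_mul_le_iff₀ h2, mul_comm (c ^ σ)]
  exact h1

/-- The quadrature error on separated elements. -/
lemma exists_error_separated {γ : ℝ} (hγ : 0 < γ) {s : ℝ} (hs0 : 0 < s) (hs1 : s < 1) :
    ∃ K : ℝ, 0 ≤ K ∧ ∀ (𝒯 : Mesh) (r p n : ℕ) (u v u₀ v₀ : ℝ → ℝ) (U V : Fin 𝒯.M → ℝ[X]),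
      r ≠ 0 → p ≠ 0 → 𝒯.IsRef r u U → 𝒯.IsRef p v V →
      (∀ i, ∀ x ∈ Ioo (0 : ℝ) 1, 𝒯.pull i u₀ x = (U i).eval x) →
      (∀ i, ∀ x ∈ Ioo (0 : ℝ) 1, 𝒯.pull i v₀ x = (V i).eval x) → ∀ i j,
      γ * 𝒯.h i ≤ 𝒯.lo j - 𝒯.hi i → γ * 𝒯.h j ≤ 𝒯.lo j - 𝒯.hi i →
      |∫ z, kern s u v z ∂((volume.restrict (𝒯.elt i)).prod (volume.restrict (𝒯.elt j))) -
        𝒯.QSep s n u₀ v₀ i j| ≤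
        K * ((r ^ 3 * tildeNorm s u) * (p ^ 3 * tildeNorm s v)) * decay γ r p n := by
  have hγ1 : 0 < 1 + γ := by linarith
  obtain ⟨C, hC, hker⟩ := exists_kernelApprox_affine (1 + 2 * s) (t₀ := 1 / (1 + γ)) (by positivity)
    (by rw [div_lt_one hγ1]; linarith)
  refine ⟨2 * ((wMeas fun _ => 1).real univ * (wMeas fun _ => 1).real univ) *
    (C * 2 ^ (3 : ℝ)) * 1024, by positivity, ?_⟩
  intro 𝒯 r p n u v u₀ v₀ U V hr hp hU hV hu₀ hv₀ i j hi hj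
  have hhi := 𝒯.h_pos i
  have hhj := 𝒯.h_pos j
  set δ := 𝒯.lo j - 𝒯.hi i with hδ
  have hδ0 : 0 < δ := (mul_pos hγ hhi).trans_le hi
  have hlo : 𝒯.lo j = 𝒯.lo i + 𝒯.h i + δ := by rw [hδ]; simp only [Mesh.h]; ring
  set D := δ + 𝒯.h i + 𝒯.h j with hD
  have hD0 : 0 < D := by positivity
  have hc0 : 0 < 𝒯.h i + δ + -𝒯.h i / 2 + 𝒯.h j / 2 := by linarith
  -- The centre value is the distance of the midpoints, $\delta+(h_i+h_j)/2$. The smallness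
  -- condition amounts to $\gamma(h_i+h_j)/2\le\delta$, the mean of the two hypotheses on the gap.
  have hk := hker (𝒯.h i + δ) (-𝒯.h i) (𝒯.h j) _ rfl hc0 (by
    rw [abs_neg, abs_of_pos hhi, abs_of_pos hhj, div_mul_eq_mul_div, one_mul, le_div_iff₀ hγ1]
    nlinarith)
  have hdist : ∀ x ∈ Ioo (0 : ℝ) 1, ∀ y ∈ Ioo (0 : ℝ) 1,
      |𝒯.lo i + x * 𝒯.h i - (𝒯.lo j + y * 𝒯.h j)| ≤ D := by
    intro x hx y hy
    rw [hlo, hD, abs_le]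
    constructor <;> nlinarith [hx.1, hx.2, hy.1, hy.2]
  have hX : 0 < 𝒯.h i * 𝒯.h j * (D ^ (1 + 2 * s))⁻¹ := by
    have := Real.rpow_pos_of_pos hD0 (1 + 2 * s); positivity
  have hmem : ∀ {r : ℕ} {u : ℝ → ℝ} {U : Fin 𝒯.M → ℝ[X]}, 𝒯.IsRef r u U →
      (fun x y : ℝ => (U i).eval x - (U j).eval y) ∈ biPoly r := fun hU =>
    (biPoly _).sub_mem (biPoly_eval biPoly_fst (hU.deg i)) (biPoly_eval biPoly_snd (hU.deg j))
  have hKX : 𝒯.h i * 𝒯.h j * (C * ((𝒯.h i + δ + -𝒯.h i / 2 + 𝒯.h j / 2) ^ (1 + 2 * s))⁻¹) ≤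
      C * 2 ^ (3 : ℝ) * (𝒯.h i * 𝒯.h j * (D ^ (1 + 2 * s))⁻¹) := by
    have := inv_rpow_le_of_le_two_mul hc0 hD0 (by rw [hD]; linarith) (σ := 1 + 2 * s) (τ := 3)
      (by linarith) (by linarith)
    calc _ ≤ 𝒯.h i * 𝒯.h j * (C * (2 ^ (3 : ℝ) * (D ^ (1 + 2 * s))⁻¹)) := by gcongr
      _ = _ := by ring
  have herr := error_of_weighted_bounds isWeight_one isWeight_one hk (rate_pos hγ)
    (rate_lt_one hγ).le (hmem hU) (hmem hV) hX (by norm_num : (0 : ℝ) ≤ 1024)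
    (mul_nonneg (by positivity) (tildeNorm_nonneg s u))
    (mul_nonneg (by positivity) (tildeNorm_nonneg s v)) (mul_pos hhi hhj).le
    (fun x hx y hy => hU.difference_bound hr hs0 hs1 i j hD0 hdist (Ioo_subset_Icc_self hx)
      (Ioo_subset_Icc_self hy))
    (fun x hx y hy => hV.difference_bound hp hs0 hs1 i j hD0 hdist (Ioo_subset_Icc_self hx)
      (Ioo_subset_Icc_self hy)) hKX n
  have hI : ∫ z, kern s u v z ∂((volume.restrict (𝒯.elt i)).prod (volume.restrict (𝒯.elt j))) =
      𝒯.h i * 𝒯.h j * dInt (fun _ => 1) (fun _ => 1) (fun x y =>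
        ((U i).eval x - (U j).eval y) * ((V i).eval x - (V j).eval y) *
          (|𝒯.h i + δ + -𝒯.h i * x + 𝒯.h j * y| ^ (1 + 2 * s))⁻¹) := by
    rw [𝒯.integral_elt_prod, ← wMeas_one]
    congr 1
    refine dInt_congr isWeight_one isWeight_one (G := fun x y => kern s u v
      (𝒯.lo i + x * 𝒯.h i, 𝒯.lo j + y * 𝒯.h j)) fun x hx y hy => ?_
    simp only [kern]
    rw [hU.eval i x (Ioo_subset_Icc_self hx), hV.eval i x (Ioo_subset_Icc_self hx),
      hU.eval j y (Ioo_subset_Icc_self hy), hV.eval j y (Ioo_subset_Icc_self hy),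
      div_eq_mul_inv, hlo, ← abs_neg]
    congr 4
    ring
  have hQ : 𝒯.QSep s n u₀ v₀ i j =
      𝒯.h i * 𝒯.h j * dGauss (fun _ => 1) (fun _ => 1) n (fun x y =>
        ((U i).eval x - (U j).eval y) * ((V i).eval x - (V j).eval y) *
          (|𝒯.h i + δ + -𝒯.h i * x + 𝒯.h j * y| ^ (1 + 2 * s))⁻¹) := by
    rw [Mesh.QSep]
    congr 1
    refine dGauss_congr isWeight_one isWeight_one n (G := fun x y =>
      (𝒯.pull i u₀ x - 𝒯.pull j u₀ y) * (𝒯.pull i v₀ x - 𝒯.pull j v₀ y) /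
      |(1 - x) * 𝒯.h i + (𝒯.lo j - 𝒯.hi i) + y * 𝒯.h j| ^ (1 + 2 * s)) fun x hx y hy => ?_
    rw [hu₀ i x hx, hv₀ i x hx, hu₀ j y hy, hv₀ j y hy, div_eq_mul_inv]
    congr 4
    ring
  rw [hI, hQ]
  exact herr

/-! ### Quadrature errors on the complement -/

lemma gauss_one_const {n : ℕ} (hn : n ≠ 0) (c : ℝ) : gauss (fun _ => 1) n (fun _ => c) = c := by
  have h := isWeight_one.gauss_eval n (C c) (by rw [natDegree_C]; omega)
  simp only [eval_C, integral_const, wMeas_one_real, one_smul] at h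
  exact h

/-- A dummy second variable makes the one-dimensional rule a tensor rule, so the planar error
estimate covers it. For $n=0$ both sides are zero. -/
lemma dGauss_fst {w : ℝ → ℝ} (hw : IsWeight w) (n : ℕ) (F : ℝ → ℝ) :
    dGauss w (fun _ => 1) n (fun x _ => F x) = gauss w n F := by
  rcases eq_or_ne n 0 with rfl | hn
  · have h : gaussNodes w 0 = ∅ := by
      rw [← Finset.card_eq_zero]; exact (hw.card_and_mem_gaussNodes 0).1
    simp [dGauss, gauss, h]
  · simp only [dGauss, gauss_one_const hn]

lemma dInt_fst {w : ℝ → ℝ} (hw : IsWeight w) (F : ℝ → ℝ) :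
    dInt w (fun _ => 1) (fun x _ => F x) = ∫ x, F x ∂(wMeas w) := by
  have := isWeight_one.isFiniteMeasure
  have := hw.isFiniteMeasure
  rw [dInt, integral_fun_fst, wMeas_one_real, one_smul]

lemma error_one_dim {w : ℝ → ℝ} (hw : IsWeight w) {k : ℝ → ℝ} {q B : ℝ}
    (hk : KernelApprox (fun x _ => k x) q B) (hq0 : 0 < q) (hq1 : q ≤ 1) {r p : ℕ}
    {P Q : ℝ[X]} (hP : P.natDegree ≤ r) (hQ : Q.natDegree ≤ p) {X κ R S c K : ℝ} (hX : 0 < X)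
    (hκ : 0 ≤ κ) (hR : 0 ≤ R) (hS : 0 ≤ S) (hc : 0 ≤ c)
    (hPb : ∀ x ∈ Ioo (0 : ℝ) 1, X * P.eval x ^ 2 ≤ κ * R ^ 2)
    (hQb : ∀ x ∈ Ioo (0 : ℝ) 1, X * Q.eval x ^ 2 ≤ κ * S ^ 2)
    (hK : c * B ≤ K * X) (n : ℕ) :
    |c * (∫ x in Ioo (0 : ℝ) 1, w x * (P.eval x * Q.eval x * k x)) -
      c * gauss w n (fun x => P.eval x * Q.eval x * k x)| ≤
      2 * (wMeas w).real univ * K * κ * (R * S) * q ^ (2 * (n : ℤ) - 1 - ((r + p : ℕ) : ℤ)) := by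
  have h := error_of_weighted_bounds hw isWeight_one hk hq0 hq1 (biPoly_eval biPoly_fst hP)
    (biPoly_eval biPoly_fst hQ) hX hκ hR hS hc (fun x hx _ _ => hPb x hx)
    (fun x hx _ _ => hQb x hx) hK n
  rwa [dGauss_fst hw n fun x => P.eval x * Q.eval x * k x,
    dInt_fst hw fun x => P.eval x * Q.eval x * k x, wMeas_one_real, mul_one, hw.integral_wMeas] at h

lemma natDegree_comp_one_sub_le {P : ℝ[X]} {r : ℕ} (hP : P.natDegree ≤ r) :
    (P.comp (1 - X)).natDegree ≤ r := by
  refine natDegree_comp_le.trans ?_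
  have : (1 - X : ℝ[X]).natDegree ≤ 1 := by compute_degree
  calc _ ≤ P.natDegree * 1 := Nat.mul_le_mul_left _ this
    _ ≤ r := by rwa [mul_one]

/-- $(P(x)-P(0))/x$ is a value of the derivative, by the mean value theorem. -/
lemma divX_bound {P : ℝ[X]} {c κ : ℝ}
    (h : ∀ x ∈ Icc (0 : ℝ) 1, c * P.derivative.eval x ^ 2 ≤ κ) {x : ℝ} (hx : x ∈ Ioo (0 : ℝ) 1) :
    c * P.divX.eval x ^ 2 ≤ κ := by
  obtain ⟨ξ, hξ, e⟩ := exists_derivative_eq P (a := 0) (by simp) (Ioo_subset_Icc_self hx)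
  rw [eval_sub_eval_zero, sub_zero, mul_comm, mul_right_cancel_iff_of_pos hx.1] at e
  rw [e]
  exact h ξ hξ

section

variable {γ : ℝ} (hγ : 0 < γ) {s : ℝ} (hs0 : 0 < s) (hs1 : s < 1)
include hγ hs0 hs1

/-- Serves both endpoints of $\Omega$ at once: $a=\pm h$ according to the side, $\delta$ is the
distance of the element to the endpoint and $\delta+h/2$ that of its midpoint. The condition $\gamma
h\le\delta$ bounds the relative variation of the kernel, and $\delta+h\le2(\delta+h/2)$ lets the
kernel be compared with the scale in `value_bound`. -/
lemma exists_error_far :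
    ∃ K : ℝ, 0 ≤ K ∧ ∀ (𝒯 : Mesh) (r p n : ℕ) (u v : ℝ → ℝ) (U V : Fin 𝒯.M → ℝ[X]),
      r ≠ 0 → p ≠ 0 → 𝒯.IsRef r u U → 𝒯.IsRef p v V → ∀ (i : Fin 𝒯.M) (A a δ : ℝ), |a| = 𝒯.h i →
      A + a / 2 = δ + 𝒯.h i / 2 → γ * 𝒯.h i ≤ δ → (∀ x ∈ 𝒯.elt i, bdryDist x ≤ δ + 𝒯.h i) →
      |𝒯.h i * (∫ x in Ioo (0 : ℝ) 1, (U i).eval x * (V i).eval x * (|A + a * x| ^ (2 * s))⁻¹) -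
        𝒯.h i * gaussLeg n (fun x => (U i).eval x * (V i).eval x * (|A + a * x| ^ (2 * s))⁻¹)| ≤
        K * ((r ^ 3 * tildeNorm s u) * (p ^ 3 * tildeNorm s v)) * decay γ r p n := by
  have hγ1 : 0 < 1 + γ := by linarith
  obtain ⟨C, hC, hker⟩ := exists_kernelApprox_affine (2 * s) (t₀ := 1 / (1 + γ)) (by positivity)
    (by rw [div_lt_one hγ1]; linarith)
  refine ⟨2 * (wMeas fun _ => 1).real univ * (C * 2 ^ (2 : ℝ)) * 32, by positivity, ?_⟩
  intro 𝒯 r p n u v U V hr hp hU hV i A a δ ha hA hδ hb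
  have hh := 𝒯.h_pos i
  have hδ0 : 0 < δ := (mul_pos hγ hh).trans_le hδ
  have hc0 : 0 < A + a / 2 := by rw [hA]; positivity
  have hk := hker A a 0 (A + a / 2) (by ring) hc0 (by
    rw [ha, abs_zero, add_zero, div_mul_eq_mul_div, one_mul, le_div_iff₀ hγ1, hA]
    nlinarith)
  simp only [zero_mul, add_zero] at hk
  have hX : 0 < 𝒯.h i * ((δ + 𝒯.h i) ^ (2 * s))⁻¹ := by
    have := Real.rpow_pos_of_pos (add_pos hδ0 hh) (2 * s); positivity
  have hKX : 𝒯.h i * (C * ((A + a / 2) ^ (2 * s))⁻¹) ≤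
      C * 2 ^ (2 : ℝ) * (𝒯.h i * ((δ + 𝒯.h i) ^ (2 * s))⁻¹) := by
    have := inv_rpow_le_of_le_two_mul hc0 (add_pos hδ0 hh) (by rw [hA]; linarith) (σ := 2 * s)
      (τ := 2) (by linarith) (by linarith)
    calc _ ≤ 𝒯.h i * (C * (2 ^ (2 : ℝ) * ((δ + 𝒯.h i) ^ (2 * s))⁻¹)) := by gcongr
      _ = _ := by ring
  have h := error_one_dim isWeight_one (k := fun x => (|A + a * x| ^ (2 * s))⁻¹) hk (rate_pos hγ)
    (rate_lt_one hγ).le (hU.deg i) (hV.deg i) hX (by norm_num : (0 : ℝ) ≤ 32)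
    (mul_nonneg (by positivity) (tildeNorm_nonneg s u))
    (mul_nonneg (by positivity) (tildeNorm_nonneg s v)) hh.le
    (fun x hx => hU.value_bound hr hs0 hs1 i hb (Ioo_subset_Icc_self hx))
    (fun x hx => hV.value_bound hp hs0 hs1 i hb (Ioo_subset_Icc_self hx)) hKX n
  simp only [one_mul] at h
  exact h

/-- The quadrature error on the part of the complement that lies to the left of `Ω`. -/
lemma exists_error_left :
    ∃ K : ℝ, 0 ≤ K ∧ ∀ (𝒯 : Mesh) (r p n : ℕ) (u v u₀ v₀ : ℝ → ℝ) (U V : Fin 𝒯.M → ℝ[X]),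
      r ≠ 0 → p ≠ 0 → 𝒯.IsRef r u U → 𝒯.IsRef p v V →
      (∀ i, ∀ x ∈ Ioo (0 : ℝ) 1, 𝒯.pull i u₀ x = (U i).eval x) →
      (∀ i, ∀ x ∈ Ioo (0 : ℝ) 1, 𝒯.pull i v₀ x = (V i).eval x) → ∀ i,
      (𝒯.lo i = -1 → |(∫ x in 𝒯.elt i, u x * v x * ((x + 1) ^ (2 * s))⁻¹) -
        𝒯.h i * gaussJac 0 (2 - 2 * s) n (fun x =>
          𝒯.pull i u₀ x * 𝒯.pull i v₀ x / (x ^ 2 * 𝒯.h i ^ (2 * s)))| ≤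
        K * ((r ^ 3 * tildeNorm s u) * (p ^ 3 * tildeNorm s v)) * decay γ r p n) ∧
      (γ * 𝒯.h i ≤ 𝒯.lo i + 1 → |(∫ x in 𝒯.elt i, u x * v x * ((x + 1) ^ (2 * s))⁻¹) -
        𝒯.h i * gaussLeg n (fun x =>
          𝒯.pull i u₀ x * 𝒯.pull i v₀ x / |(𝒯.lo i + 1) + x * 𝒯.h i| ^ (2 * s))| ≤
        K * ((r ^ 3 * tildeNorm s u) * (p ^ 3 * tildeNorm s v)) * decay γ r p n) := by
  have hw : IsWeight fun x => (1 - x) ^ (0 : ℝ) * x ^ (2 - 2 * s) :=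
    isWeight_jacobi_right (by linarith)
  obtain ⟨K, hK, hfar⟩ := exists_error_far hγ hs0 hs1
  refine ⟨max (2 * (wMeas fun x => (1 - x) ^ (0 : ℝ) * x ^ (2 - 2 * s)).real univ * 1 * 512) K,
    le_max_of_le_right hK, ?_⟩
  intro 𝒯 r p n u v u₀ v₀ U V hr hp hU hV hu₀ hv₀ i
  have hh := 𝒯.h_pos i
  have hN := mul_nonneg (by positivity : (0 : ℝ) ≤ (r : ℝ) ^ 3) (tildeNorm_nonneg s u)
  have hN' := mul_nonneg (by positivity : (0 : ℝ) ≤ (p : ℝ) ^ 3) (tildeNorm_nonneg s v)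
  have hd := decay_nonneg hγ r p n
  constructor
  · intro hlo
    have hX : 0 < 𝒯.h i ^ (1 - 2 * s) := Real.rpow_pos_of_pos hh _
    have hzero : ∀ {r : ℕ} {u : ℝ → ℝ} {U : Fin 𝒯.M → ℝ[X]}, 𝒯.IsRef r u U →
        (U i).eval 0 = 0 := fun hU => by
      rw [← hU.eval i 0 (by simp), hlo, hU.lip.zero _ (by simp [Om])]
    have hdeg : ∀ {P : ℝ[X]} {r : ℕ}, P.natDegree ≤ r → P.divX.natDegree ≤ r := fun h => by
      rw [natDegree_divX_eq_natDegree_tsub_one]; omega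
    -- Both functions vanish at $-1$, so a factor $x$ splits off each. With $(xh)^{-2s}$ this leaves
    -- the Jacobi weight $x^{2-2s}$ and a polynomial integrand, so the kernel is the constant $1$.
    have h := error_one_dim hw (kernelApprox_one (rate_pos hγ).le) (rate_pos hγ)
      (rate_lt_one hγ).le (hdeg (hU.deg i)) (hdeg (hV.deg i)) (K := 1) hX
      (by norm_num : (0 : ℝ) ≤ 512) hN hN' hX.le
      (fun x hx => divX_bound (fun y hy => hU.derivative_bound hs0 hs1 i hy) hx)
      (fun x hx => divX_bound (fun y hy => hV.derivative_bound hs0 hs1 i hy) hx)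
      (by linarith) n
    simp only [mul_one] at h
    have eU := fun x => (eval_sub_eval_zero (U i) x).symm
    have eV := fun x => (eval_sub_eval_zero (V i) x).symm
    simp only [hzero hU, hzero hV, sub_zero] at eU eV
    have hI : (∫ x in 𝒯.elt i, u x * v x * ((x + 1) ^ (2 * s))⁻¹) =
        𝒯.h i ^ (1 - 2 * s) * ∫ x in Ioo (0 : ℝ) 1, (1 - x) ^ (0 : ℝ) * x ^ (2 - 2 * s) *
          ((U i).divX.eval x * (V i).divX.eval x) := by
      rw [𝒯.setIntegral_elt, ← integral_const_mul, ← integral_const_mul]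
      refine setIntegral_congr_fun measurableSet_Ioo fun x hx => ?_
      have e : 𝒯.lo i + x * 𝒯.h i + 1 = x * 𝒯.h i := by rw [hlo]; ring
      rw [hU.eval i x (Ioo_subset_Icc_self hx), hV.eval i x (Ioo_subset_Icc_self hx), e, ← eU, ← eV,
        Real.mul_rpow hx.1.le hh.le, Real.rpow_zero, ← rpow_shift'' hh, mul_inv]
      have e2 : x ^ (2 - 2 * s) = x ^ 2 * (x ^ (2 * s))⁻¹ := by
        rw [← Real.rpow_two, ← Real.rpow_neg hx.1.le, ← Real.rpow_add hx.1]; rfl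
      rw [e2]
      ring
    have hQ : 𝒯.h i * gaussJac 0 (2 - 2 * s) n (fun x =>
          𝒯.pull i u₀ x * 𝒯.pull i v₀ x / (x ^ 2 * 𝒯.h i ^ (2 * s))) =
        𝒯.h i ^ (1 - 2 * s) * gauss (fun x => (1 - x) ^ (0 : ℝ) * x ^ (2 - 2 * s)) n (fun x =>
          (U i).divX.eval x * (V i).divX.eval x) := by
      rw [gaussJac, ← gauss_const_mul, ← gauss_const_mul]
      refine hw.gauss_congr n fun x hx => ?_
      rw [hu₀ i x hx, hv₀ i x hx, ← eU, ← eV, ← rpow_shift'' hh]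
      have := hx.1.ne'
      field_simp
    rw [hI, hQ]
    refine h.trans (mul_le_mul_of_nonneg_right (mul_le_mul_of_nonneg_right ?_ (by positivity)) hd)
    rw [mul_one]
    exact le_max_left _ _
  · intro hγi
    have h := hfar 𝒯 r p n u v U V hr hp hU hV i (𝒯.lo i + 1) (𝒯.h i) (𝒯.lo i + 1)
      (abs_of_pos hh) rfl hγi (fun x hx => (bdryDist_le_left (𝒯.elt_subset_Om i hx)).trans (by
        have := hx.2
        simp only [Mesh.h]; linarith))
    have hI : (∫ x in 𝒯.elt i, u x * v x * ((x + 1) ^ (2 * s))⁻¹) =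
        𝒯.h i * ∫ x in Ioo (0 : ℝ) 1, (U i).eval x * (V i).eval x *
          (|𝒯.lo i + 1 + 𝒯.h i * x| ^ (2 * s))⁻¹ := by
      rw [𝒯.setIntegral_elt]
      congr 1
      refine setIntegral_congr_fun measurableSet_Ioo fun x hx => ?_
      have e : 𝒯.lo i + x * 𝒯.h i + 1 = 𝒯.lo i + 1 + 𝒯.h i * x := by ring
      have hpos : 0 < 𝒯.lo i + 1 + 𝒯.h i * x := by
        have := mul_pos hγ hh
        have := mul_pos hh hx.1
        linarith
      rw [hU.eval i x (Ioo_subset_Icc_self hx), hV.eval i x (Ioo_subset_Icc_self hx), e,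
        abs_of_pos hpos]
    have hQ : gaussLeg n (fun x =>
          𝒯.pull i u₀ x * 𝒯.pull i v₀ x / |(𝒯.lo i + 1) + x * 𝒯.h i| ^ (2 * s)) =
        gaussLeg n (fun x => (U i).eval x * (V i).eval x *
          (|𝒯.lo i + 1 + 𝒯.h i * x| ^ (2 * s))⁻¹) := by
      refine isWeight_one.gauss_congr n fun x hx => ?_
      rw [hu₀ i x hx, hv₀ i x hx, mul_comm (𝒯.h i), div_eq_mul_inv]
    rw [hI, hQ]
    exact h.trans (mul_le_mul_of_nonneg_right
      (mul_le_mul_of_nonneg_right (le_max_right _ _) (by positivity)) hd)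

/-- The quadrature error on the part of the complement that lies to the right of `Ω`. -/
lemma exists_error_right :
    ∃ K : ℝ, 0 ≤ K ∧ ∀ (𝒯 : Mesh) (r p n : ℕ) (u v u₀ v₀ : ℝ → ℝ) (U V : Fin 𝒯.M → ℝ[X]),
      r ≠ 0 → p ≠ 0 → 𝒯.IsRef r u U → 𝒯.IsRef p v V →
      (∀ i, ∀ x ∈ Ioo (0 : ℝ) 1, 𝒯.pull i u₀ x = (U i).eval x) →
      (∀ i, ∀ x ∈ Ioo (0 : ℝ) 1, 𝒯.pull i v₀ x = (V i).eval x) → ∀ i,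
      (𝒯.hi i = 1 → |(∫ x in 𝒯.elt i, u x * v x * ((1 - x) ^ (2 * s))⁻¹) -
        𝒯.h i * gaussJac (2 - 2 * s) 0 n (fun x =>
          𝒯.pull i u₀ x * 𝒯.pull i v₀ x / ((1 - x) ^ 2 * 𝒯.h i ^ (2 * s)))| ≤
        K * ((r ^ 3 * tildeNorm s u) * (p ^ 3 * tildeNorm s v)) * decay γ r p n) ∧
      (γ * 𝒯.h i ≤ 1 - 𝒯.hi i → |(∫ x in 𝒯.elt i, u x * v x * ((1 - x) ^ (2 * s))⁻¹) -
        𝒯.h i * gaussLeg n (fun x =>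
          𝒯.pull i u₀ x * 𝒯.pull i v₀ x / |(1 - 𝒯.hi i) + (1 - x) * 𝒯.h i| ^ (2 * s))| ≤
        K * ((r ^ 3 * tildeNorm s u) * (p ^ 3 * tildeNorm s v)) * decay γ r p n) := by
  have hw : IsWeight fun x => (1 - x) ^ (2 - 2 * s) * x ^ (0 : ℝ) :=
    isWeight_jacobi_left (by linarith)
  obtain ⟨K, hK, hfar⟩ := exists_error_far hγ hs0 hs1
  refine ⟨max (2 * (wMeas fun x => (1 - x) ^ (2 - 2 * s) * x ^ (0 : ℝ)).real univ * 1 * 512) K,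
    le_max_of_le_right hK, ?_⟩
  intro 𝒯 r p n u v u₀ v₀ U V hr hp hU hV hu₀ hv₀ i
  have hh := 𝒯.h_pos i
  have hhi : 𝒯.hi i = 𝒯.lo i + 𝒯.h i := by simp [Mesh.h]
  have hN := mul_nonneg (by positivity : (0 : ℝ) ≤ (r : ℝ) ^ 3) (tildeNorm_nonneg s u)
  have hN' := mul_nonneg (by positivity : (0 : ℝ) ≤ (p : ℝ) ^ 3) (tildeNorm_nonneg s v)
  have hd := decay_nonneg hγ r p n
  constructor
  · intro h1
    have hX : 0 < 𝒯.h i ^ (1 - 2 * s) := Real.rpow_pos_of_pos hh _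
    have hm : ∀ {x : ℝ}, x ∈ Ioo (0 : ℝ) 1 → 1 - x ∈ Ioo (0 : ℝ) 1 :=
      fun hx => ⟨by linarith [hx.2], by linarith [hx.1]⟩
    -- Reflection moves the zero at the right endpoint to $0$, where `divX` removes it; reflecting
    -- back yields the quotient by $1-x$.
    have hzero : ∀ {r : ℕ} {u : ℝ → ℝ} {U : Fin 𝒯.M → ℝ[X]}, 𝒯.IsRef r u U →
        ((U i).comp (1 - X)).eval 0 = 0 := fun hU => by
      have := hU.eval i 1 (by simp)
      rw [one_mul, ← hhi, h1, hU.lip.zero _ (by simp [Om])] at this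
      simp [← this]
    have hdeg : ∀ {P : ℝ[X]} {r : ℕ}, P.natDegree ≤ r →
        ((P.comp (1 - X)).divX.comp (1 - X)).natDegree ≤ r := fun h => by
      refine natDegree_comp_one_sub_le ?_
      rw [natDegree_divX_eq_natDegree_tsub_one]
      exact (Nat.sub_le _ _).trans (natDegree_comp_one_sub_le h)
    have hder : ∀ {P : ℝ[X]} {c κ : ℝ}, (∀ x ∈ Icc (0 : ℝ) 1, c * P.derivative.eval x ^ 2 ≤ κ) →
        ∀ x ∈ Icc (0 : ℝ) 1, c * (P.comp (1 - X)).derivative.eval x ^ 2 ≤ κ := by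
      intro P c κ h x hx
      have := h (1 - x) ⟨by linarith [hx.2], by linarith [hx.1]⟩
      rw [derivative_comp]
      simpa using this
    have h := error_one_dim hw (kernelApprox_one (rate_pos hγ).le) (rate_pos hγ)
      (rate_lt_one hγ).le (hdeg (hU.deg i)) (hdeg (hV.deg i)) (K := 1) hX
      (by norm_num : (0 : ℝ) ≤ 512) hN hN' hX.le
      (fun x hx => by
        have := divX_bound (hder fun y hy => hU.derivative_bound hs0 hs1 i hy) (hm hx)
        simpa using this)
      (fun x hx => by
        have := divX_bound (hder fun y hy => hV.derivative_bound hs0 hs1 i hy) (hm hx)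
        simpa using this)
      (by linarith) n
    simp only [mul_one] at h
    have key : ∀ {P : ℝ[X]}, (P.comp (1 - X)).eval 0 = 0 → ∀ x,
        (1 - x) * ((P.comp (1 - X)).divX.comp (1 - X)).eval x = P.eval x := by
      intro P h0 x
      have := eval_sub_eval_zero (P.comp (1 - X)) (1 - x)
      rw [h0, sub_zero] at this
      rw [eval_comp]
      simp only [eval_sub, eval_one, eval_X]
      rw [← this]
      simp
    have eU := key (hzero hU)
    have eV := key (hzero hV)
    set f := ((U i).comp (1 - X)).divX.comp (1 - X)
    set g := ((V i).comp (1 - X)).divX.comp (1 - X)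
    have hI : (∫ x in 𝒯.elt i, u x * v x * ((1 - x) ^ (2 * s))⁻¹) =
        𝒯.h i ^ (1 - 2 * s) * ∫ x in Ioo (0 : ℝ) 1, (1 - x) ^ (2 - 2 * s) * x ^ (0 : ℝ) *
          (f.eval x * g.eval x) := by
      rw [𝒯.setIntegral_elt, ← integral_const_mul, ← integral_const_mul]
      refine setIntegral_congr_fun measurableSet_Ioo fun x hx => ?_
      have hx1 := (hm hx).1
      have e : 1 - (𝒯.lo i + x * 𝒯.h i) = (1 - x) * 𝒯.h i := by
        linear_combination hhi - h1
      rw [hU.eval i x (Ioo_subset_Icc_self hx), hV.eval i x (Ioo_subset_Icc_self hx), e, ← eU, ← eV,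
        Real.mul_rpow hx1.le hh.le, Real.rpow_zero, ← rpow_shift'' hh, mul_inv]
      have e2 : (1 - x) ^ (2 - 2 * s) = (1 - x) ^ 2 * ((1 - x) ^ (2 * s))⁻¹ := by
        rw [← Real.rpow_two, ← Real.rpow_neg hx1.le, ← Real.rpow_add hx1]; rfl
      rw [e2]
      ring
    have hQ : 𝒯.h i * gaussJac (2 - 2 * s) 0 n (fun x =>
          𝒯.pull i u₀ x * 𝒯.pull i v₀ x / ((1 - x) ^ 2 * 𝒯.h i ^ (2 * s))) =
        𝒯.h i ^ (1 - 2 * s) * gauss (fun x => (1 - x) ^ (2 - 2 * s) * x ^ (0 : ℝ)) n (fun x =>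
          f.eval x * g.eval x) := by
      rw [gaussJac, ← gauss_const_mul, ← gauss_const_mul]
      refine hw.gauss_congr n fun x hx => ?_
      rw [hu₀ i x hx, hv₀ i x hx, ← eU, ← eV, ← rpow_shift'' hh]
      have := (hm hx).1.ne'
      field_simp
    rw [hI, hQ]
    refine h.trans (mul_le_mul_of_nonneg_right (mul_le_mul_of_nonneg_right ?_ (by positivity)) hd)
    rw [mul_one]
    exact le_max_left _ _
  · intro hγi
    have h := hfar 𝒯 r p n u v U V hr hp hU hV i (1 - 𝒯.hi i + 𝒯.h i) (-𝒯.h i) (1 - 𝒯.hi i)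
      (by rw [abs_neg, abs_of_pos hh]) (by ring) hγi
      (fun x hx => (bdryDist_le_right (𝒯.elt_subset_Om i hx)).trans (by
        have := hx.1
        simp only [Mesh.h]; linarith))
    have hI : (∫ x in 𝒯.elt i, u x * v x * ((1 - x) ^ (2 * s))⁻¹) =
        𝒯.h i * ∫ x in Ioo (0 : ℝ) 1, (U i).eval x * (V i).eval x *
          (|1 - 𝒯.hi i + 𝒯.h i + -𝒯.h i * x| ^ (2 * s))⁻¹ := by
      rw [𝒯.setIntegral_elt]
      congr 1
      refine setIntegral_congr_fun measurableSet_Ioo fun x hx => ?_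
      have e : 1 - (𝒯.lo i + x * 𝒯.h i) = 1 - 𝒯.hi i + 𝒯.h i + -𝒯.h i * x := by rw [hhi]; ring
      have hpos : 0 < 1 - 𝒯.hi i + 𝒯.h i + -𝒯.h i * x := by
        have := mul_pos hγ hh
        have := mul_pos hh (sub_pos.2 hx.2)
        linarith
      rw [hU.eval i x (Ioo_subset_Icc_self hx), hV.eval i x (Ioo_subset_Icc_self hx), e,
        abs_of_pos hpos]
    have hQ : gaussLeg n (fun x =>
          𝒯.pull i u₀ x * 𝒯.pull i v₀ x / |(1 - 𝒯.hi i) + (1 - x) * 𝒯.h i| ^ (2 * s)) =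
        gaussLeg n (fun x => (U i).eval x * (V i).eval x *
          (|1 - 𝒯.hi i + 𝒯.h i + -𝒯.h i * x| ^ (2 * s))⁻¹) := by
      refine isWeight_one.gauss_congr n fun x hx => ?_
      have e : 1 - 𝒯.hi i + (1 - x) * 𝒯.h i = 1 - 𝒯.hi i + 𝒯.h i + -𝒯.h i * x := by ring
      rw [hu₀ i x hx, hv₀ i x hx, e, div_eq_mul_inv]
    rw [hI, hQ]
    exact h.trans (mul_le_mul_of_nonneg_right
      (mul_le_mul_of_nonneg_right (le_max_right _ _) (by positivity)) hd)

end

/-! ### Geometry of shape regular meshes -/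

namespace Mesh

variable {𝒯 : Mesh}

lemma touch_comm {i j : Fin 𝒯.M} : 𝒯.Touch i j ↔ 𝒯.Touch j i := by
  rw [Touch, Touch, inter_comm]

lemma touch_of_hi_eq_lo {i j : Fin 𝒯.M} (h : 𝒯.hi i = 𝒯.lo j) : 𝒯.Touch i j := by
  refine ⟨𝒯.hi i, ?_, ?_⟩
  · rw [closure_elt]; exact right_mem_Icc.2 (𝒯.lo_lt_hi i).le
  · rw [closure_elt, h]; exact left_mem_Icc.2 (𝒯.lo_lt_hi j).le

lemma hi_eq_lo_of_touch {i j : Fin 𝒯.M} (hij : i < j) (h : 𝒯.Touch i j) : 𝒯.hi i = 𝒯.lo j := by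
  obtain ⟨x, hx, hy⟩ := h
  rw [closure_elt] at hx hy
  exact le_antisymm (𝒯.hi_le_lo hij) (hy.1.trans hx.2)

lemma exists_next {i : Fin 𝒯.M} (h : (i : ℕ) + 1 < 𝒯.M) :
    ∃ k : Fin 𝒯.M, (k : ℕ) = i + 1 ∧ 𝒯.hi i = 𝒯.lo k :=
  ⟨⟨i + 1, h⟩, rfl, rfl⟩

lemma exists_prev {i : Fin 𝒯.M} (h : (i : ℕ) ≠ 0) :
    ∃ k : Fin 𝒯.M, (k : ℕ) + 1 = i ∧ 𝒯.hi k = 𝒯.lo i := by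
  have := i.2
  obtain ⟨k, hk⟩ := Nat.exists_eq_succ_of_ne_zero h
  refine ⟨⟨k, by omega⟩, hk.symm, ?_⟩
  simp only [hi, lo]
  congr 1
  ext
  exact hk.symm

lemma neg_one_mem_closure_elt {i : Fin 𝒯.M} : -1 ∈ closure (𝒯.elt i) ↔ 𝒯.lo i = -1 := by
  rw [closure_elt]
  refine ⟨fun h => le_antisymm h.1 (𝒯.neg_one_le_node _), fun h => ?_⟩
  rw [← h]; exact left_mem_Icc.2 (𝒯.lo_lt_hi i).le

lemma one_mem_closure_elt {i : Fin 𝒯.M} : 1 ∈ closure (𝒯.elt i) ↔ 𝒯.hi i = 1 := by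
  rw [closure_elt]
  refine ⟨fun h => le_antisymm (𝒯.node_le_one _) h.2, fun h => ?_⟩
  rw [← h]; exact right_mem_Icc.2 (𝒯.lo_lt_hi i).le

namespace ShapeRegular

variable {γ : ℝ} (hγ : 𝒯.ShapeRegular γ)
include hγ

/-- The gap contains the right neighbour of the first element and the left neighbour of the second,
possibly the same element; shape regularity bounds their lengths from below. -/
lemma separated {i j : Fin 𝒯.M} (hij : i < j) (h : ¬ 𝒯.Touch i j) :
    γ * 𝒯.h i ≤ 𝒯.lo j - 𝒯.hi i ∧ γ * 𝒯.h j ≤ 𝒯.lo j - 𝒯.hi i := by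
  have hj := j.2
  have hij' : (i : ℕ) < j := hij
  obtain ⟨k, hk, hik⟩ := exists_next (i := i) (by omega)
  obtain ⟨l, hl, hlj⟩ := exists_prev (i := j) (by omega)
  have hkj : k < j := lt_of_le_of_ne (Fin.le_def.2 (by omega)) fun e => h (e ▸ touch_of_hi_eq_lo hik)
  have hil : i < l := lt_of_le_of_ne (Fin.le_def.2 (by omega)) fun e => h (e ▸ touch_of_hi_eq_lo hlj)
  have h1 := 𝒯.hi_le_lo hkj
  have h2 := 𝒯.hi_le_lo hil
  have h3 := hγ i k (touch_of_hi_eq_lo hik)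
  have h4 := hγ j l (touch_comm.1 (touch_of_hi_eq_lo hlj))
  simp only [Mesh.h] at h3 h4 ⊢
  constructor <;> linarith

/-- An element away from $-1$ has a left neighbour, which lies between it and $-1$. -/
lemma left {i : Fin 𝒯.M} (h : 𝒯.lo i ≠ -1) : γ * 𝒯.h i ≤ 𝒯.lo i + 1 := by
  obtain ⟨k, -, hk⟩ := exists_prev (i := i) fun h0 => h (by
    rw [← 𝒯.node_zero, lo]; congr 1; ext; exact h0)
  have h1 := hγ i k (touch_comm.1 (touch_of_hi_eq_lo hk))
  have h2 : -1 ≤ 𝒯.lo k := 𝒯.neg_one_le_node _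
  simp only [Mesh.h] at h1 ⊢
  linarith

lemma right {i : Fin 𝒯.M} (h : 𝒯.hi i ≠ 1) : γ * 𝒯.h i ≤ 1 - 𝒯.hi i := by
  have hi := i.2
  obtain ⟨k, -, hk⟩ := exists_next (i := i) (lt_of_le_of_ne hi fun h0 => h (by
    rw [← 𝒯.node_last, Mesh.hi]; congr 1; ext; exact h0))
  have h1 := hγ i k (touch_of_hi_eq_lo hk)
  have h2 : 𝒯.hi k ≤ 1 := 𝒯.node_le_one _
  simp only [Mesh.h] at h1 ⊢
  linarith

end ShapeRegular

end Mesh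

/-! ### The consistency error -/

lemma integral_kern_swap (s : ℝ) (u v : ℝ → ℝ) (μ ν : Measure ℝ) [SFinite μ] [SFinite ν] :
    ∫ z, kern s u v z ∂(μ.prod ν) = ∫ z, kern s u v z ∂(ν.prod μ) := by
  rw [← integral_prod_swap]
  congr 1; ext z
  simp only [kern, Prod.fst_swap, Prod.snd_swap]
  rw [abs_sub_comm]; ring

section

variable {γ : ℝ} (hγ : 0 < γ) {s : ℝ} (hs0 : 0 < s) (hs1 : s < 1)
include hγ hs0 hs1

lemma exists_error_pair :
    ∃ K : ℝ, 0 ≤ K ∧ ∀ (𝒯 : Mesh), 𝒯.ShapeRegular γ →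
      ∀ (r p n : ℕ) (u v u₀ v₀ : ℝ → ℝ) (U V : Fin 𝒯.M → ℝ[X]),
      r ≠ 0 → p ≠ 0 → 𝒯.IsRef r u U → 𝒯.IsRef p v V →
      (∀ i, ∀ x ∈ Ioo (0 : ℝ) 1, 𝒯.pull i u₀ x = (U i).eval x) →
      (∀ i, ∀ x ∈ Ioo (0 : ℝ) 1, 𝒯.pull i v₀ x = (V i).eval x) → ∀ i j,
      |∫ z, kern s u v z ∂((volume.restrict (𝒯.elt i)).prod (volume.restrict (𝒯.elt j))) -
        𝒯.Q s n u₀ v₀ i j| ≤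
        K * ((r ^ 3 * tildeNorm s u) * (p ^ 3 * tildeNorm s v)) * decay γ r p n := by
  obtain ⟨K₁, hK₁, h₁⟩ := exists_error_identical hγ hs0 hs1
  obtain ⟨K₂, hK₂, h₂⟩ := exists_error_adjacent hγ hs0 hs1
  obtain ⟨K₃, hK₃, h₃⟩ := exists_error_separated hγ hs0 hs1
  refine ⟨K₁ + K₂ + K₃, by positivity, ?_⟩
  intro 𝒯 h𝒯 r p n u v u₀ v₀ U V hr hp hU hV hu₀ hv₀ i j
  have hN := mul_nonneg (by positivity : (0 : ℝ) ≤ (r : ℝ) ^ 3) (tildeNorm_nonneg s u)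
  have hN' := mul_nonneg (by positivity : (0 : ℝ) ≤ (p : ℝ) ^ 3) (tildeNorm_nonneg s v)
  have hd := decay_nonneg hγ r p n
  have hmono : ∀ {K x : ℝ}, K ≤ K₁ + K₂ + K₃ →
      x ≤ K * ((r ^ 3 * tildeNorm s u) * (p ^ 3 * tildeNorm s v)) * decay γ r p n →
      x ≤ (K₁ + K₂ + K₃) * ((r ^ 3 * tildeNorm s u) * (p ^ 3 * tildeNorm s v)) * decay γ r p n :=
    fun hK hx => hx.trans (mul_le_mul_of_nonneg_right
      (mul_le_mul_of_nonneg_right hK (by positivity)) hd)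
  -- It suffices to treat ordered pairs, because the exact integral and the rule are both symmetric
  -- in the two elements.
  have hord : ∀ i j, i < j →
      |∫ z, kern s u v z ∂((volume.restrict (𝒯.elt i)).prod (volume.restrict (𝒯.elt j))) -
        (open Classical in if 𝒯.Touch i j then 𝒯.QAdj s n u₀ v₀ i j else 𝒯.QSep s n u₀ v₀ i j)| ≤
      (K₁ + K₂ + K₃) * ((r ^ 3 * tildeNorm s u) * (p ^ 3 * tildeNorm s v)) * decay γ r p n := by
    intro i j hij
    by_cases ht : 𝒯.Touch i j
    · rw [if_pos ht]
      exact hmono (by linarith) (h₂ 𝒯 r p n u v u₀ v₀ U V hr hp hU hV hu₀ hv₀ i j (h𝒯 _ _ ht)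
        (h𝒯 _ _ (Mesh.touch_comm.1 ht)) (Mesh.hi_eq_lo_of_touch hij ht))
    · rw [if_neg ht]
      obtain ⟨hi, hj⟩ := h𝒯.separated hij ht
      exact hmono (by linarith) (h₃ 𝒯 r p n u v u₀ v₀ U V hr hp hU hV hu₀ hv₀ i j hi hj)
  rcases lt_trichotomy i j with hij | rfl | hij
  · have := hord i j hij
    simpa only [Mesh.Q, hij.ne, hij, if_true, if_false] using this
  · rw [Mesh.Q, if_pos rfl]
    exact hmono (by linarith) (h₁ 𝒯 r p n u v u₀ v₀ U V hU hV hu₀ hv₀ i)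
  · have := hord j i hij
    rw [integral_kern_swap, Mesh.touch_comm] at this
    simpa only [Mesh.Q, hij.ne', hij.not_gt, if_true, if_false] using this

lemma exists_error_compl :
    ∃ K : ℝ, 0 ≤ K ∧ ∀ (𝒯 : Mesh), 𝒯.ShapeRegular γ →
      ∀ (r p n : ℕ) (u v u₀ v₀ : ℝ → ℝ) (U V : Fin 𝒯.M → ℝ[X]),
      r ≠ 0 → p ≠ 0 → 𝒯.IsRef r u U → 𝒯.IsRef p v V →
      (∀ i, ∀ x ∈ Ioo (0 : ℝ) 1, 𝒯.pull i u₀ x = (U i).eval x) →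
      (∀ i, ∀ x ∈ Ioo (0 : ℝ) 1, 𝒯.pull i v₀ x = (V i).eval x) → ∀ i,
      |(2 * s)⁻¹ * ((∫ x in 𝒯.elt i, u x * v x * ((x + 1) ^ (2 * s))⁻¹) +
        ∫ x in 𝒯.elt i, u x * v x * ((1 - x) ^ (2 * s))⁻¹) - 𝒯.QComp s n u₀ v₀ i| ≤
        K * ((r ^ 3 * tildeNorm s u) * (p ^ 3 * tildeNorm s v)) * decay γ r p n := by
  obtain ⟨K₁, hK₁, h₁⟩ := exists_error_left hγ hs0 hs1
  obtain ⟨K₂, hK₂, h₂⟩ := exists_error_right hγ hs0 hs1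
  refine ⟨(2 * s)⁻¹ * (K₁ + K₂), by positivity, ?_⟩
  intro 𝒯 h𝒯 r p n u v u₀ v₀ U V hr hp hU hV hu₀ hv₀ i
  obtain ⟨l₁, l₂⟩ := h₁ 𝒯 r p n u v u₀ v₀ U V hr hp hU hV hu₀ hv₀ i
  obtain ⟨r₁, r₂⟩ := h₂ 𝒯 r p n u v u₀ v₀ U V hr hp hU hV hu₀ hv₀ i
  set E := (r ^ 3 * tildeNorm s u) * (p ^ 3 * tildeNorm s v)
  set IL := ∫ x in 𝒯.elt i, u x * v x * ((x + 1) ^ (2 * s))⁻¹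
  set IR := ∫ x in 𝒯.elt i, u x * v x * ((1 - x) ^ (2 * s))⁻¹
  have hadd : ∀ {L R : ℝ}, |IL - 𝒯.h i * L| ≤ K₁ * E * decay γ r p n →
      |IR - 𝒯.h i * R| ≤ K₂ * E * decay γ r p n →
      |(2 * s)⁻¹ * (IL + IR) - 𝒯.h i / (2 * s) * (L + R)| ≤
        (2 * s)⁻¹ * (K₁ + K₂) * E * decay γ r p n := by
    intro L R hL hR
    have e : (2 * s)⁻¹ * (IL + IR) - 𝒯.h i / (2 * s) * (L + R) =
        (2 * s)⁻¹ * ((IL - 𝒯.h i * L) + (IR - 𝒯.h i * R)) := by ring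
    rw [e, abs_mul, abs_of_nonneg (by positivity : 0 ≤ (2 * s)⁻¹)]
    calc _ ≤ (2 * s)⁻¹ * (K₁ * E * decay γ r p n + K₂ * E * decay γ r p n) :=
          mul_le_mul_of_nonneg_left ((abs_add_le _ _).trans (add_le_add hL hR)) (by positivity)
      _ = _ := by ring
  rw [Mesh.QComp]
  simp only [Mesh.neg_one_mem_closure_elt, Mesh.one_mem_closure_elt]
  refine hadd ?_ ?_
  · split_ifs with h
    · exact l₁ h
    · exact l₂ (h𝒯.left h)
  · split_ifs with h
    · exact r₁ h
    · exact r₂ (h𝒯.right h)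

lemma exists_consistency_error :
    ∃ K : ℝ, 0 ≤ K ∧ ∀ (𝒯 : Mesh), 𝒯.ShapeRegular γ →
      ∀ (r p n : ℕ) (u v u₀ v₀ : ℝ → ℝ) (U V : Fin 𝒯.M → ℝ[X]),
      r ≠ 0 → p ≠ 0 → 𝒯.IsRef r u U → 𝒯.IsRef p v V →
      (∀ i, ∀ x ∈ Ioo (0 : ℝ) 1, 𝒯.pull i u₀ x = (U i).eval x) →
      (∀ i, ∀ x ∈ Ioo (0 : ℝ) 1, 𝒯.pull i v₀ x = (V i).eval x) →
      |formA s u v - 𝒯.approxForm s n u₀ v₀| ≤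
        K * (𝒯.M : ℝ) ^ 2 * ((r ^ 3 * tildeNorm s u) * (p ^ 3 * tildeNorm s v)) *
          decay γ r p n := by
  obtain ⟨K₁, hK₁, h₁⟩ := exists_error_pair hγ hs0 hs1
  obtain ⟨K₂, hK₂, h₂⟩ := exists_error_compl hγ hs0 hs1
  refine ⟨|Cs s / 2| * (K₁ + 2 * K₂), by positivity, ?_⟩
  intro 𝒯 h𝒯 r p n u v u₀ v₀ U V hr hp hU hV hu₀ hv₀
  have e₁ := h₁ 𝒯 h𝒯 r p n u v u₀ v₀ U V hr hp hU hV hu₀ hv₀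
  have e₂ := h₂ 𝒯 h𝒯 r p n u v u₀ v₀ U V hr hp hU hV hu₀ hv₀
  have hN := mul_nonneg (by positivity : (0 : ℝ) ≤ (r : ℝ) ^ 3) (tildeNorm_nonneg s u)
  have hN' := mul_nonneg (by positivity : (0 : ℝ) ≤ (p : ℝ) ^ 3) (tildeNorm_nonneg s v)
  have hd := decay_nonneg hγ r p n
  have hM : (1 : ℝ) ≤ 𝒯.M := by exact_mod_cast 𝒯.M_pos
  set E := (r ^ 3 * tildeNorm s u) * (p ^ 3 * tildeNorm s v) with hE
  have hE0 : 0 ≤ E := mul_nonneg hN hN'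
  rw [𝒯.formA_eq_sum hU.lip hV.lip hs0 hs1, Mesh.approxForm, ← mul_sub, abs_mul,
    add_sub_add_comm, ← mul_sub, ← Finset.sum_sub_distrib, ← Finset.sum_sub_distrib]
  simp only [← Finset.sum_sub_distrib]
  have b₁ : ∀ i : Fin 𝒯.M, |∑ j, (∫ z, kern s u v z
      ∂((volume.restrict (𝒯.elt i)).prod (volume.restrict (𝒯.elt j))) - 𝒯.Q s n u₀ v₀ i j)| ≤
      𝒯.M * (K₁ * E * decay γ r p n) := fun i => by
    refine (Finset.abs_sum_le_sum_abs _ _).trans ((Finset.sum_le_sum fun j _ => e₁ i j).trans ?_)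
    simp
  have b₂ := (Finset.abs_sum_le_sum_abs _ Finset.univ).trans (Finset.sum_le_sum fun i _ => b₁ i)
  have b₃ := (Finset.abs_sum_le_sum_abs _ Finset.univ).trans (Finset.sum_le_sum fun i _ => e₂ i)
  simp only [Finset.sum_const, Finset.card_univ, Fintype.card_fin, nsmul_eq_mul] at b₂ b₃
  have hF : 0 ≤ K₂ * E * decay γ r p n := by positivity
  calc _ ≤ |Cs s / 2| * (𝒯.M * (𝒯.M * (K₁ * E * decay γ r p n)) +
        2 * (𝒯.M * (K₂ * E * decay γ r p n))) := by
        refine mul_le_mul_of_nonneg_left ((abs_add_le _ _).trans (add_le_add b₂ ?_)) (abs_nonneg _)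
        rw [abs_mul, abs_two]
        linarith
    _ ≤ |Cs s / 2| * (𝒯.M * (𝒯.M * (K₁ * E * decay γ r p n)) +
        2 * (𝒯.M * (𝒯.M * (K₂ * E * decay γ r p n)))) := by
        -- A mesh has at least one element, so the complement terms, linear in their number, are
        -- absorbed in the square.
        have := mul_le_mul_of_nonneg_right hM hF
        rw [one_mul] at this
        gcongr
    _ = _ := by ring

end

/-! ### Passage to the continuous representatives -/

lemma formA_congr_ae {s : ℝ} {u u' v v' : ℝ → ℝ} (hu : u =ᵐ[volume] u') (hv : v =ᵐ[volume] v') :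
    formA s u v = formA s u' v' := by
  simp only [formA]
  congr 1
  refine integral_congr_ae ?_
  filter_upwards [hu, hv] with x hx hx'
  refine integral_congr_ae ?_
  filter_upwards [hu, hv] with y hy hy'
  rw [hx, hx', hy, hy']

lemma tildeNorm_congr_ae {s : ℝ} {u u' : ℝ → ℝ} (hu : u =ᵐ[volume] u') :
    tildeNorm s u = tildeNorm s u' := by
  have h := ae_restrict_of_ae (s := Om) hu
  have h1 : ∫ x in Om, |u x| ^ 2 = ∫ x in Om, |u' x| ^ 2 :=
    integral_congr_ae (by filter_upwards [h] with x hx; rw [hx])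
  have h2 : ∫ x in Om, |u x / bdryDist x ^ s| ^ 2 = ∫ x in Om, |u' x / bdryDist x ^ s| ^ 2 :=
    integral_congr_ae (by filter_upwards [h] with x hx; rw [hx])
  have h3 : slobSq s u = slobSq s u' := by
    refine integral_congr_ae ?_
    filter_upwards [h] with x hx
    refine integral_congr_ae ?_
    filter_upwards [h] with y hy
    rw [hx, hy]
  rw [tildeNorm, tildeNorm, h1, h2, h3]

lemma tildeNorm_zero (s : ℝ) : tildeNorm s 0 = 0 := by
  simp [tildeNorm, slobSq]

lemma Mesh.IsPiecewisePoly.mono {𝒯 : Mesh} {r p : ℕ} {u : ℝ → ℝ} (hu : 𝒯.IsPiecewisePoly r u)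
    (h : r ≤ p) : 𝒯.IsPiecewisePoly p u :=
  ⟨hu.lip, hu.zero, fun i => (hu.poly i).imp fun _ hq => ⟨hq.1.trans h, hq.2⟩⟩

/-- Splines of degree `r` have a reference representation of degree `max r 1`, and splines of
degree zero vanish. -/
lemma Mesh.exists_isRef_of_mem_spline0 (𝒯 : Mesh) {r : ℕ} {u : ℝ → ℝ} (hu : u ∈ 𝒯.spline0 r) (s : ℝ) :
    ∃ (w : ℝ → ℝ) (U : Fin 𝒯.M → ℝ[X]), 𝒯.IsRef (max r 1) w U ∧ u =ᵐ[volume] w ∧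
      (∀ i, ∀ x ∈ Ioo (0 : ℝ) 1, 𝒯.pull i u x = (U i).eval x) ∧
      ((max r 1 : ℕ) : ℝ) ^ 3 * tildeNorm s w = (r : ℝ) ^ 3 * tildeNorm s u := by
  obtain ⟨w, hw, hwe, hae⟩ := 𝒯.exists_isPiecewisePoly hu
  obtain ⟨U, hU⟩ := (hw.mono (le_max_left r 1)).exists_isRef
  refine ⟨w, U, hU, hae, fun i x hx => ?_, ?_⟩
  · rw [← hU.eval i x (Ioo_subset_Icc_self hx), Mesh.pull]
    refine hwe i _ ?_
    have hh := 𝒯.h_pos i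
    have e : 𝒯.hi i = 𝒯.lo i + 𝒯.h i := by simp [Mesh.h]
    refine ⟨?_, ?_⟩
    · nlinarith [hx.1]
    · rw [e]; nlinarith [hx.2]
  · rw [tildeNorm_congr_ae hae]
    rcases eq_or_ne r 0 with rfl | hr
    · rw [hw.eq_zero, tildeNorm_zero, mul_zero, mul_zero]
    · rw [max_eq_left (Nat.one_le_iff_ne_zero.2 hr)]

end FracLap

theorem mainTheorem4 (γ : ℝ) (hγ : 0 < γ) :
    ∃ ρ : ℝ, 1 < ρ ∧ ∀ s : ℝ, 0 < s → s < 1 →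
      ∃ C : ℝ, 0 < C ∧ ∀ 𝒯 : FracLap.Mesh, 𝒯.ShapeRegular γ →
        ∀ (r p n : ℕ) (u v : ℝ → ℝ), u ∈ 𝒯.spline0 r → v ∈ 𝒯.spline0 p →
          |FracLap.formA s u v - 𝒯.approxForm s n u v| ≤
            C * (𝒯.M : ℝ) ^ 2 * ρ ^ ((r : ℤ) + (p : ℤ) - 2 * (n : ℤ) + 1) *
              (r : ℝ) ^ 3 * (p : ℝ) ^ 3 * FracLap.tildeNorm s u * FracLap.tildeNorm s v := by
  refine ⟨(FracLap.rate γ)⁻¹, (one_lt_inv₀ (FracLap.rate_pos hγ)).2 (FracLap.rate_lt_one hγ),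
    fun s hs0 hs1 => ?_⟩
  obtain ⟨K, hK, h⟩ := FracLap.exists_consistency_error hγ hs0 hs1
  -- The constant obtained so far may be zero, hence the added $1$.
  refine ⟨K + 1, by positivity, fun 𝒯 h𝒯 r p n u v hu hv => ?_⟩
  obtain ⟨u', U, hU, hau, hpu, hnu⟩ := 𝒯.exists_isRef_of_mem_spline0 hu s
  obtain ⟨v', V, hV, hav, hpv, hnv⟩ := 𝒯.exists_isRef_of_mem_spline0 hv s
  have key := h 𝒯 h𝒯 _ _ n u' v' u v U V (by omega) (by omega) hU hV hpu hpv
  rw [hnu, hnv, ← FracLap.formA_congr_ae hau hav] at key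
  have hu0 := FracLap.tildeNorm_nonneg s u
  have hv0 := FracLap.tildeNorm_nonneg s v
  -- In degree zero the factor $r^3$ or $p^3$ annihilates both bounds, so the exponent with
  -- $\max(r,1)$ or $\max(p,1)$ in `key` is harmless.
  rcases eq_or_ne r 0 with rfl | hr
  · simpa using key
  rcases eq_or_ne p 0 with rfl | hp
  · simpa using key
  rw [max_eq_left (Nat.one_le_iff_ne_zero.2 hr), max_eq_left (Nat.one_le_iff_ne_zero.2 hp)] at key
  have hρ : (FracLap.rate γ)⁻¹ ^ ((r : ℤ) + (p : ℤ) - 2 * (n : ℤ) + 1) = FracLap.decay γ r p n := by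
    rw [inv_zpow', FracLap.decay]
    congr 1
    push_cast
    ring
  rw [hρ]
  have hd := FracLap.decay_nonneg hγ r p n
  calc _ ≤ K * (𝒯.M : ℝ) ^ 2 * ((r ^ 3 * FracLap.tildeNorm s u) * (p ^ 3 * FracLap.tildeNorm s v)) *
        FracLap.decay γ r p n := key
    _ ≤ (K + 1) * (𝒯.M : ℝ) ^ 2 *
        ((r ^ 3 * FracLap.tildeNorm s u) * (p ^ 3 * FracLap.tildeNorm s v)) *
        FracLap.decay γ r p n := by gcongr; linarith
    _ = _ := by ring
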